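/- **Setting.** Fix a horizon $n\ge 1$, a power $\kappa\ge 0$, and a scalar Gaussian noise $V^n=(V_1,\dots,V_n)$ with partially observable state-space realization $$S_{t+1}=A_tS_t+B_tW_t,\qquad V_t=C_tS_t+N_tW_t,\qquad t=1,\dots,n,$$ where $S_t\in\mathbb R^{n_s}$, $W_t\in\mathbb R^{n_w}$, $S_1\sim N(\mu_{S_1},K_{S_1})$, $W_t\sim N(0,K_{W_t})$ are mutually independent, $K_{S_1}\succeq0$, $K_{W_t}\succeq 0$, $N_tK_{W_t}N_t^T>0$, and all coefficients are nonrandom. ($A_n,B_n$ are arbitrary; they enter only the quantities with index $n+1$.) A superscript $t$ denotes the tuple of variables up to time $t$; $H(\cdot)$ is differential entropy. The channel is $Y_t=X_t+V_t$. With $K_{V^n}$ the covariance matrix of $V^n$, the Cover–Pombra $n$-FTFI capacity is $$C_n^{fb}(\kappa)=\max\ \tfrac12\log\frac{\det\big((B+I)K_{V^n}(B+I)^T+K_{\overline Z}\big)}{\det K_{V^n}}$$ over strictly lower triangular $B$ and $K_{\overline Z}\succeq0$ with $\frac1n\mathrm{trace}(BK_{V^n}B^T+K_{\overline Z})\le\kappa$.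 **Filter for the noise.** Let $\hat S_t=E\{S_t|V^{t-1}\}$, $\hat I_t=V_t-E\{V_t|V^{t-1}\}$ and let $\Sigma_t$ be the conditional covariance of $S_t$ given $V^{t-1}$, which is nonrandom and equals $E\{(S_t-\hat S_t)(S_t-\hat S_t)^T\}$. Then $\hat I_t=V_t-C_t\hat S_t=C_t(S_t-\hat S_t)+N_tW_t$, the $\hat I_t\sim N(0,K_{\hat I_t})$ are independent, $\hat I_t$ is independent of $V^{t-1}$, the conditional variance of $V_t$ given $V^{t-1}$ is $K_{\hat I_t}$, and $$K_{\hat I_t}=C_t\Sigma_tC_t^T+N_tK_{W_t}N_t^T,\qquad M_t=(A_t\Sigma_tC_t^T+B_tK_{W_t}N_t^T)K_{\hat I_t}^{-1},\qquad \hat S_{t+1}=A_t\hat S_t+M_t\hat I_t,\quad \hat S_1=\mu_{S_1},$$ $$\Sigma_{t+1}=A_t\Sigma_tA_t^T+B_tK_{W_t}B_t^T-M_tK_{\hat I_t}M_t^T,\quad \Sigma_1=K_{S_1},\quad \Sigma_t\succeq 0;$$ moreover $H(V^n)=\frac12\sum_{t=1}^n\log(2\pi eK_{\hat I_t})$. **(a)**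 $C_n^{fb}(\kappa)=\sup\big\{\sum_{t=1}^nH(Y_t|Y^{t-1})-H(V^n)\big\}$ over all families of conditional distributions $P_t(dx_t|\hat s_t,y^{t-1})$, $t=1,\dots,n$, that are Gaussian with mean linear (possibly with a constant term) in $(\hat s_t,y^{t-1})$ and nonrandom variance and satisfy $\frac1nE\sum_t X_t^2\le\kappa$, where, given $X^{t-1}$ and $V^n$, the input $X_t$ has distribution $P_t(\cdot|\hat S_t,Y^{t-1})$; the supremum is attained. For every such family (without the power constraint) a corresponding process exists, $(X^n,Y^n)$ is jointly Gaussian, $V_t=C_t\hat S_t+\hat I_t$, the conditional distribution of $Y_t$ given $(Y^{t-1},X^t,\hat S_t)$ is $P_t(dy|X_t,\hat S_t)=N(X_t+C_t\hat S_t,K_{\hat I_t})$, the conditional distribution of $Y_t$ given $Y^{t-1}$ is $$P_t(dy_t|y^{t-1})=\int P_t(dy_t|x_t,\hat s_t)\,P_t(dx_t|\hat s_t,y^{t-1})\,P_t(d\hat s_t|y^{t-1}),$$ and it is Gaussian with mean linear (with a constant term) in $y^{t-1}$ and nonrandom variance. **(b)** Every optimal process of (a) has, almost surely, the form $$X_t=\Lambda_t\big(\hat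 S_t-\widehat{\hat S}_t\big)+Z_t,\qquad \widehat{\hat S}_t=E\{\hat S_t|Y^{t-1}\},\qquad t=1,\dots,n, \qquad(*)$$ with nonrandom $\Lambda_t\in\mathbb R^{1\times n_s}$ and independent $Z_t\sim N(0,K_{Z_t})$, $Z^n$ independent of $V^n$. For all $\Lambda_t$ and $K_{Z_t}\ge0$ a process $(*)$ exists, and every process $(*)$ belongs to the class in (a) (without the power constraint) and satisfies the following, for $t=1,\dots,n$. $Z_t$ is independent of $(X^{t-1},V^{t-1},\hat S^t,\widehat{\hat S}{}^t,\hat I^t,Y^{t-1})$; $\hat I_t$ is independent of $(X^{t-1},V^{t-1},\hat S^t,Y^{t-1},\widehat{\hat S}{}^t)$; $Y_t=\Lambda_t(\hat S_t-\widehat{\hat S}_t)+C_t\hat S_t+\hat I_t+Z_t$; and $\frac1nE\sum_{t}X_t^2=\frac1n\sum_{t}(\Lambda_tK_t\Lambda_t^T+K_{Z_t})$, where $K_t$ is the conditional covariance of $\hat S_t$ given $Y^{t-1}$, which is nonrandom and equals $E\{(\hat S_t-\widehat{\hat S}_t)(\hat S_t-\widehat{\hat S}_t)^T\}$. With $I_t=Y_t-E\{Y_t|Y^{t-1}\}$: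 (i) $I_t=Y_t-C_t\widehat{\hat S}_t=(\Lambda_t+C_t)(\hat S_t-\widehat{\hat S}_t)+\hat I_t+Z_t$; the $I_t\sim N(0,K_{I_t})$ are independent, $I_t$ is independent of $Y^{t-1}$, the conditional variance of $Y_t$ given $Y^{t-1}$ is $$K_{I_t}=(\Lambda_t+C_t)K_t(\Lambda_t+C_t)^T+K_{\hat I_t}+K_{Z_t},$$ and $\widehat{\hat S}_{t+1}=A_t\widehat{\hat S}_t+F_tI_t$, $\widehat{\hat S}_1=\mu_{S_1}$, with $F_t=\big(A_tK_t(\Lambda_t+C_t)^T+M_tK_{\hat I_t}\big)K_{I_t}^{-1}$. (ii) $K_{t+1}=A_tK_tA_t^T+M_tK_{\hat I_t}M_t^T-F_tK_{I_t}F_t^T$, $K_1=0$, $K_t\succeq0$. **(c)** With processes of the form $(*)$, $$C_n^{fb}(\kappa)=\sup_{\frac1nE\sum_tX_t^2\le\kappa}\ \frac12\sum_{t=1}^n\log\frac{K_{I_t}}{K_{\hat I_t}}=\sup_{\frac1n\sum_{t}(\Lambda_tK_t\Lambda_t^T+K_{Z_t})\le\kappa}\ \frac12\sum_{t=1}^n\log\frac{(\Lambda_t+C_t)K_t(\Lambda_t+C_t)^T+K_{\hat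 I_t}+K_{Z_t}}{K_{\hat I_t}},$$ the suprema being over $(\Lambda_t,K_{Z_t})$, $K_{Z_t}\ge 0$, $t=1,\dots,n$, and attained. -/

import Mathlib

open MeasureTheory ProbabilityTheory Matrix
open scoped NNReal ENNReal

/-! ### Differential entropy -/

/-- Differential entropy (in nats) `H(μ) = - ∫ f log f` of a law `μ` with density
`f = dμ/dvolume`.  It is meaningful under `HasDiffEntropy μ`. -/
noncomputable def diffEntropy {E : Type*} [MeasureSpace E] (μ : Measure E) : ℝ :=
  -∫ x, Real.log (μ.rnDeriv volume x).toReal ∂μ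

/-- The law `μ` has a density and its differential entropy exists and is finite. -/
def HasDiffEntropy {E : Type*} [MeasureSpace E] (μ : Measure E) : Prop :=
  μ ≪ (volume : Measure E) ∧ Integrable (fun x => Real.log (μ.rnDeriv volume x).toReal) μ

/-- Conditional differential entropy `H(Y | U)`: the average over `U` of the entropy of the
conditional distribution of `Y` given `U`. -/
noncomputable def condDiffEntropy {Ω E : Type*} [MeasurableSpace Ω] [MeasurableSpace E]
    (P : Measure Ω) [IsFiniteMeasure P] (Y : Ω → ℝ) (U : Ω → E) : ℝ :=
  ∫ u, diffEntropy (condDistrib Y U P u) ∂(P.map U)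

/-! ### Processes, predictions and innovations

Times are numbered from `0`: index `t` here is time `t + 1` in the usual numbering
`1, …, n`. -/

/-- The first `m` variables of a process, as one random vector. -/
def block {Ω E : Type*} (X : ℕ → Ω → E) (m : ℕ) : Ω → Fin m → E := fun ω j => X j ω

/-- The σ-algebra generated by the variables of `V` with index `< t` (trivial for `t = 0`). -/
abbrev pastSigma {Ω : Type*} (V : ℕ → Ω → ℝ) (t : ℕ) : MeasurableSpace Ω :=
  MeasurableSpace.comap (block V t) inferInstance

/-- `E{U | V₀, …, V_{t-1}}`. -/
noncomputable def predict {Ω E : Type*} [MeasurableSpace Ω] [NormedAddCommGroup E]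
    [NormedSpace ℝ E] [CompleteSpace E] (P : Measure Ω) (V : ℕ → Ω → ℝ) (t : ℕ) (U : Ω → E) :
    Ω → E :=
  P[U | pastSigma V t]

/-- The innovation `V_t - E{V_t | V₀, …, V_{t-1}}`. -/
noncomputable def innov {Ω : Type*} [MeasurableSpace Ω] (P : Measure Ω) (V : ℕ → Ω → ℝ) (t : ℕ) :
    Ω → ℝ :=
  fun ω => V t ω - predict P V t (V t) ω

/-- The error covariance matrix `E{(U - U') (U - U')ᵀ}`. -/
noncomputable def errCov {Ω : Type*} [MeasurableSpace Ω] {k : ℕ} (P : Measure Ω)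
    (U U' : Ω → Fin k → ℝ) : Matrix (Fin k) (Fin k) ℝ :=
  Matrix.of fun i j => ∫ ω, (U ω i - U' ω i) * (U ω j - U' ω j) ∂P

/-- The average power `(1/n) E{∑_{t<n} X_t²}`. -/
noncomputable def avgPower {Ω : Type*} [MeasurableSpace Ω] (P : Measure Ω) (n : ℕ)
    (X : ℕ → Ω → ℝ) : ℝ :=
  (n : ℝ)⁻¹ * ∫ ω, ∑ t ∈ Finset.range n, (X t ω) ^ 2 ∂P

/-! ### The noise model -/

/-- Parameters of a time-varying partially observable state space realization, over the horizon
`n`, of a scalar Gaussian noise: `S_{t+1} = A_t S_t + B_t W_t`, `V_t = C_t S_t + N_t W_t`.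
The row vectors `C_t`, `N_t` are stored as vectors. -/
structure NoiseModel (ns nw n : ℕ) where
  A : ℕ → Matrix (Fin ns) (Fin ns) ℝ
  B : ℕ → Matrix (Fin ns) (Fin nw) ℝ
  C : ℕ → Fin ns → ℝ
  N : ℕ → Fin nw → ℝ
  /-- mean of the initial state -/
  mu : Fin ns → ℝ
  /-- covariance of the initial state -/
  K₁ : Matrix (Fin ns) (Fin ns) ℝ
  /-- covariances of the driving noise -/
  KW : ℕ → Matrix (Fin nw) (Fin nw) ℝ
  K₁_psd : K₁.PosSemidef
  KW_psd : ∀ t < n, (KW t).PosSemidef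
  R_pos : ∀ t < n, 0 < N t ⬝ᵥ KW t *ᵥ N t

namespace NoiseModel

variable {ns nw n : ℕ} {Ω : Type*}

/-- The state process `S`. -/
def state (M : NoiseModel ns nw n) (S₁ : Ω → Fin ns → ℝ) (W : ℕ → Ω → Fin nw → ℝ) :
    ℕ → Ω → Fin ns → ℝ
  | 0 => S₁
  | t + 1 => fun ω => M.A t *ᵥ M.state S₁ W t ω + M.B t *ᵥ W t ω

/-- The noise process `V`. -/
def noise (M : NoiseModel ns nw n) (S₁ : Ω → Fin ns → ℝ) (W : ℕ → Ω → Fin nw → ℝ) (t : ℕ) :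
    Ω → ℝ :=
  fun ω => M.C t ⬝ᵥ M.state S₁ W t ω + M.N t ⬝ᵥ W t ω

/-- `S₁ ∼ N(mu, K₁)`, the `W_t ∼ N(0, KW_t)` are independent, and `S₁` is independent of
`W`. -/
structure IsDrivenBy [MeasurableSpace Ω] (M : NoiseModel ns nw n) (P : Measure Ω)
    (S₁ : Ω → Fin ns → ℝ) (W : ℕ → Ω → Fin nw → ℝ) : Prop where
  meas_S : Measurable S₁
  meas_W : ∀ t < n, Measurable (W t)
  law_S : HasLaw (fun ω => WithLp.toLp 2 (S₁ ω))
    (multivariateGaussian (WithLp.toLp 2 M.mu) M.K₁) P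
  law_W : ∀ t < n, HasLaw (fun ω => WithLp.toLp 2 (W t ω)) (multivariateGaussian 0 (M.KW t)) P
  indep_W : iIndepFun (fun (t : Fin n) => W t) P
  indep_SW : IndepFun S₁ (block W n) P

/-- The state estimate from the noise, `Ŝ_t = E{S_t | V^{t-1}}`. -/
noncomputable def est [MeasurableSpace Ω] (M : NoiseModel ns nw n) (P : Measure Ω)
    (S₁ : Ω → Fin ns → ℝ) (W : ℕ → Ω → Fin nw → ℝ) (t : ℕ) : Ω → Fin ns → ℝ :=
  predict P (M.noise S₁ W) t (M.state S₁ W t)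

/-- The channel output `Y_t = X_t + V_t`. -/
def output (M : NoiseModel ns nw n) (S₁ : Ω → Fin ns → ℝ) (W : ℕ → Ω → Fin nw → ℝ)
    (X : ℕ → Ω → ℝ) (t : ℕ) : Ω → ℝ :=
  fun ω => X t ω + M.noise S₁ W t ω

/-- The estimate of `Ŝ_t` from the channel output, `E{Ŝ_t | Y^{t-1}}`. -/
noncomputable def estEst [MeasurableSpace Ω] (M : NoiseModel ns nw n) (P : Measure Ω)
    (S₁ : Ω → Fin ns → ℝ) (W : ℕ → Ω → Fin nw → ℝ) (X : ℕ → Ω → ℝ) (t : ℕ) :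
    Ω → Fin ns → ℝ :=
  predict P (M.output S₁ W X) t (M.est P S₁ W t)

/-- The covariance matrix of the noise vector `(V_t)_{t<n}`. -/
noncomputable def noiseCov [MeasurableSpace Ω] (M : NoiseModel ns nw n) (P : Measure Ω)
    (S₁ : Ω → Fin ns → ℝ) (W : ℕ → Ω → Fin nw → ℝ) : Matrix (Fin n) (Fin n) ℝ :=
  Matrix.of fun i j => cov[M.noise S₁ W i, M.noise S₁ W j; P]

/-! ### The two generalized Riccati difference equations -/

/-- `C_t Σ C_tᵀ + N_t KW_t N_tᵀ`. -/
def innovVarOf (M : NoiseModel ns nw n) (t : ℕ) (Sg : Matrix (Fin ns) (Fin ns) ℝ) : ℝ :=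
  M.C t ⬝ᵥ Sg *ᵥ M.C t + M.N t ⬝ᵥ M.KW t *ᵥ M.N t

/-- `A_t Σ C_tᵀ + B_t KW_t N_tᵀ`. -/
def crossOf (M : NoiseModel ns nw n) (t : ℕ) (Sg : Matrix (Fin ns) (Fin ns) ℝ) : Fin ns → ℝ :=
  M.A t *ᵥ (Sg *ᵥ M.C t) + M.B t *ᵥ (M.KW t *ᵥ M.N t)

/-- The solution `Σ_t` of the first Riccati equation. -/
noncomputable def Sig (M : NoiseModel ns nw n) : ℕ → Matrix (Fin ns) (Fin ns) ℝ
  | 0 => M.K₁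
  | t + 1 => M.A t * M.Sig t * (M.A t)ᵀ + M.B t * M.KW t * (M.B t)ᵀ
      - (M.innovVarOf t (M.Sig t))⁻¹ •
        vecMulVec (M.crossOf t (M.Sig t)) (M.crossOf t (M.Sig t))

/-- The variance `C_t Σ_t C_tᵀ + N_t KW_t N_tᵀ` of the innovation of the noise. -/
noncomputable def KIhat (M : NoiseModel ns nw n) (t : ℕ) : ℝ := M.innovVarOf t (M.Sig t)

/-- The gain `M_t(Σ_t)` of the first filter. -/
noncomputable def gainM (M : NoiseModel ns nw n) (t : ℕ) : Fin ns → ℝ :=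
  (M.KIhat t)⁻¹ • M.crossOf t (M.Sig t)

/-- `(Λ_t + C_t) K (Λ_t + C_t)ᵀ + KIhat_t + K_{Z_t}`. -/
noncomputable def outVarOf (M : NoiseModel ns nw n) (L : ℕ → Fin ns → ℝ) (KZ : ℕ → ℝ≥0) (t : ℕ)
    (K : Matrix (Fin ns) (Fin ns) ℝ) : ℝ :=
  (L t + M.C t) ⬝ᵥ K *ᵥ (L t + M.C t) + M.KIhat t + KZ t

/-- `A_t K (Λ_t + C_t)ᵀ + M_t(Σ_t) KIhat_t`. -/
noncomputable def outCrossOf (M : NoiseModel ns nw n) (L : ℕ → Fin ns → ℝ) (t : ℕ)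
    (K : Matrix (Fin ns) (Fin ns) ℝ) : Fin ns → ℝ :=
  M.A t *ᵥ (K *ᵥ (L t + M.C t)) + M.KIhat t • M.gainM t

/-- The solution `K_t` of the second Riccati equation, for the input gains `L` and the input
noise variances `KZ`. -/
noncomputable def KFb (M : NoiseModel ns nw n) (L : ℕ → Fin ns → ℝ) (KZ : ℕ → ℝ≥0) :
    ℕ → Matrix (Fin ns) (Fin ns) ℝ
  | 0 => 0
  | t + 1 => M.A t * M.KFb L KZ t * (M.A t)ᵀ + M.KIhat t • vecMulVec (M.gainM t) (M.gainM t)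
      - (M.outVarOf L KZ t (M.KFb L KZ t))⁻¹ •
        vecMulVec (M.outCrossOf L t (M.KFb L KZ t)) (M.outCrossOf L t (M.KFb L KZ t))

/-- The variance `K_{I_t}` of the innovation of the channel output. -/
noncomputable def KI (M : NoiseModel ns nw n) (L : ℕ → Fin ns → ℝ) (KZ : ℕ → ℝ≥0) (t : ℕ) : ℝ :=
  M.outVarOf L KZ t (M.KFb L KZ t)

/-- The gain `F_t(Σ_t, K_t)` of the second filter. -/
noncomputable def gainF (M : NoiseModel ns nw n) (L : ℕ → Fin ns → ℝ) (KZ : ℕ → ℝ≥0) (t : ℕ) :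
    Fin ns → ℝ :=
  (M.KI L KZ t)⁻¹ • M.outCrossOf L t (M.KFb L KZ t)

end NoiseModel

/-! ### The Cover-Pombra `n`-FTFI capacity -/

/-- The rates `½ log (det((B+I) K_V (B+I)ᵀ + K_Z) / det K_V)` achievable by inputs `X = B V + Z`
with `B` strictly lower triangular, `Z ∼ N(0, K_Z)` independent of the noise `V`, and
`(1/n) trace(B K_V Bᵀ + K_Z) ≤ κ`. -/
def coverPombraRates {n : ℕ} (KV : Matrix (Fin n) (Fin n) ℝ) (κ : ℝ) : Set ℝ :=
  {r | ∃ B KZ : Matrix (Fin n) (Fin n) ℝ, (∀ i j, i ≤ j → B i j = 0) ∧ KZ.PosSemidef ∧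
    (n : ℝ)⁻¹ * (B * KV * Bᵀ + KZ).trace ≤ κ ∧
    r = 1 / 2 * Real.log (((B + 1) * KV * (B + 1)ᵀ + KZ).det / KV.det)}

/-- The Cover-Pombra `n`-FTFI capacity for a noise with covariance matrix `KV`. -/
noncomputable def ftfiCapacity {n : ℕ} (KV : Matrix (Fin n) (Fin n) ℝ) (κ : ℝ) : ℝ :=
  sSup (coverPombraRates KV κ)

namespace NoiseModel

variable {ns nw n : ℕ} {Ω : Type*}

/-! ### Input distributions depending on `(Ŝ_t, Y^{t-1})` -/

/-- A family of conditional input distributions `P_t(dx_t | ŝ_t, y^{t-1})`. -/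
abbrev InputKernels (ns : ℕ) : Type :=
  ∀ t : ℕ, Kernel ((Fin ns → ℝ) × (Fin t → ℝ)) ℝ

/-- `P_t(dx_t | ŝ_t, y^{t-1})` is Gaussian, its mean is linear (with a constant term) in
`(ŝ_t, y^{t-1})` and its variance is nonrandom. -/
def IsGaussianInput (n : ℕ) (π : InputKernels ns) : Prop :=
  ∀ t < n, ∃ (a : ℝ) (b : Fin ns → ℝ) (g : Fin t → ℝ) (v : ℝ≥0),
    ∀ (s : Fin ns → ℝ) (y : Fin t → ℝ), π t (s, y) = gaussianReal (a + b ⬝ᵥ s + g ⬝ᵥ y) v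

/-- The input process `X` is generated by the conditional distributions `π`, causally in the
noise: given `X^{t-1}` and the whole noise `V^n`, the input `X_t` has the distribution
`P_t(dx_t | Ŝ_t, Y^{t-1})`. -/
structure Generates [MeasurableSpace Ω] (M : NoiseModel ns nw n) (P : Measure Ω)
    (S₁ : Ω → Fin ns → ℝ) (W : ℕ → Ω → Fin nw → ℝ) (π : InputKernels ns) (X : ℕ → Ω → ℝ) :
    Prop where
  meas : ∀ t < n, Measurable (X t)
  cond : ∀ t < n, HasCondDistrib (X t)
    (fun ω => ((block X t ω, block (M.noise S₁ W) n ω),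
      (M.est P S₁ W t ω, block (M.output S₁ W X) t ω)))
    (Kernel.prodMkLeft _ (π t)) P

/-- The value `∑_t H(Y_t | Y^{t-1}) - H(V^n)` of an input process. -/
noncomputable def inputRate [MeasurableSpace Ω] (M : NoiseModel ns nw n) (P : Measure Ω)
    [IsFiniteMeasure P] (S₁ : Ω → Fin ns → ℝ) (W : ℕ → Ω → Fin nw → ℝ) (X : ℕ → Ω → ℝ) : ℝ :=
  ∑ t ∈ Finset.range n, condDiffEntropy P (M.output S₁ W X t) (block (M.output S₁ W X) t)
    - diffEntropy (P.map (block (M.noise S₁ W) n))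

/-- The values `∑_t H(Y_t | Y^{t-1}) - H(V^n)` over all Gaussian input distributions
`P_t(dx_t | ŝ_t, y^{t-1})` of power at most `κ`. -/
def inputRates (M : NoiseModel ns nw n) (κ : ℝ) : Set ℝ :=
  {r | ∃ (Ω : Type) (_ : MeasurableSpace Ω) (P : Measure Ω) (_ : IsProbabilityMeasure P)
    (S₁ : Ω → Fin ns → ℝ) (W : ℕ → Ω → Fin nw → ℝ) (π : InputKernels ns) (X : ℕ → Ω → ℝ),
    M.IsDrivenBy P S₁ W ∧ IsGaussianInput n π ∧ M.Generates P S₁ W π X ∧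
    avgPower P n X ≤ κ ∧ r = M.inputRate P S₁ W X}

/-- The channel law `P_t(dy | x_t, ŝ_t)`, Gaussian with mean `x_t + C_t ŝ_t` and variance
`KIhat_t`. -/
noncomputable def channel (M : NoiseModel ns nw n) (t : ℕ) : Kernel (ℝ × (Fin ns → ℝ)) ℝ where
  toFun p := gaussianReal (p.1 + M.C t ⬝ᵥ p.2) (M.KIhat t).toNNReal
  measurable' := by
    have h : Measurable fun p : ℝ × (Fin ns → ℝ) =>
        (p.1 + M.C t ⬝ᵥ p.2, (M.KIhat t).toNNReal) := by
      unfold dotProduct; fun_prop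
    exact measurable_gaussianReal.comp h

/-! ### Inputs in terms of the sufficient statistic -/

/-- The input process is `X_t = Λ_t (Ŝ_t - E{Ŝ_t | Y^{t-1}}) + Z_t`, where the
`Z_t ∼ N(0, K_{Z_t})` are independent, and independent of the noise `V^n`. -/
structure IsSuffStatInput [MeasurableSpace Ω] (M : NoiseModel ns nw n) (P : Measure Ω)
    (S₁ : Ω → Fin ns → ℝ) (W : ℕ → Ω → Fin nw → ℝ) (L : ℕ → Fin ns → ℝ) (KZ : ℕ → ℝ≥0)
    (Z X : ℕ → Ω → ℝ) : Prop where
  meas_X : ∀ t < n, Measurable (X t)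
  meas_Z : ∀ t < n, Measurable (Z t)
  law_Z : ∀ t < n, HasLaw (Z t) (gaussianReal 0 (KZ t)) P
  indep_Z : iIndepFun (fun (t : Fin n) => Z t) P
  indep_ZV : IndepFun (block Z n) (block (M.noise S₁ W) n) P
  repr : ∀ t < n, X t =ᵐ[P] fun ω =>
    L t ⬝ᵥ (M.est P S₁ W t ω - M.estEst P S₁ W X t ω) + Z t ω

/-- The values `½ ∑_t log (K_{I_t} / K_{Î_t})`, through the variances of the innovations of
output and noise, over all `(Λ, K_Z)` whose input process has power at most `κ`. -/
def suffStatRates (M : NoiseModel ns nw n) (κ : ℝ) : Set ℝ :=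
  {r | ∃ (L : ℕ → Fin ns → ℝ) (KZ : ℕ → ℝ≥0)
    (Ω : Type) (_ : MeasurableSpace Ω) (P : Measure Ω) (_ : IsProbabilityMeasure P)
    (S₁ : Ω → Fin ns → ℝ) (W : ℕ → Ω → Fin nw → ℝ) (Z X : ℕ → Ω → ℝ),
    M.IsDrivenBy P S₁ W ∧ M.IsSuffStatInput P S₁ W L KZ Z X ∧ avgPower P n X ≤ κ ∧
    r = 1 / 2 * ∑ t ∈ Finset.range n, Real.log
      (Var[innov P (M.output S₁ W X) t; P] / Var[innov P (M.noise S₁ W) t; P])}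

/-- The values of the explicit formula in terms of the two Riccati equations, over all
`(Λ, K_Z)` with `(1/n) ∑_t (Λ_t K_t Λ_tᵀ + K_{Z_t}) ≤ κ`. -/
def riccatiRates (M : NoiseModel ns nw n) (κ : ℝ) : Set ℝ :=
  {r | ∃ (L : ℕ → Fin ns → ℝ) (KZ : ℕ → ℝ≥0),
    (n : ℝ)⁻¹ * ∑ t ∈ Finset.range n, (L t ⬝ᵥ M.KFb L KZ t *ᵥ L t + KZ t) ≤ κ ∧
    r = 1 / 2 * ∑ t ∈ Finset.range n, Real.log
      (((L t + M.C t) ⬝ᵥ M.KFb L KZ t *ᵥ (L t + M.C t) + M.KIhat t + KZ t) / M.KIhat t)}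

/-! ### The claims about the processes -/

/-- The generalized Kalman filter for the noise: recursion for `Ŝ_t`, the innovations of the
noise, the error covariances `Σ_t`, and the entropy of the noise. -/
structure NoiseFilterClaims [MeasurableSpace Ω] (M : NoiseModel ns nw n) (P : Measure Ω)
    [IsProbabilityMeasure P] (S₁ : Ω → Fin ns → ℝ) (W : ℕ → Ω → Fin nw → ℝ) : Prop where
  est_init : M.est P S₁ W 0 =ᵐ[P] fun _ => M.mu
  est_step : ∀ t < n, M.est P S₁ W (t + 1) =ᵐ[P] fun ω =>
    M.A t *ᵥ M.est P S₁ W t ω + innov P (M.noise S₁ W) t ω • M.gainM t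
  innov_eq : ∀ t < n, innov P (M.noise S₁ W) t =ᵐ[P] fun ω =>
    M.noise S₁ W t ω - M.C t ⬝ᵥ M.est P S₁ W t ω
  innov_eq_err : ∀ t < n, innov P (M.noise S₁ W) t =ᵐ[P] fun ω =>
    M.C t ⬝ᵥ (M.state S₁ W t ω - M.est P S₁ W t ω) + M.N t ⬝ᵥ W t ω
  KIhat_pos : ∀ t < n, 0 < M.KIhat t
  innov_law : ∀ t < n, HasLaw (innov P (M.noise S₁ W) t) (gaussianReal 0 (M.KIhat t).toNNReal) P
  innov_indep : iIndepFun (fun (t : Fin n) => innov P (M.noise S₁ W) t) P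
  innov_indep_past : ∀ t < n, IndepFun (innov P (M.noise S₁ W) t) (block (M.noise S₁ W) t) P
  noise_condVar : ∀ t < n,
    predict P (M.noise S₁ W) t (fun ω => (innov P (M.noise S₁ W) t ω) ^ 2) =ᵐ[P]
      fun _ => M.KIhat t
  errCov_eq : ∀ t ≤ n, errCov P (M.state S₁ W t) (M.est P S₁ W t) = M.Sig t
  condCov_eq : ∀ t ≤ n, ∀ i j, predict P (M.noise S₁ W) t (fun ω =>
      (M.state S₁ W t ω i - M.est P S₁ W t ω i) * (M.state S₁ W t ω j - M.est P S₁ W t ω j))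
    =ᵐ[P] fun _ => M.Sig t i j
  Sig_psd : ∀ t ≤ n, (M.Sig t).PosSemidef
  entropy_exists : HasDiffEntropy (P.map (block (M.noise S₁ W) n))
  entropy_eq : diffEntropy (P.map (block (M.noise S₁ W) n)) =
    1 / 2 * ∑ t ∈ Finset.range n, Real.log (2 * Real.pi * Real.exp 1 * M.KIhat t)

/-- The joint law of input and output induced by Gaussian input distributions
`P_t(dx_t | ŝ_t, y^{t-1})`. -/
structure InducedLawClaims [MeasurableSpace Ω] (M : NoiseModel ns nw n) (P : Measure Ω)
    [IsProbabilityMeasure P] (S₁ : Ω → Fin ns → ℝ) (W : ℕ → Ω → Fin nw → ℝ)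
    (π : InputKernels ns) (X : ℕ → Ω → ℝ) : Prop where
  jointly_gaussian : HasGaussianLaw (fun ω => (block X n ω, block (M.output S₁ W X) n ω)) P
  noise_eq : ∀ t < n, M.noise S₁ W t =ᵐ[P] fun ω =>
    M.C t ⬝ᵥ M.est P S₁ W t ω + innov P (M.noise S₁ W) t ω
  channel_law : ∀ t < n, HasCondDistrib (M.output S₁ W X t)
    (fun ω => ((block (M.output S₁ W X) t ω, block X t ω), (X t ω, M.est P S₁ W t ω)))
    (Kernel.prodMkLeft _ (M.channel t)) P
  output_law : ∀ t < n, ∀ᵐ y ∂(P.map (block (M.output S₁ W X) t)),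
    condDistrib (M.output S₁ W X t) (block (M.output S₁ W X) t) P y =
      (condDistrib (M.est P S₁ W t) (block (M.output S₁ W X) t) P y).bind
        fun s => (π t (s, y)).bind fun x => M.channel t (x, s)
  output_gaussian : ∀ t < n, ∃ (a : ℝ) (g : Fin t → ℝ) (v : ℝ≥0),
    ∀ᵐ y ∂(P.map (block (M.output S₁ W X) t)),
      condDistrib (M.output S₁ W X t) (block (M.output S₁ W X) t) P y =
        gaussianReal (a + g ⬝ᵥ y) v
  entropy_exists : ∀ t < n,
    (∀ᵐ y ∂(P.map (block (M.output S₁ W X) t)), HasDiffEntropy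
      (condDistrib (M.output S₁ W X t) (block (M.output S₁ W X) t) P y)) ∧
    Integrable (fun y => diffEntropy
      (condDistrib (M.output S₁ W X t) (block (M.output S₁ W X) t) P y))
      (P.map (block (M.output S₁ W X) t))

/-- The properties of an input `X_t = Λ_t (Ŝ_t - E{Ŝ_t | Y^{t-1}}) + Z_t`: independence, power,
and the generalized Kalman filter for `E{Ŝ_t | Y^{t-1}}` with error covariances `K_t`. -/
structure FeedbackFilterClaims [MeasurableSpace Ω] (M : NoiseModel ns nw n) (P : Measure Ω)
    [IsProbabilityMeasure P] (S₁ : Ω → Fin ns → ℝ) (W : ℕ → Ω → Fin nw → ℝ)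
    (L : ℕ → Fin ns → ℝ) (KZ : ℕ → ℝ≥0) (Z X : ℕ → Ω → ℝ) : Prop where
  in_class : ∃ π : InputKernels ns, IsGaussianInput n π ∧ M.Generates P S₁ W π X
  indep_Z_past : ∀ t < n, IndepFun (Z t) (fun ω =>
    (block X t ω, block (M.noise S₁ W) t ω, block (M.est P S₁ W) (t + 1) ω,
      block (M.estEst P S₁ W X) (t + 1) ω, block (innov P (M.noise S₁ W)) (t + 1) ω,
      block (M.output S₁ W X) t ω)) P
  indep_innov_past : ∀ t < n, IndepFun (innov P (M.noise S₁ W) t) (fun ω =>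
    (block X t ω, block (M.noise S₁ W) t ω, block (M.est P S₁ W) (t + 1) ω,
      block (M.output S₁ W X) t ω, block (M.estEst P S₁ W X) (t + 1) ω)) P
  output_eq : ∀ t < n, M.output S₁ W X t =ᵐ[P] fun ω =>
    L t ⬝ᵥ (M.est P S₁ W t ω - M.estEst P S₁ W X t ω) + M.C t ⬝ᵥ M.est P S₁ W t ω
      + innov P (M.noise S₁ W) t ω + Z t ω
  power_eq : avgPower P n X =
    (n : ℝ)⁻¹ * ∑ t ∈ Finset.range n, (L t ⬝ᵥ M.KFb L KZ t *ᵥ L t + KZ t)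
  estEst_init : M.estEst P S₁ W X 0 =ᵐ[P] fun _ => M.mu
  estEst_step : ∀ t < n, M.estEst P S₁ W X (t + 1) =ᵐ[P] fun ω =>
    M.A t *ᵥ M.estEst P S₁ W X t ω + innov P (M.output S₁ W X) t ω • M.gainF L KZ t
  innov_eq : ∀ t < n, innov P (M.output S₁ W X) t =ᵐ[P] fun ω =>
    M.output S₁ W X t ω - M.C t ⬝ᵥ M.estEst P S₁ W X t ω
  innov_eq_err : ∀ t < n, innov P (M.output S₁ W X) t =ᵐ[P] fun ω =>
    (L t + M.C t) ⬝ᵥ (M.est P S₁ W t ω - M.estEst P S₁ W X t ω)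
      + innov P (M.noise S₁ W) t ω + Z t ω
  KI_pos : ∀ t < n, 0 < M.KI L KZ t
  innov_law : ∀ t < n,
    HasLaw (innov P (M.output S₁ W X) t) (gaussianReal 0 (M.KI L KZ t).toNNReal) P
  innov_indep : iIndepFun (fun (t : Fin n) => innov P (M.output S₁ W X) t) P
  innov_indep_past : ∀ t < n,
    IndepFun (innov P (M.output S₁ W X) t) (block (M.output S₁ W X) t) P
  output_condVar : ∀ t < n,
    predict P (M.output S₁ W X) t (fun ω => (innov P (M.output S₁ W X) t ω) ^ 2) =ᵐ[P]
      fun _ => M.KI L KZ t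
  errCov_eq : ∀ t ≤ n, errCov P (M.est P S₁ W t) (M.estEst P S₁ W X t) = M.KFb L KZ t
  condCov_eq : ∀ t ≤ n, ∀ i j, predict P (M.output S₁ W X) t (fun ω =>
      (M.est P S₁ W t ω i - M.estEst P S₁ W X t ω i) *
        (M.est P S₁ W t ω j - M.estEst P S₁ W X t ω j))
    =ᵐ[P] fun _ => M.KFb L KZ t i j
  KFb_psd : ∀ t ≤ n, (M.KFb L KZ t).PosSemidef

end NoiseModel

/-!
All random variables that occur are affine functions of one Gaussian vector, so they live in a
Gaussian space (`IsGaussianSpace`): a linear space of Gaussian variables in which uncorrelated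
means independent, conditional expectations are orthogonal projections, and prediction errors have
nonrandom conditional covariances. Probability thereby reduces to linear algebra for the
covariance form, which may be degenerate. Independence is mostly obtained by showing that a
variable lies in the subspace `orthTo` of all variables uncorrelated with a given one: this
subspace is again a Gaussian space, hence closed under the recursions that build the state, the
noise, the input and the estimates.

*Entropy and determinants.* The innovations of a Gaussian process are its image under a unimodular
affine map (`exists_innov_affine`). Therefore the determinant of its covariance matrix is the
product of the variances of the innovations (`det_covariance_eq_prod_var_innov`), its differential
entropy is the sum of the entropies of the innovations, and the rate of an input is
`½ ∑ log (K_I / K_Î)`, with the variances of the innovations of the output and of the noise.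

*Filters.* Both filters are instances of one step `kalman_step` of a Kalman filter with correlated
state and observation noise: for the noise, the state is `S_t`; for the channel output, the state
is `Ŝ_t`, which is driven by the innovation `Î_t` of the noise. The second instance applies to
every input `X_t = Λ_t Ŝ_t + R_t + ζ_t` where `R_t` is a function of the past of the output and
`ζ_t` is uncorrelated with that past, with `Ŝ_t` and with `Î_t` (`IsFilterInput`); the recursion
for the error covariance does not involve `R_t`. Such an input has the form
`Λ_t (Ŝ_t - E{Ŝ_t | Y^{t-1}}) + ζ_t + ρ_t` with `ρ_t` a function of the past of the output, and `ρ_t` changes only the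
power, by `E ρ_t²` (`integral_sq_input`).

*Capacity.* Four sets of achievable rates coincide. An arbitrary linear input of Cover and Pombra,
regressed on the past of the output and on the error `Ŝ_t - E{Ŝ_t | Y^{t-1}}`, is an
`IsFilterInput` (`exists_isFilterInput`), so removing the deterministic function of the past of
the output yields Riccati coefficients with the same rate and at most the same power. Conversely
every process of the form `Λ_t (Ŝ_t - E{Ŝ_t | Y^{t-1}}) + Z_t` is generated by Gaussian
conditional distributions, and is linear in the noise and the input noise. The maximum over linear
inputs exists because the constraint set is compact (`isGreatest_ftfiCapacity`). For an optimal
input the power `E ρ_t²` must vanish, since otherwise it could be spent on the variance of the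
last `Z_t`, which increases the rate strictly (`outputPart_eq_zero_of_optimal`).
-/

/-! ### Gaussian spaces -/

section LinearSpace

variable {Ω : Type*}

/-- A random vector belongs to a linear space of random variables if all its continuous linear
functionals do. -/
def MemVec {E : Type*} [NormedAddCommGroup E] [NormedSpace ℝ E]
    (G : Submodule ℝ (Ω → ℝ)) (f : Ω → E) : Prop :=
  ∀ L : StrongDual ℝ E, (fun ω => L (f ω)) ∈ G

lemma memVec_real {G : Submodule ℝ (Ω → ℝ)} {f : Ω → ℝ} : MemVec G f ↔ f ∈ G := by
  refine ⟨fun h => h (ContinuousLinearMap.id ℝ ℝ), fun h L => ?_⟩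
  have : (fun ω => L (f ω)) = L 1 • f := by
    ext ω
    have := L.map_smul (f ω) 1
    simp only [smul_eq_mul, mul_one] at this
    simp [this, mul_comm]
  rw [this]; exact G.smul_mem _ h

lemma MemVec.prodMk {E F : Type*} [NormedAddCommGroup E] [NormedSpace ℝ E]
    [NormedAddCommGroup F] [NormedSpace ℝ F] {G : Submodule ℝ (Ω → ℝ)} {f : Ω → E} {g : Ω → F}
    (hf : MemVec G f) (hg : MemVec G g) : MemVec G (fun ω => (f ω, g ω)) := by
  intro L
  have : (fun ω => L (f ω, g ω)) = (fun ω => (L ∘L .inl ℝ E F) (f ω)) +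
      fun ω => (L ∘L .inr ℝ E F) (g ω) := by
    ext ω; simp [← map_add]
  rw [this]; exact G.add_mem (hf _) (hg _)

lemma memVec_pi {ι : Type*} [Fintype ι] {E : Type*} [NormedAddCommGroup E]
    [NormedSpace ℝ E] {G : Submodule ℝ (Ω → ℝ)} {f : Ω → ι → E}
    (hf : ∀ i, MemVec G (fun ω => f ω i)) : MemVec G f := by
  classical
  intro L
  have : (fun ω => L (f ω)) =
      ∑ i, fun ω => (L ∘L ContinuousLinearMap.single ℝ (fun _ => E) i) (f ω i) := by
    ext ω
    simp only [Finset.sum_apply, ContinuousLinearMap.comp_apply, ContinuousLinearMap.single_apply,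
      ← map_sum]
    rw [Finset.univ_sum_single]
  rw [this]; exact G.sum_mem fun i _ => hf i _

lemma memVec_pi_real {ι : Type*} [Fintype ι] {G : Submodule ℝ (Ω → ℝ)} {f : Ω → ι → ℝ}
    (hf : ∀ i, (fun ω => f ω i) ∈ G) : MemVec G f :=
  memVec_pi fun i => memVec_real.2 (hf i)

lemma MemVec.eval {ι : Type*} [Fintype ι] {G : Submodule ℝ (Ω → ℝ)} {f : Ω → ι → ℝ}
    (hf : MemVec G f) (i : ι) : (fun ω => f ω i) ∈ G :=
  hf (ContinuousLinearMap.proj i)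

lemma MemVec.fst {E F : Type*} [NormedAddCommGroup E] [NormedSpace ℝ E]
    [NormedAddCommGroup F] [NormedSpace ℝ F] {G : Submodule ℝ (Ω → ℝ)} {f : Ω → E × F}
    (hf : MemVec G f) : MemVec G (fun ω => (f ω).1) :=
  fun L => hf (L ∘L .fst ℝ E F)

lemma MemVec.snd {E F : Type*} [NormedAddCommGroup E] [NormedSpace ℝ E]
    [NormedAddCommGroup F] [NormedSpace ℝ F] {G : Submodule ℝ (Ω → ℝ)} {f : Ω → E × F}
    (hf : MemVec G f) : MemVec G (fun ω => (f ω).2) :=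
  fun L => hf (L ∘L .snd ℝ E F)

lemma dotProduct_mem {ι : Type*} [Fintype ι] {G : Submodule ℝ (Ω → ℝ)} {f : Ω → ι → ℝ}
    (hf : ∀ i, (fun ω => f ω i) ∈ G) (a : ι → ℝ) : (fun ω => a ⬝ᵥ f ω) ∈ G := by
  have : (fun ω => a ⬝ᵥ f ω) = ∑ i, a i • fun ω => f ω i := by
    ext ω; simp [dotProduct]
  rw [this]; exact G.sum_mem fun i _ => G.smul_mem _ (hf i)

lemma mulVec_mem {ι κ : Type*} [Fintype ι] {G : Submodule ℝ (Ω → ℝ)} {f : Ω → ι → ℝ}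
    (hf : ∀ i, (fun ω => f ω i) ∈ G) (A : Matrix κ ι ℝ) (i : κ) :
    (fun ω => (A *ᵥ f ω) i) ∈ G :=
  dotProduct_mem hf (A i)

lemma MemVec.mono {E : Type*} [NormedAddCommGroup E] [NormedSpace ℝ E]
    {G G' : Submodule ℝ (Ω → ℝ)} {f : Ω → E} (hf : MemVec G f) (h : G ≤ G') : MemVec G' f :=
  fun L => h (hf L)

end LinearSpace

section GaussianSpace

variable {Ω : Type*} [MeasurableSpace Ω] {P : Measure Ω}

/-- A Gaussian space: a linear space of random variables, all of them Gaussian, that contains the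
constants and is closed under almost sure equality.  Finitely many of its elements are always
jointly Gaussian. -/
structure IsGaussianSpace (P : Measure Ω) (G : Submodule ℝ (Ω → ℝ)) : Prop where
  gauss : ∀ f ∈ G, HasGaussianLaw f P
  const : ∀ c : ℝ, (fun _ => c) ∈ G
  congr : ∀ f ∈ G, ∀ g, f =ᵐ[P] g → g ∈ G

/-- The random variables that are almost surely an affine function of the random vector `u`. -/
def affSpan {m : ℕ} (P : Measure Ω) (u : Ω → Fin m → ℝ) : Submodule ℝ (Ω → ℝ) where
  carrier := {f | ∃ (a : ℝ) (g : Fin m → ℝ), f =ᵐ[P] fun ω => a + g ⬝ᵥ u ω}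
  add_mem' := by
    rintro f f' ⟨a, g, h⟩ ⟨a', g', h'⟩
    refine ⟨a + a', g + g', ?_⟩
    filter_upwards [h, h'] with ω h h'
    simp only [Pi.add_apply, h, h', add_dotProduct]; ring
  zero_mem' := ⟨0, 0, by simp; rfl⟩
  smul_mem' := by
    rintro c f ⟨a, g, h⟩
    refine ⟨c * a, c • g, ?_⟩
    filter_upwards [h] with ω h
    simp only [Pi.smul_apply, h, smul_dotProduct, smul_eq_mul]; ring

/-- The random variables that are almost surely an affine function of `g`. -/
def gaussSpan {E : Type*} [NormedAddCommGroup E] [NormedSpace ℝ E]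
    (P : Measure Ω) (g : Ω → E) : Submodule ℝ (Ω → ℝ) where
  carrier := {f | ∃ (L : StrongDual ℝ E) (c : ℝ), f =ᵐ[P] fun ω => L (g ω) + c}
  add_mem' := by
    rintro f f' ⟨L, c, h⟩ ⟨L', c', h'⟩
    refine ⟨L + L', c + c', ?_⟩
    filter_upwards [h, h'] with ω h h'
    simp only [Pi.add_apply, h, h', _root_.add_apply]; ring
  zero_mem' := ⟨0, 0, by simp; rfl⟩
  smul_mem' := by
    rintro r f ⟨L, c, h⟩
    refine ⟨r • L, r * c, ?_⟩
    filter_upwards [h] with ω h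
    simp only [Pi.smul_apply, h, smul_eq_mul, _root_.smul_apply]; ring

lemma isGaussianSpace_gaussSpan {E : Type*} [NormedAddCommGroup E] [NormedSpace ℝ E]
    [MeasurableSpace E] [BorelSpace E] {g : Ω → E} (hg : HasGaussianLaw g P) :
    IsGaussianSpace P (gaussSpan P g) where
  gauss := by
    rintro f ⟨L, c, h⟩
    have hL := hg.map_fun L
    have h1 : HasLaw (fun ω => L (g ω)) (gaussianReal P[fun ω => L (g ω)]
      Var[fun ω => L (g ω); P].toNNReal) P := ⟨hL.aemeasurable, hL.map_eq_gaussianReal⟩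
    exact ((gaussianReal_add_const h1 c).hasGaussianLaw).congr h.symm
  const := fun c => ⟨0, c, by simp⟩
  congr := by
    rintro f ⟨L, c, h⟩ f' h'
    exact ⟨L, c, h'.symm.trans h⟩

lemma memVec_gaussSpan {E : Type*} [NormedAddCommGroup E] [NormedSpace ℝ E] (g : Ω → E) :
    MemVec (gaussSpan P g) g :=
  fun L => ⟨L, 0, by simp⟩

namespace IsGaussianSpace

variable {G : Submodule ℝ (Ω → ℝ)}

lemma hasGaussianLaw (hG : IsGaussianSpace P G) {E : Type*} [NormedAddCommGroup E]
    [NormedSpace ℝ E] [MeasurableSpace E] [BorelSpace E] {f : Ω → E}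
    (hm : AEMeasurable f P) (hf : MemVec G f) : HasGaussianLaw f P where
  isGaussian_map := by
    refine isGaussian_of_isGaussian_map fun L => ?_
    rw [AEMeasurable.map_map_of_aemeasurable (by fun_prop) hm]
    exact (hG.gauss _ (hf L)).isGaussian_map

lemma memLp (hG : IsGaussianSpace P G) {f : Ω → ℝ} (hf : f ∈ G) : MemLp f 2 P :=
  (hG.gauss f hf).memLp_two

lemma integrable (hG : IsGaussianSpace P G) {f : Ω → ℝ} (hf : f ∈ G) : Integrable f P :=
  (hG.gauss f hf).integrable

lemma isProbabilityMeasure (hG : IsGaussianSpace P G) : IsProbabilityMeasure P :=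
  (hG.gauss _ (hG.const 0)).isProbabilityMeasure

lemma affSpan_le (hG : IsGaussianSpace P G) {m : ℕ} {u : Ω → Fin m → ℝ}
    (hu : ∀ j, (fun ω => u ω j) ∈ G) : affSpan P u ≤ G := by
  rintro f ⟨a, g, h⟩
  exact hG.congr _ (G.add_mem (hG.const a) (dotProduct_mem hu g)) _ h.symm

end IsGaussianSpace

lemma affSpan_congr {m : ℕ} {u : Ω → Fin m → ℝ} {f g : Ω → ℝ} (hf : f ∈ affSpan P u)
    (h : f =ᵐ[P] g) : g ∈ affSpan P u := by
  obtain ⟨a, v, hv⟩ := hf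
  exact ⟨a, v, h.symm.trans hv⟩

lemma const_mem_affSpan {m : ℕ} (u : Ω → Fin m → ℝ) (c : ℝ) : (fun _ => c) ∈ affSpan P u :=
  ⟨c, 0, by simp⟩

lemma coord_mem_affSpan {m : ℕ} (u : Ω → Fin m → ℝ) (j : Fin m) :
    (fun ω => u ω j) ∈ affSpan P u :=
  ⟨0, Pi.single j 1, by simp⟩

lemma affSpan_mono {m m' : ℕ} {u : Ω → Fin m → ℝ} {u' : Ω → Fin m' → ℝ}
    (h : ∀ j, (fun ω => u ω j) ∈ affSpan P u') : affSpan P u ≤ affSpan P u' := by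
  rintro f ⟨a, g, hf⟩
  exact affSpan_congr (add_mem (const_mem_affSpan u' a) (dotProduct_mem h g)) hf.symm

lemma affSpan_block_mono {U : ℕ → Ω → ℝ} {s t : ℕ} (h : s ≤ t) :
    affSpan P (block U s) ≤ affSpan P (block U t) :=
  affSpan_mono fun j => coord_mem_affSpan (block U t) (Fin.castLE h j)

lemma mem_affSpan_block (U : ℕ → Ω → ℝ) {s t : ℕ} (h : s < t) : U s ∈ affSpan P (block U t) :=
  coord_mem_affSpan (block U t) ⟨s, h⟩

lemma covariance_congr_ae {f f' g g' : Ω → ℝ} (hf : f =ᵐ[P] f') (hg : g =ᵐ[P] g') :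
    cov[f, g; P] = cov[f', g'; P] := by
  unfold covariance
  rw [integral_congr_ae hf, integral_congr_ae hg]
  refine integral_congr_ae ?_
  filter_upwards [hf, hg] with ω h1 h2
  rw [h1, h2]

/-- The elements of `G` that are uncorrelated with `z`. -/
def orthTo (P : Measure Ω) {G : Submodule ℝ (Ω → ℝ)} (hG : IsGaussianSpace P G) {z : Ω → ℝ}
    (hz : z ∈ G) : Submodule ℝ (Ω → ℝ) where
  carrier := {f | f ∈ G ∧ cov[z, f; P] = 0}
  add_mem' := by
    have := hG.isProbabilityMeasure
    rintro f g ⟨hf, hf'⟩ ⟨hg, hg'⟩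
    exact ⟨G.add_mem hf hg, by
      rw [covariance_add_right (hG.memLp hz) (hG.memLp hf) (hG.memLp hg), hf', hg', add_zero]⟩
  zero_mem' := ⟨G.zero_mem, by simp⟩
  smul_mem' := by
    rintro c f ⟨hf, hf'⟩
    exact ⟨G.smul_mem c hf, by rw [covariance_smul_right, hf', mul_zero]⟩

lemma isGaussianSpace_orthTo {G : Submodule ℝ (Ω → ℝ)} (hG : IsGaussianSpace P G) {z : Ω → ℝ}
    (hz : z ∈ G) : IsGaussianSpace P (orthTo P hG hz) where
  gauss f hf := hG.gauss f hf.1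
  const c := ⟨hG.const c, by have := hG.isProbabilityMeasure; simp⟩
  congr f hf g h := ⟨hG.congr f hf.1 g h, by
    rw [← hf.2]; exact covariance_congr_ae (by rfl) h.symm⟩

lemma orthTo_le {G : Submodule ℝ (Ω → ℝ)} (hG : IsGaussianSpace P G) {z : Ω → ℝ}
    (hz : z ∈ G) : orthTo P hG hz ≤ G := fun _ hf => hf.1

/-- In a Gaussian space, uncorrelated random vectors are independent. -/
lemma IsGaussianSpace.indepFun_of_cov {G : Submodule ℝ (Ω → ℝ)} (hG : IsGaussianSpace P G)
    {E F : Type*} [NormedAddCommGroup E] [NormedSpace ℝ E] [MeasurableSpace E] [BorelSpace E]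
    [SecondCountableTopology E] [CompleteSpace E] [NormedAddCommGroup F] [NormedSpace ℝ F]
    [MeasurableSpace F] [BorelSpace F] [SecondCountableTopology F] [CompleteSpace F]
    {f : Ω → E} {g : Ω → F} (hfm : AEMeasurable f P) (hgm : AEMeasurable g P)
    (hf : MemVec G f) (hg : MemVec G g)
    (h : ∀ (L : StrongDual ℝ E) (L' : StrongDual ℝ F),
      cov[fun ω => L (f ω), fun ω => L' (g ω); P] = 0) :
    IndepFun f g P :=
  (hG.hasGaussianLaw (hfm.prodMk hgm) (hf.prodMk hg)).indepFun_of_covariance_strongDual h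

lemma IsGaussianSpace.indepFun_orthTo {G : Submodule ℝ (Ω → ℝ)} (hG : IsGaussianSpace P G)
    {z : Ω → ℝ} (hz : z ∈ G)
    {F : Type*} [NormedAddCommGroup F] [NormedSpace ℝ F]
    [MeasurableSpace F] [BorelSpace F] [SecondCountableTopology F] [CompleteSpace F]
    {g : Ω → F} (hgm : AEMeasurable g P)
    (hg : MemVec (orthTo P hG hz) g) : IndepFun z g P := by
  refine hG.indepFun_of_cov (hG.gauss z hz).aemeasurable hgm (memVec_real.2 hz)
    (hg.mono (orthTo_le hG hz)) fun L L' => ?_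
  have : (fun ω => L (z ω)) = fun ω => L 1 * z ω := by
    ext ω
    have := L.map_smul (z ω) 1
    simp only [smul_eq_mul, mul_one] at this
    rw [this, mul_comm]
  rw [this, covariance_const_mul_left, (hg L').2, mul_zero]

end GaussianSpace

/-! ### Orthogonal projection for a positive semidefinite form -/

/-- Gram-Schmidt: for a positive semidefinite form, possibly degenerate, some linear combination
of finitely many vectors `u i` differs from `x` by a vector orthogonal to all `u i`. -/
lemma exists_sub_sum_orthogonal {V ι : Type*} [AddCommGroup V] [Module ℝ V]
    (B : V →ₗ[ℝ] V →ₗ[ℝ] ℝ) (hsymm : ∀ x y, B x y = B y x) (hpos : ∀ x, 0 ≤ B x x)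
    (u : ι → V) (s : Finset ι) (x : V) :
    ∃ g : ι → ℝ, ∀ j ∈ s, B (x - ∑ i ∈ s, g i • u i) (u j) = 0 := by
  classical
  have hcs : ∀ x y, B y y = 0 → B x y = 0 := by
    intro x y hy
    by_contra hne
    have h1 := hpos (x - ((B x x + 1) / (2 * B x y)) • y)
    simp only [map_sub, map_smul, LinearMap.sub_apply, LinearMap.smul_apply, smul_eq_mul, hy,
      hsymm y x] at h1
    have h2 : (B x x + 1) / (2 * B x y) * B x y = (B x x + 1) / 2 := by field_simp
    nlinarith
  induction s using Finset.induction_on generalizing x with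
  | empty => exact ⟨0, by simp⟩
  | insert a s ha ih =>
    obtain ⟨gx, hx⟩ := ih x
    obtain ⟨ga, hga⟩ := ih (u a)
    set y := x - ∑ i ∈ s, gx i • u i with hy
    set r := u a - ∑ i ∈ s, ga i • u i with hr
    have hua : u a = r + ∑ i ∈ s, ga i • u i := by rw [hr]; abel
    have hyu : ∀ j ∈ s, B y (u j) = 0 := hx
    -- the last direction only contributes through its residual `r`
    obtain ⟨c, hc⟩ : ∃ c : ℝ, B (y - c • r) r = 0 := by
      by_cases h0 : B r r = 0
      · exact ⟨0, hcs _ _ h0⟩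
      · refine ⟨B y r / B r r, ?_⟩
        simp only [map_sub, map_smul, LinearMap.sub_apply, LinearMap.smul_apply, smul_eq_mul]
        field_simp; ring
    refine ⟨fun i => if i = a then c else gx i - c * ga i, ?_⟩
    have hsum : ∑ i ∈ insert a s, (if i = a then c else gx i - c * ga i) • u i
        = c • u a + ∑ i ∈ s, (gx i - c * ga i) • u i := by
      rw [Finset.sum_insert ha, if_pos rfl]
      congr 1
      refine Finset.sum_congr rfl fun i hi => ?_
      rw [if_neg (by rintro rfl; exact ha hi)]
    have hres : x - ∑ i ∈ insert a s, (if i = a then c else gx i - c * ga i) • u i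
        = y - c • r := by
      rw [hsum, hy, hr]
      simp only [sub_smul, mul_smul, Finset.sum_sub_distrib, ← Finset.smul_sum, smul_sub]
      abel
    rw [hres]
    have hs : ∀ j ∈ s, B (y - c • r) (u j) = 0 := fun j hj => by
      simp [hyu j hj, hga j hj]
    intro j hj
    rcases Finset.mem_insert.1 hj with rfl | hj
    · rw [hua, map_add, hc, map_sum]
      simp only [map_smul, smul_eq_mul, zero_add]
      exact Finset.sum_eq_zero fun i hi => by rw [hs i hi, mul_zero]
    · exact hs j hj

/-! ### Conditional expectations in Gaussian spaces -/

section CondExp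

variable {Ω : Type*} [MeasurableSpace Ω] {P : Measure Ω} {G : Submodule ℝ (Ω → ℝ)}

/-- The covariance as a bilinear form on a Gaussian space. -/
noncomputable def covForm (hG : IsGaussianSpace P G) : G →ₗ[ℝ] G →ₗ[ℝ] ℝ :=
  haveI := hG.isProbabilityMeasure
  LinearMap.mk₂ ℝ (fun f g => cov[(f : Ω → ℝ), (g : Ω → ℝ); P])
    (fun (f g h : G) => covariance_add_left (hG.memLp f.2) (hG.memLp g.2) (hG.memLp h.2))
    (fun c _ _ => covariance_smul_left c)
    (fun (f g h : G) => covariance_add_right (hG.memLp f.2) (hG.memLp g.2) (hG.memLp h.2))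
    (fun c _ _ => covariance_smul_right c)

lemma covForm_apply (hG : IsGaussianSpace P G) (f g : G) :
    covForm hG f g = cov[(f : Ω → ℝ), (g : Ω → ℝ); P] := rfl

lemma covForm_symm (hG : IsGaussianSpace P G) (f g : G) : covForm hG f g = covForm hG g f :=
  covariance_comm _ _

lemma covForm_nonneg (hG : IsGaussianSpace P G) (f : G) : 0 ≤ covForm hG f f := by
  rw [covForm_apply, covariance_self (hG.gauss _ f.2).aemeasurable]
  exact variance_nonneg _ _

/-- Linear regression of `x` on the coordinates of a random vector, which may be linearly
dependent. -/
lemma exists_sub_affine_orthogonal (hG : IsGaussianSpace P G) {ι : Type*} [Fintype ι]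
    {u : Ω → ι → ℝ} (hu : ∀ j, (fun ω => u ω j) ∈ G) {x : Ω → ℝ} (hx : x ∈ G) :
    ∃ (g : ι → ℝ), ∀ j, cov[fun ω => x ω - g ⬝ᵥ u ω, fun ω => u ω j; P] = 0 := by
  obtain ⟨g, hg⟩ := exists_sub_sum_orthogonal (covForm hG) (covForm_symm hG) (covForm_nonneg hG)
    (fun j => (⟨fun ω => u ω j, hu j⟩ : G)) Finset.univ ⟨x, hx⟩
  refine ⟨g, fun j => ?_⟩
  have := hg j (Finset.mem_univ j)
  rw [covForm_apply] at this
  convert this using 2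
  ext ω
  simp [dotProduct, Finset.sum_apply]

/-- In a Gaussian space the affine function of `u` with the right mean and an error uncorrelated
with `u` is the conditional expectation given `u`: the error is even independent of `u`. -/
lemma IsGaussianSpace.condExp_eq (hG : IsGaussianSpace P G) {m : ℕ} {u : Ω → Fin m → ℝ}
    (hum : Measurable u) (hu : ∀ j, (fun ω => u ω j) ∈ G) {x p : Ω → ℝ} (hx : x ∈ G)
    (hp : p ∈ affSpan P u) (hmean : ∫ ω, x ω ∂P = ∫ ω, p ω ∂P)
    (hcov : ∀ j, cov[fun ω => x ω - p ω, fun ω => u ω j; P] = 0) :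
    P[x | MeasurableSpace.comap u inferInstance] =ᵐ[P] p := by
  have := hG.isProbabilityMeasure
  have hpG : p ∈ G := hG.affSpan_le hu hp
  have hdG : (fun ω => x ω - p ω) ∈ G := G.sub_mem hx hpG
  obtain ⟨a, g, hag⟩ := hp
  have hind : IndepFun (fun ω => x ω - p ω) u P := by
    refine hG.indepFun_orthTo hdG hum.aemeasurable (memVec_pi_real fun j => ⟨hu j, hcov j⟩)
  have haem : AEMeasurable (fun ω => x ω - p ω) P := (hG.gauss _ hdG).aemeasurable
  set d := haem.mk _ with hd
  have hdm : Measurable d := haem.measurable_mk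
  have hdae : (fun ω => x ω - p ω) =ᵐ[P] d := haem.ae_eq_mk
  have hind' : IndepFun d u P := hind.congr hdae (by rfl)
  have h1 : P[d | MeasurableSpace.comap u inferInstance] =ᵐ[P] fun _ => ∫ ω, d ω ∂P :=
    condExp_indep_eq hdm.comap_le hum.comap_le (comap_measurable d).stronglyMeasurable hind'
  have h0 : ∫ ω, d ω ∂P = 0 := by
    rw [← integral_congr_ae hdae, integral_sub (hG.integrable hx) (hG.integrable hpG), hmean,
      sub_self]
  have h2 : P[(fun ω => a + g ⬝ᵥ u ω) | MeasurableSpace.comap u inferInstance] =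
      fun ω => a + g ⬝ᵥ u ω := by
    refine condExp_of_stronglyMeasurable hum.comap_le ?_ ((hG.integrable hpG).congr hag)
    have : Measurable fun v : Fin m → ℝ => a + g ⬝ᵥ v := by unfold dotProduct; fun_prop
    exact (this.comp (comap_measurable u)).stronglyMeasurable
  have hsum : x =ᵐ[P] d + fun ω => a + g ⬝ᵥ u ω := by
    filter_upwards [hdae, hag] with ω h h'
    simp only [Pi.add_apply, ← h, ← h']; ring
  refine (condExp_congr_ae hsum).trans ?_
  refine (condExp_add ((hG.integrable hdG).congr hdae)
    ((hG.integrable hpG).congr hag) _).trans ?_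
  filter_upwards [h1, hag] with ω h1 hag
  rw [Pi.add_apply, h1, h0, h2, hag, zero_add]

/-- In a Gaussian space conditional expectations given a vector are affine functions of it, with
an error uncorrelated with it. -/
lemma IsGaussianSpace.condExp_mem (hG : IsGaussianSpace P G) {m : ℕ} {u : Ω → Fin m → ℝ}
    (hum : Measurable u) (hu : ∀ j, (fun ω => u ω j) ∈ G) {x : Ω → ℝ} (hx : x ∈ G) :
    P[x | MeasurableSpace.comap u inferInstance] ∈ affSpan P u ∧
    ∀ f ∈ affSpan P u,
      cov[fun ω => x ω - (P[x | MeasurableSpace.comap u inferInstance]) ω, f; P] = 0 := by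
  have := hG.isProbabilityMeasure
  obtain ⟨g, hg⟩ := exists_sub_affine_orthogonal hG hu hx
  set a : ℝ := ∫ ω, (x ω - g ⬝ᵥ u ω) ∂P with ha
  have hgu := dotProduct_mem hu g
  have hp : (fun ω => a + g ⬝ᵥ u ω) ∈ affSpan P u := ⟨a, g, by rfl⟩
  have hpG := hG.affSpan_le hu hp
  have hcov : ∀ j, cov[fun ω => x ω - (a + g ⬝ᵥ u ω), fun ω => u ω j; P] = 0 := by
    intro j
    rw [← hg j]
    have : (fun ω => x ω - (a + g ⬝ᵥ u ω)) = fun ω => (x ω - g ⬝ᵥ u ω) - a := by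
      ext ω; ring
    rw [this]
    exact covariance_sub_const_left (hG.integrable (G.sub_mem hx hgu)) a
  have h := hG.condExp_eq hum hu hx hp (by
    rw [integral_add (integrable_const _) (hG.integrable hgu), ha,
      integral_sub (hG.integrable hx) (hG.integrable hgu)]
    simp) hcov
  refine ⟨affSpan_congr hp h.symm, fun f hf => ?_⟩
  have hdG : (fun ω => x ω - (a + g ⬝ᵥ u ω)) ∈ G := G.sub_mem hx hpG
  have h3 : f ∈ orthTo P hG hdG :=
    (isGaussianSpace_orthTo hG hdG).affSpan_le (fun j => ⟨hu j, hcov j⟩) hf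
  rw [← h3.2]
  refine covariance_congr_ae ?_ (by rfl)
  filter_upwards [h] with ω h
  rw [h]

lemma condExp_apply_ae {k : ℕ} {m : MeasurableSpace Ω} {θ : Ω → Fin k → ℝ}
    (hθ : Integrable θ P) (i : Fin k) :
    (fun ω => (P[θ | m]) ω i) =ᵐ[P] P[(fun ω => θ ω i) | m] :=
  ContinuousLinearMap.comp_condExp_comm hθ (ContinuousLinearMap.proj (R := ℝ) i)

end CondExp

/-! ### Densities and differential entropies -/

section Entropy

lemma diffEntropy_withDensity {E : Type*} [MeasureSpace E] [SigmaFinite (volume : Measure E)]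
    {μ : Measure E} {p : E → ℝ} (hp : Measurable p) (hp0 : ∀ x, 0 ≤ p x)
    (hμ : μ = volume.withDensity fun x => ENNReal.ofReal (p x))
    (hint : Integrable (fun x => Real.log (p x)) μ) :
    HasDiffEntropy μ ∧ diffEntropy μ = -∫ x, Real.log (p x) ∂μ := by
  have hac : μ ≪ volume := hμ ▸ withDensity_absolutelyContinuous _ _
  have h1 : μ.rnDeriv volume =ᵐ[μ] fun x => ENNReal.ofReal (p x) := by
    refine hac.ae_le ?_
    rw [hμ]
    exact Measure.rnDeriv_withDensity _ hp.ennreal_ofReal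
  have h2 : (fun x => Real.log (μ.rnDeriv volume x).toReal) =ᵐ[μ] fun x => Real.log (p x) := by
    filter_upwards [h1] with x hx
    rw [hx, ENNReal.toReal_ofReal (hp0 x)]
  exact ⟨⟨hac, hint.congr h2.symm⟩, by rw [diffEntropy, integral_congr_ae h2]⟩

lemma log_gaussianPDFReal (m : ℝ) {v : ℝ≥0} (hv : v ≠ 0) (x : ℝ) :
    Real.log (gaussianPDFReal m v x) =
      -(1 / 2) * Real.log (2 * Real.pi * v) - (x - m) ^ 2 / (2 * v) := by
  have hv' : (0 : ℝ) < v := by positivity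
  rw [gaussianPDFReal, Real.log_mul (by positivity) (Real.exp_pos _).ne', Real.log_exp,
    Real.log_inv, Real.log_sqrt (by positivity)]
  ring

lemma integrable_sub_sq_gaussianReal (m : ℝ) (v : ℝ≥0) :
    Integrable (fun x : ℝ => (x - m) ^ 2) (gaussianReal m v) :=
  ((memLp_id_gaussianReal' 2 (by norm_num)).sub (memLp_const m)).integrable_sq

lemma integral_sub_sq_gaussianReal (m : ℝ) (v : ℝ≥0) :
    ∫ x : ℝ, (x - m) ^ 2 ∂(gaussianReal m v) = v := by
  have h := variance_fun_id_gaussianReal (μ := m) (v := v)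
  rw [variance_eq_integral measurable_id'.aemeasurable] at h
  simpa using h

lemma integrable_log_gaussianPDFReal (m : ℝ) {v : ℝ≥0} (hv : v ≠ 0) :
    Integrable (fun x => Real.log (gaussianPDFReal m v x)) (gaussianReal m v) := by
  simp_rw [log_gaussianPDFReal m hv]
  exact (integrable_const _).sub ((integrable_sub_sq_gaussianReal m v).div_const _)

lemma integral_log_gaussianPDFReal (m : ℝ) {v : ℝ≥0} (hv : v ≠ 0) :
    ∫ x, Real.log (gaussianPDFReal m v x) ∂(gaussianReal m v) =
      -(1 / 2 * Real.log (2 * Real.pi * Real.exp 1 * v)) := by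
  have hv' : (0 : ℝ) < v := by positivity
  simp_rw [log_gaussianPDFReal m hv]
  rw [integral_sub (integrable_const _) ((integrable_sub_sq_gaussianReal m v).div_const _),
    integral_div, integral_sub_sq_gaussianReal]
  have : 2 * Real.pi * Real.exp 1 * v = 2 * Real.pi * v * Real.exp 1 := by ring
  rw [this, Real.log_mul (by positivity) (Real.exp_pos _).ne', Real.log_exp]
  simp only [integral_const, probReal_univ, smul_eq_mul]
  field_simp; ring

lemma diffEntropy_gaussianReal (m : ℝ) {v : ℝ≥0} (hv : v ≠ 0) :
    HasDiffEntropy (gaussianReal m v) ∧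
      diffEntropy (gaussianReal m v) = 1 / 2 * Real.log (2 * Real.pi * Real.exp 1 * v) := by
  have h := diffEntropy_withDensity (μ := gaussianReal m v) (measurable_gaussianPDFReal m v)
    (gaussianPDFReal_nonneg m v) (gaussianReal_of_var_ne_zero m hv)
    (integrable_log_gaussianPDFReal m hv)
  exact ⟨h.1, by rw [h.2, integral_log_gaussianPDFReal m hv, neg_neg]⟩

/-- The product density of independent Gaussian variables. -/
lemma withDensity_pi_gaussian {ι : Type*} [Fintype ι] (v : ι → ℝ≥0) (hv : ∀ i, v i ≠ 0) :
    (volume : Measure (ι → ℝ)).withDensity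
      (fun x => ENNReal.ofReal (∏ i, gaussianPDFReal 0 (v i) (x i))) =
      Measure.pi fun i => gaussianReal 0 (v i) := by
  refine (Measure.pi_eq fun s hs => ?_).symm
  rw [withDensity_apply _ (MeasurableSet.univ_pi hs), volume_pi, Measure.restrict_pi_pi,
    ← ofReal_integral_eq_lintegral_ofReal]
  · rw [integral_fintype_prod_eq_prod, ENNReal.ofReal_prod_of_nonneg]
    · exact Finset.prod_congr rfl fun i _ => (gaussianReal_apply_eq_integral 0 (hv i) (s i)).symm
    · exact fun i _ => integral_nonneg fun x => gaussianPDFReal_nonneg _ _ _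
  · exact Integrable.fintype_prod_dep fun i => (integrable_gaussianPDFReal 0 (v i)).restrict
  · exact ae_of_all _ fun x => Finset.prod_nonneg fun i _ => gaussianPDFReal_nonneg _ _ _

/-- A vector whose image under a unimodular affine map is a vector of independent Gaussian
variables has the entropy of that vector. -/
lemma diffEntropy_of_affine {n : ℕ} {Ω : Type*} [MeasurableSpace Ω] {P : Measure Ω}
    [IsProbabilityMeasure P] {u J : Ω → Fin n → ℝ} (hu : AEMeasurable u P)
    (T : Matrix (Fin n) (Fin n) ℝ) (hT : T.det = 1) (a : Fin n → ℝ)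
    (hJ : J =ᵐ[P] fun ω => T *ᵥ u ω - a) (v : Fin n → ℝ≥0) (hv : ∀ i, v i ≠ 0)
    (hlaw : HasLaw J (Measure.pi fun i => gaussianReal 0 (v i)) P) :
    HasDiffEntropy (P.map u) ∧ diffEntropy (P.map u) =
      1 / 2 * ∑ i, Real.log (2 * Real.pi * Real.exp 1 * v i) := by
  set Φ : (Fin n → ℝ) → (Fin n → ℝ) := fun x => T *ᵥ x - a with hΦ
  have hpres1 : MeasurePreserving (fun x : Fin n → ℝ => T *ᵥ x) := by
    refine ⟨(Matrix.toLin' T).continuous_of_finiteDimensional.measurable, ?_⟩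
    have := Real.map_matrix_volume_pi_eq_smul_volume_pi (M := T) (by rw [hT]; exact one_ne_zero)
    rw [hT] at this
    simpa using! this
  have hpres : MeasurePreserving Φ :=
    (measurePreserving_sub_right (volume : Measure (Fin n → ℝ)) a).comp hpres1
  have hinj : Function.Injective Φ := by
    intro x y hxy
    have h1 : T *ᵥ x = T *ᵥ y := by simpa [hΦ] using hxy
    have hunit : IsUnit T.det := by rw [hT]; exact isUnit_one
    have := congrArg (fun z => T⁻¹ *ᵥ z) h1
    simpa [Matrix.mulVec_mulVec, Matrix.nonsing_inv_mul _ hunit] using this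
  have hemb : MeasurableEmbedding Φ :=
    hpres.measurable.measurableEmbedding hinj
  set p : (Fin n → ℝ) → ℝ := fun x => ∏ i, gaussianPDFReal 0 (v i) (Φ x i) with hp
  have hpm : Measurable p :=
    Finset.measurable_prod _ fun i _ => (measurable_gaussianPDFReal 0 (v i)).comp
      ((measurable_pi_apply i).comp hpres.measurable)
  have hp0 : ∀ x, 0 < p x := fun x => Finset.prod_pos fun i _ => gaussianPDFReal_pos _ _ _ (hv i)
  have hmap : (P.map u).map Φ = Measure.pi fun i => gaussianReal 0 (v i) := by
    rw [AEMeasurable.map_map_of_aemeasurable hpres.measurable.aemeasurable hu,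
      ← hlaw.map_eq, Measure.map_congr hJ]
    rfl
  have hdens : P.map u = volume.withDensity fun x => ENNReal.ofReal (p x) := by
    ext s hs
    have h1 : P.map u s = (P.map u).map Φ (Φ '' s) := by
      rw [hemb.map_apply, Set.preimage_image_eq _ hinj]
    rw [h1, hmap, ← withDensity_pi_gaussian v hv,
      withDensity_apply _ (hemb.measurableSet_image.2 hs),
      withDensity_apply _ hs, ← hpres.setLIntegral_comp_emb hemb]
  have hlog : ∀ x, Real.log (p x) = ∑ i, Real.log (gaussianPDFReal 0 (v i) (Φ x i)) := fun x =>
    Real.log_prod fun i _ => (gaussianPDFReal_pos _ _ _ (hv i)).ne'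
  have hΦlaw : ∀ i, MeasurePreserving (fun x => Φ x i) (P.map u) (gaussianReal 0 (v i)) := by
    intro i
    refine ⟨(measurable_pi_apply i).comp hpres.measurable, ?_⟩
    have h2 : (P.map u).map (fun x => Φ x i) = ((P.map u).map Φ).map (fun x => x i) := by
      rw [Measure.map_map (measurable_pi_apply i) hpres.measurable]; rfl
    rw [h2, hmap]
    exact (measurePreserving_eval (fun i => gaussianReal 0 (v i)) i).map_eq
  have hint : ∀ i, Integrable (fun x => Real.log (gaussianPDFReal 0 (v i) (Φ x i))) (P.map u) :=
    fun i => (hΦlaw i).integrable_comp_of_integrable (integrable_log_gaussianPDFReal 0 (hv i))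
  have h := diffEntropy_withDensity hpm (fun x => (hp0 x).le) hdens
    (by simp_rw [hlog]; exact integrable_finsetSum _ fun i _ => hint i)
  refine ⟨h.1, ?_⟩
  rw [h.2]
  simp_rw [hlog]
  rw [integral_finsetSum _ fun i _ => hint i, ← Finset.sum_neg_distrib, Finset.mul_sum]
  refine Finset.sum_congr rfl fun i _ => ?_
  have h3 : ∫ x, Real.log (gaussianPDFReal 0 (v i) (Φ x i)) ∂(P.map u) =
      ∫ x, Real.log (gaussianPDFReal 0 (v i) x) ∂((P.map u).map fun x => Φ x i) := by
    rw [integral_map (hΦlaw i).measurable.aemeasurable]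
    exact (Real.measurable_log.comp (measurable_gaussianPDFReal 0 (v i))).aestronglyMeasurable
  rw [h3, (hΦlaw i).map_eq, integral_log_gaussianPDFReal 0 (hv i), neg_neg]

end Entropy

/-! ### Conditional laws -/

section CondLaw

/-- The chain rule for conditional distributions. -/
lemma ProbabilityTheory.HasCondDistrib.compProd {Ω : Type*} [MeasurableSpace Ω] {P : Measure Ω}
    [SFinite P] {𝓣 : Type*} [MeasurableSpace 𝓣] {T : Ω → 𝓣} {𝓧 𝓨 : Type*}
    [MeasurableSpace 𝓧] [MeasurableSpace 𝓨]
    {X : Ω → 𝓧} {Y : Ω → 𝓨} {κ : Kernel 𝓣 𝓧} {η : Kernel (𝓣 × 𝓧) 𝓨}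
    [IsSFiniteKernel κ] [IsSFiniteKernel η] (h : HasCondDistrib X T κ P)
    (h' : HasCondDistrib Y (fun ω => (T ω, X ω)) η P) :
    HasCondDistrib (fun ω => (X ω, Y ω)) T (κ ⊗ₖ η) P := by
  have hX : AEMeasurable X P := h.aemeasurable_snd
  have hY : AEMeasurable Y P := h'.aemeasurable_snd
  have hT : AEMeasurable T P := h.aemeasurable_fst
  refine ⟨by fun_prop, ?_⟩
  rw [← Measure.compProd_assoc', ← h.map_eq, ← h'.map_eq,
    AEMeasurable.map_map_of_aemeasurable (by fun_prop) (by fun_prop)]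
  rfl

variable {Ω : Type*} [MeasurableSpace Ω] {P : Measure Ω} [IsProbabilityMeasure P]
  {𝓣 : Type*} [MeasurableSpace 𝓣] {T : Ω → 𝓣} {X Z : Ω → ℝ} {m : 𝓣 → ℝ} {v : ℝ≥0}
  {κ : Kernel 𝓣 ℝ}

/-- The joint law of a random variable and a Gaussian variable centred at a function of it. -/
lemma map_prod_gaussianReal (μ : Measure 𝓣) [IsProbabilityMeasure μ] (hm : Measurable m)
    [IsSFiniteKernel κ] (hκ : ∀ τ, κ τ = gaussianReal (m τ) v) :
    (μ.prod (gaussianReal 0 v)).map (fun p => (p.1, m p.1 + p.2)) = μ ⊗ₘ κ := by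
  ext s hs
  have hφ : Measurable fun p : 𝓣 × ℝ => (p.1, m p.1 + p.2) := by fun_prop
  rw [Measure.map_apply hφ hs, Measure.prod_apply (hφ hs), Measure.compProd_apply hs]
  refine lintegral_congr fun τ => ?_
  rw [hκ, ← zero_add (m τ), ← gaussianReal_map_const_add (m τ),
    Measure.map_apply (by fun_prop) (measurable_prodMk_left hs)]
  rfl

/-- A variable that is a function of `T` plus independent centred Gaussian noise has a Gaussian
conditional law given `T`. -/
lemma hasCondDistrib_gaussianReal (hm : Measurable m) [IsSFiniteKernel κ]
    (hκ : ∀ τ, κ τ = gaussianReal (m τ) v) (hT : AEMeasurable T P)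
    (hX : X =ᵐ[P] fun ω => m (T ω) + Z ω) (hZ : HasLaw Z (gaussianReal 0 v) P)
    (hind : IndepFun Z T P) : HasCondDistrib X T κ P := by
  have := Measure.isProbabilityMeasure_map hT
  have h1 : HasLaw (fun ω => (T ω, Z ω)) ((P.map T).prod (gaussianReal 0 v)) P :=
    ⟨hT.prodMk hZ.aemeasurable, by
      rw [hind.symm.map_prod_eq_prod_map_map hT hZ.aemeasurable, hZ.map_eq]⟩
  have h2 : HasLaw (fun p : 𝓣 × ℝ => (p.1, m p.1 + p.2)) (P.map T ⊗ₘ κ)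
      ((P.map T).prod (gaussianReal 0 v)) :=
    ⟨(by fun_prop : Measurable fun p : 𝓣 × ℝ => (p.1, m p.1 + p.2)).aemeasurable,
      map_prod_gaussianReal _ hm hκ⟩
  refine (h2.fun_comp h1).congr ?_
  filter_upwards [hX] with ω h
  rw [h]

/-- Conversely, a Gaussian conditional law with nonrandom variance means independent noise. -/
lemma ProbabilityTheory.HasCondDistrib.indepFun_sub (hm : Measurable m) [IsSFiniteKernel κ]
    (hκ : ∀ τ, κ τ = gaussianReal (m τ) v) (h : HasCondDistrib X T κ P) :
    HasLaw (fun ω => X ω - m (T ω)) (gaussianReal 0 v) P ∧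
      IndepFun (fun ω => X ω - m (T ω)) T P := by
  have hT : AEMeasurable T P := h.aemeasurable_fst
  have := Measure.isProbabilityMeasure_map hT
  have hψ : Measurable fun p : 𝓣 × ℝ => (p.1, p.2 - m p.1) := by fun_prop
  have hφ : Measurable fun p : 𝓣 × ℝ => (p.1, m p.1 + p.2) := by fun_prop
  have h2 : HasLaw (fun p : 𝓣 × ℝ => (p.1, p.2 - m p.1))
      ((P.map T).prod (gaussianReal 0 v)) (P.map T ⊗ₘ κ) := by
    refine ⟨hψ.aemeasurable, ?_⟩
    rw [← map_prod_gaussianReal _ hm hκ, Measure.map_map hψ hφ]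
    convert Measure.map_id
    ext p <;> simp
  have h3 : HasLaw (fun ω => (T ω, X ω - m (T ω))) ((P.map T).prod (gaussianReal 0 v)) P :=
    h2.fun_comp h
  have hlaw : HasLaw (fun ω => X ω - m (T ω)) (gaussianReal 0 v) P := by
    have : HasLaw (Prod.snd : 𝓣 × ℝ → ℝ) (gaussianReal 0 v) ((P.map T).prod (gaussianReal 0 v)) :=
      ⟨measurable_snd.aemeasurable, by simp⟩
    exact this.fun_comp h3
  refine ⟨hlaw, IndepFun.symm ?_⟩
  rw [indepFun_iff_map_prod_eq_prod_map_map hT hlaw.aemeasurable, h3.map_eq, hlaw.map_eq]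

end CondLaw

/-! ### Prediction and innovations of a Gaussian process -/

section Innovations

variable {Ω : Type*} [MeasurableSpace Ω] {P : Measure Ω} {G : Submodule ℝ (Ω → ℝ)}
  {U : ℕ → Ω → ℝ} {t n : ℕ}

lemma measurable_block {E : Type*} [MeasurableSpace E] {U : ℕ → Ω → E}
    (hU : ∀ j < t, Measurable (U j)) : Measurable (block U t) :=
  measurable_pi_lambda _ fun j => hU j j.2

lemma predict_mem (hG : IsGaussianSpace P G) (hUm : ∀ j < t, Measurable (U j))
    (hU : ∀ j < t, U j ∈ G) {x : Ω → ℝ} (hx : x ∈ G) :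
    predict P U t x ∈ affSpan P (block U t) :=
  (hG.condExp_mem (measurable_block hUm) (fun j => hU j j.2) hx).1

lemma affSpan_block_le (hG : IsGaussianSpace P G) (hU : ∀ j < t, U j ∈ G) :
    affSpan P (block U t) ≤ G :=
  hG.affSpan_le fun j => hU j j.2

lemma cov_sub_predict (hG : IsGaussianSpace P G) (hUm : ∀ j < t, Measurable (U j))
    (hU : ∀ j < t, U j ∈ G) {x f : Ω → ℝ} (hx : x ∈ G) (hf : f ∈ affSpan P (block U t)) :
    cov[fun ω => x ω - predict P U t x ω, f; P] = 0 :=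
  (hG.condExp_mem (measurable_block hUm) (fun j => hU j j.2) hx).2 f hf

lemma predict_eq (hG : IsGaussianSpace P G) (hUm : ∀ j < t, Measurable (U j))
    (hU : ∀ j < t, U j ∈ G) {x p : Ω → ℝ} (hx : x ∈ G) (hp : p ∈ affSpan P (block U t))
    (hmean : ∫ ω, x ω ∂P = ∫ ω, p ω ∂P)
    (hcov : ∀ j < t, cov[fun ω => x ω - p ω, U j; P] = 0) : predict P U t x =ᵐ[P] p :=
  hG.condExp_eq (measurable_block hUm) (fun j => hU j j.2) hx hp hmean fun j => hcov j j.2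

lemma integral_predict [IsProbabilityMeasure P] {E : Type*} [NormedAddCommGroup E]
    [NormedSpace ℝ E] [CompleteSpace E] (hUm : ∀ j < t, Measurable (U j)) (x : Ω → E) :
    ∫ ω, predict P U t x ω ∂P = ∫ ω, x ω ∂P :=
  integral_condExp (measurable_block hUm).comap_le

lemma predict_apply {k : ℕ} {θ : Ω → Fin k → ℝ} (hθ : ∀ i, Integrable (fun ω => θ ω i) P)
    (i : Fin k) : (fun ω => predict P U t θ ω i) =ᵐ[P] predict P U t fun ω => θ ω i :=
  condExp_apply_ae (Integrable.of_eval hθ) i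

lemma predict_apply_mem (hG : IsGaussianSpace P G) (hUm : ∀ j < t, Measurable (U j))
    (hU : ∀ j < t, U j ∈ G) {k : ℕ} {θ : Ω → Fin k → ℝ} (hθ : ∀ i, (fun ω => θ ω i) ∈ G)
    (i : Fin k) : (fun ω => predict P U t θ ω i) ∈ affSpan P (block U t) :=
  affSpan_congr (predict_mem hG hUm hU (hθ i))
    (predict_apply (fun i => hG.integrable (hθ i)) i).symm

lemma cov_sub_predict_apply (hG : IsGaussianSpace P G) (hUm : ∀ j < t, Measurable (U j))
    (hU : ∀ j < t, U j ∈ G) {k : ℕ} {θ : Ω → Fin k → ℝ} (hθ : ∀ i, (fun ω => θ ω i) ∈ G)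
    (i : Fin k) {f : Ω → ℝ} (hf : f ∈ affSpan P (block U t)) :
    cov[fun ω => θ ω i - predict P U t θ ω i, f; P] = 0 := by
  rw [← cov_sub_predict hG hUm hU (hθ i) hf]
  refine covariance_congr_ae ?_ (by rfl)
  filter_upwards [predict_apply (U := U) (t := t) (fun i => hG.integrable (hθ i)) i] with ω h
  rw [h]

lemma integral_sub_predict_apply (hG : IsGaussianSpace P G) (hUm : ∀ j < t, Measurable (U j))
    {k : ℕ} {θ : Ω → Fin k → ℝ} (hθ : ∀ i, (fun ω => θ ω i) ∈ G) (i : Fin k) :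
    ∫ ω, (θ ω i - predict P U t θ ω i) ∂P = 0 := by
  have := hG.isProbabilityMeasure
  have h := predict_apply (U := U) (t := t) (fun i => hG.integrable (hθ i)) i
  rw [integral_sub (hG.integrable (hθ i)) (integrable_condExp.congr h.symm),
    integral_congr_ae h, integral_predict hUm, sub_self]

lemma stronglyMeasurable_predict {E : Type*} [NormedAddCommGroup E]
    [NormedSpace ℝ E] [CompleteSpace E] (hUm : ∀ j < t, Measurable (U j)) (x : Ω → E) :
    StronglyMeasurable (predict P U t x) :=
  stronglyMeasurable_condExp.mono (measurable_block hUm).comap_le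

/-- Given no observation, the prediction is the mean. -/
lemma predict_zero [IsProbabilityMeasure P] {E : Type*} [NormedAddCommGroup E]
    [NormedSpace ℝ E] [CompleteSpace E] (x : Ω → E) :
    predict P U 0 x = fun _ => ∫ ω, x ω ∂P := by
  have : pastSigma U 0 = ⊥ := by
    have h : block U 0 = fun _ => (fun j => j.elim0) := by
      ext ω j; exact j.elim0
    rw [pastSigma, h]
    exact MeasurableSpace.comap_const _
  rw [predict, this, condExp_bot]

/-- The innovation is an affine function of the variables up to its own time. -/
lemma innov_mem_next (hG : IsGaussianSpace P G) (hUm : ∀ j < n, Measurable (U j))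
    (hU : ∀ j < n, U j ∈ G) (ht : t < n) : innov P U t ∈ affSpan P (block U (t + 1)) :=
  Submodule.sub_mem _ (mem_affSpan_block U (Nat.lt_succ_self t))
    (affSpan_block_mono (Nat.le_succ t) (predict_mem hG (fun j hj => hUm j (hj.trans ht))
      (fun j hj => hU j (hj.trans ht)) (hU t ht)))

lemma innov_mem (hG : IsGaussianSpace P G) (hUm : ∀ j < n, Measurable (U j))
    (hU : ∀ j < n, U j ∈ G) (ht : t < n) : innov P U t ∈ G :=
  affSpan_block_le hG (fun j hj => hU j (by omega)) (innov_mem_next hG hUm hU ht)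

lemma measurable_innov (hUm : ∀ j < n, Measurable (U j)) (ht : t < n) :
    Measurable (innov P U t) :=
  (hUm t ht).sub (stronglyMeasurable_predict (fun j hj => hUm j (hj.trans ht)) _).measurable

lemma cov_innov (hG : IsGaussianSpace P G) (hUm : ∀ j < n, Measurable (U j))
    (hU : ∀ j < n, U j ∈ G) (ht : t < n) {f : Ω → ℝ} (hf : f ∈ affSpan P (block U t)) :
    cov[innov P U t, f; P] = 0 :=
  cov_sub_predict hG (fun j hj => hUm j (hj.trans ht)) (fun j hj => hU j (hj.trans ht))
    (hU t ht) hf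

lemma integral_innov (hG : IsGaussianSpace P G) (hUm : ∀ j < n, Measurable (U j))
    (hU : ∀ j < n, U j ∈ G) (ht : t < n) : ∫ ω, innov P U t ω ∂P = 0 := by
  have := hG.isProbabilityMeasure
  have hi : Integrable (predict P U t (U t)) P := integrable_condExp
  unfold innov
  rw [integral_sub (hG.integrable (hU t ht)) hi,
    integral_predict (fun j hj => hUm j (hj.trans ht)), sub_self]

lemma cov_innov_innov (hG : IsGaussianSpace P G) (hUm : ∀ j < n, Measurable (U j))
    (hU : ∀ j < n, U j ∈ G) {s t : ℕ} (hs : s < n) (ht : t < n) (hst : s ≠ t) :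
    cov[innov P U s, innov P U t; P] = 0 := by
  rcases lt_or_gt_of_ne hst with h | h
  · rw [covariance_comm]
    exact cov_innov hG hUm hU ht (affSpan_block_mono h (innov_mem_next hG hUm hU hs))
  · exact cov_innov hG hUm hU hs (affSpan_block_mono h (innov_mem_next hG hUm hU ht))

lemma indepFun_innov_block (hG : IsGaussianSpace P G) (hUm : ∀ j < n, Measurable (U j))
    (hU : ∀ j < n, U j ∈ G) (ht : t < n) : IndepFun (innov P U t) (block U t) P := by
  refine hG.indepFun_orthTo (innov_mem hG hUm hU ht)
    (measurable_block fun j hj => hUm j (hj.trans ht)).aemeasurable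
    (memVec_pi_real fun j => ⟨hU j (j.2.trans ht), ?_⟩)
  exact cov_innov hG hUm hU ht (mem_affSpan_block U j.2)

lemma iIndepFun_innov (hG : IsGaussianSpace P G) (hUm : ∀ j < n, Measurable (U j))
    (hU : ∀ j < n, U j ∈ G) : iIndepFun (fun t : Fin n => innov P U t) P := by
  have h : HasGaussianLaw (fun ω => fun t : Fin n => innov P U t ω) P :=
    hG.hasGaussianLaw (measurable_pi_lambda _ fun t : Fin n =>
      measurable_innov hUm t.2).aemeasurable
      (memVec_pi_real fun t : Fin n => innov_mem hG hUm hU t.2)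
  exact h.iIndepFun_of_covariance_eq_zero fun s t hst =>
    cov_innov_innov hG hUm hU s.2 t.2 (by simpa [Fin.ext_iff] using hst)

lemma hasLaw_of_mean_zero (hG : IsGaussianSpace P G) {f : Ω → ℝ} (hf : f ∈ G)
    (h0 : ∫ ω, f ω ∂P = 0) : HasLaw f (gaussianReal 0 Var[f; P].toNNReal) P := by
  have h := (hG.gauss f hf).map_eq_gaussianReal
  rw [h0] at h
  exact ⟨(hG.gauss f hf).aemeasurable, h⟩

lemma hasLaw_innov (hG : IsGaussianSpace P G) (hUm : ∀ j < n, Measurable (U j))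
    (hU : ∀ j < n, U j ∈ G) (ht : t < n) :
    HasLaw (innov P U t) (gaussianReal 0 Var[innov P U t; P].toNNReal) P :=
  hasLaw_of_mean_zero hG (innov_mem hG hUm hU ht) (integral_innov hG hUm hU ht)

/-- The conditional mean of a function of a variable independent of the past is its mean. -/
lemma predict_comp_of_indepFun [IsProbabilityMeasure P] (hUm : ∀ j < t, Measurable (U j))
    {E : Type*} [MeasurableSpace E] {f : Ω → E} (hf : AEMeasurable f P)
    (hind : IndepFun f (block U t) P) {φ : E → ℝ} (hφ : Measurable φ) :
    predict P U t (fun ω => φ (f ω)) =ᵐ[P] fun _ => ∫ ω, φ (f ω) ∂P := by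
  have hφf : AEMeasurable (fun ω => φ (f ω)) P := hφ.comp_aemeasurable hf
  have hae := hφf.ae_eq_mk
  have hind' : IndepFun (hφf.mk _) (block U t) P :=
    (hind.comp hφ measurable_id).congr hae (by rfl)
  have h1 := condExp_indep_eq hφf.measurable_mk.comap_le (measurable_block hUm).comap_le
    (comap_measurable (hφf.mk _)).stronglyMeasurable hind'
  refine (condExp_congr_ae hae).trans (h1.trans ?_)
  rw [integral_congr_ae hae]

/-- The conditional variance given the past is nonrandom. -/
lemma predict_innov_sq (hG : IsGaussianSpace P G) (hUm : ∀ j < n, Measurable (U j))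
    (hU : ∀ j < n, U j ∈ G) (ht : t < n) :
    predict P U t (fun ω => innov P U t ω ^ 2) =ᵐ[P] fun _ => Var[innov P U t; P] := by
  have := hG.isProbabilityMeasure
  have h := predict_comp_of_indepFun (fun j hj => hUm j (hj.trans ht))
    (measurable_innov hUm ht).aemeasurable (indepFun_innov_block hG hUm hU ht)
    (φ := fun x : ℝ => x ^ 2) (by fun_prop)
  rw [variance_of_integral_eq_zero (measurable_innov hUm ht).aemeasurable
    (integral_innov hG hUm hU ht)]
  exact h

/-- The conditional law of `U_t` given its past is Gaussian, with the variance of the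
innovation. -/
lemma exists_hasCondDistrib_block (hG : IsGaussianSpace P G) (hUm : ∀ j < n, Measurable (U j))
    (hU : ∀ j < n, U j ∈ G) (ht : t < n) :
    ∃ (a : ℝ) (g : Fin t → ℝ), ∀ᵐ y ∂(P.map (block U t)),
      haveI := hG.isProbabilityMeasure
      condDistrib (U t) (block U t) P y =
        gaussianReal (a + g ⬝ᵥ y) Var[innov P U t; P].toNNReal := by
  have := hG.isProbabilityMeasure
  have hUm' : ∀ j < t, Measurable (U j) := fun j hj => hUm j (hj.trans ht)
  obtain ⟨a, g, hag⟩ := predict_mem hG hUm' (fun j hj => hU j (hj.trans ht)) (hU t ht)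
  have hm : Measurable fun y : Fin t → ℝ => a + g ⬝ᵥ y := by unfold dotProduct; fun_prop
  let κ : Kernel (Fin t → ℝ) ℝ :=
    ⟨fun y => gaussianReal (a + g ⬝ᵥ y) Var[innov P U t; P].toNNReal,
      measurable_gaussianReal.comp (hm.prodMk measurable_const)⟩
  have hκ : ∀ y, κ y = gaussianReal (a + g ⬝ᵥ y) Var[innov P U t; P].toNNReal := fun y => rfl
  have : IsMarkovKernel κ := ⟨fun y => by rw [hκ]; infer_instance⟩
  have h : HasCondDistrib (U t) (block U t) κ P := by
    refine hasCondDistrib_gaussianReal hm hκ (measurable_block hUm').aemeasurable ?_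
      (hasLaw_innov hG hUm hU ht) (indepFun_innov_block hG hUm hU ht)
    filter_upwards [hag] with ω h
    rw [← h, innov]; ring
  exact ⟨a, g, condDistrib_ae_eq_of_measure_eq_compProd _ (hUm t ht).aemeasurable h.map_eq⟩

/-- The conditional entropy given the past exists, and is that of the innovation. -/
lemma condDiffEntropy_eq (hG : IsGaussianSpace P G) [IsProbabilityMeasure P]
    (hUm : ∀ j < n, Measurable (U j))
    (hU : ∀ j < n, U j ∈ G) (ht : t < n) (hpos : 0 < Var[innov P U t; P]) :
    ((∀ᵐ y ∂(P.map (block U t)), HasDiffEntropy (condDistrib (U t) (block U t) P y)) ∧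
      Integrable (fun y => diffEntropy (condDistrib (U t) (block U t) P y)) (P.map (block U t))) ∧
    condDiffEntropy P (U t) (block U t) =
      1 / 2 * Real.log (2 * Real.pi * Real.exp 1 * Var[innov P U t; P]) := by
  obtain ⟨a, g, h⟩ := exists_hasCondDistrib_block hG hUm hU ht
  have hv : Var[innov P U t; P].toNNReal ≠ 0 := by simpa using hpos
  have := Measure.isProbabilityMeasure_map (μ := P)
    (measurable_block fun j hj => hUm j (hj.trans ht) : Measurable (block U t)).aemeasurable
  have h2 : (fun y => diffEntropy (condDistrib (U t) (block U t) P y)) =ᵐ[P.map (block U t)]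
      fun _ => 1 / 2 * Real.log (2 * Real.pi * Real.exp 1 * Var[innov P U t; P]) := by
    filter_upwards [h] with y hy
    rw [hy, (diffEntropy_gaussianReal _ hv).2, Real.coe_toNNReal _ hpos.le]
  refine ⟨⟨?_, (integrable_const _).congr h2.symm⟩, ?_⟩
  · filter_upwards [h] with y hy
    rw [hy]; exact (diffEntropy_gaussianReal _ hv).1
  · rw [condDiffEntropy, integral_congr_ae h2]; simp

omit [MeasurableSpace Ω] in
/-- A linear function of the first `t` variables, as a function of the first `n` variables. -/
lemma dotProduct_block {t n : ℕ} (ht : t ≤ n) (g : Fin t → ℝ) (U : ℕ → Ω → ℝ) (ω : Ω) :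
    g ⬝ᵥ block U t ω = ∑ j : Fin n, if h : (j : ℕ) < t then g ⟨j, h⟩ * U j ω else 0 := by
  rw [dotProduct, ← Finset.sum_filter_add_sum_filter_not Finset.univ
    (fun j : Fin n => (j : ℕ) < t)]
  rw [Finset.sum_eq_zero (s := Finset.univ.filter fun j : Fin n => ¬ (j : ℕ) < t)
    (fun j hj => dif_neg (Finset.mem_filter.1 hj).2), add_zero]
  refine Finset.sum_bij (fun j _ => Fin.castLE ht j) ?_ ?_ ?_ ?_
  · exact fun j _ => Finset.mem_filter.2 ⟨Finset.mem_univ _, j.2⟩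
  · intro j _ j' _ hjj
    simpa [Fin.ext_iff] using hjj
  · intro j hj
    exact ⟨⟨j, (Finset.mem_filter.1 hj).2⟩, Finset.mem_univ _, by ext; rfl⟩
  · intro j _
    simp [block]

/-- The innovations are obtained from the process by a unimodular affine map. -/
lemma exists_innov_affine (hG : IsGaussianSpace P G) (hUm : ∀ j < n, Measurable (U j))
    (hU : ∀ j < n, U j ∈ G) :
    ∃ (T : Matrix (Fin n) (Fin n) ℝ) (a : Fin n → ℝ), T.det = 1 ∧
      block (innov P U) n =ᵐ[P] fun ω => T *ᵥ block U n ω - a := by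
  have h : ∀ t : Fin n, ∃ (a : ℝ) (g : Fin t → ℝ),
      predict P U t (U t) =ᵐ[P] fun ω => a + g ⬝ᵥ block U t ω := fun t =>
    predict_mem hG (fun j hj => hUm j (hj.trans t.2)) (fun j hj => hU j (hj.trans t.2))
      (hU t t.2)
  choose a g hag using h
  let T : Matrix (Fin n) (Fin n) ℝ :=
    Matrix.of fun i j => if j = i then 1 else if h : (j : ℕ) < i then -g i ⟨j, h⟩ else 0
  refine ⟨T, a, ?_, ?_⟩
  · rw [Matrix.det_of_isLowerTriangular]
    · exact Finset.prod_eq_one fun i _ => by simp [T]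
    · intro i j hij
      have hij' : i < j := hij
      simp only [T, Matrix.of_apply]
      rw [if_neg hij'.ne', dif_neg]
      have : (i : ℕ) < j := hij'
      omega
  · have h2 : ∀ᵐ ω ∂P, ∀ t : Fin n, predict P U t (U t) ω = a t + g t ⬝ᵥ block U t ω :=
      ae_all_iff.2 hag
    filter_upwards [h2] with ω hω
    ext i
    have hsum : (T *ᵥ block U n ω) i = U i ω - g i ⬝ᵥ block U i ω := by
      have h4 : U i ω = ∑ j : Fin n, if j = i then U j ω else 0 := by simp
      rw [dotProduct_block i.2.le, h4, ← Finset.sum_sub_distrib, mulVec, dotProduct]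
      refine Finset.sum_congr rfl fun j _ => ?_
      simp only [T, Matrix.of_apply, block]
      by_cases hji : j = i
      · subst hji; simp
      · by_cases hlt : (j : ℕ) < i <;> simp [hji, hlt]
    simp only [Pi.sub_apply, hsum]
    rw [block, innov, hω i]; ring

lemma covariance_mulVec (hG : IsGaussianSpace P G) {ι κ : Type*} [Fintype ι] [Fintype κ]
    {u : Ω → ι → ℝ} {w : Ω → κ → ℝ} (hu : ∀ i, (fun ω => u ω i) ∈ G)
    (hw : ∀ i, (fun ω => w ω i) ∈ G) (a : ι → ℝ) (b : κ → ℝ) :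
    cov[fun ω => a ⬝ᵥ u ω, fun ω => b ⬝ᵥ w ω; P] =
      a ⬝ᵥ (Matrix.of fun i j => cov[fun ω => u ω i, fun ω => w ω j; P]) *ᵥ b := by
  have := hG.isProbabilityMeasure
  simp only [dotProduct, mulVec, Matrix.of_apply]
  rw [covariance_fun_sum_fun_sum (fun i => (hG.memLp (hu i)).const_mul (a i))
    (fun i => (hG.memLp (hw i)).const_mul (b i))]
  refine Finset.sum_congr rfl fun i _ => ?_
  rw [Finset.mul_sum]
  refine Finset.sum_congr rfl fun j _ => ?_
  rw [covariance_const_mul_left, covariance_const_mul_right]; ring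

/-- The determinant of the covariance matrix of a process is the product of the variances of
its innovations. -/
lemma det_covariance_eq_prod_var_innov (hG : IsGaussianSpace P G)
    (hUm : ∀ j < n, Measurable (U j)) (hU : ∀ j < n, U j ∈ G) :
    (Matrix.of fun i j : Fin n => cov[U i, U j; P]).det = ∏ t : Fin n, Var[innov P U t; P] := by
  have := hG.isProbabilityMeasure
  obtain ⟨T, a, hT, hTa⟩ := exists_innov_affine hG hUm hU
  set K := (Matrix.of fun i j : Fin n => cov[U i, U j; P]) with hK
  have h1 : Matrix.diagonal (fun t : Fin n => Var[innov P U t; P]) = T * K * Tᵀ := by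
    ext i j
    have h2 : cov[innov P U i, innov P U j; P] =
        cov[fun ω => T i ⬝ᵥ block U n ω, fun ω => T j ⬝ᵥ block U n ω; P] := by
      have h3 : ∀ i : Fin n, innov P U i =ᵐ[P] fun ω => T i ⬝ᵥ block U n ω - a i := fun i => by
        filter_upwards [hTa] with ω h
        exact congrFun h i
      have hmem : ∀ i, (fun ω => T i ⬝ᵥ block U n ω) ∈ G := fun i =>
        dotProduct_mem (f := block U n) (fun j => hU j j.2) (T i)
      rw [covariance_congr_ae (h3 i) (h3 j),
        covariance_sub_const_left (hG.integrable (hmem i)),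
        covariance_sub_const_right (hG.integrable (hmem j))]
    have h4 : cov[innov P U i, innov P U j; P] = (T * K * Tᵀ) i j := by
      rw [h2, covariance_mulVec hG (u := block U n) (w := block U n) (fun j => hU j j.2)
        (fun j => hU j j.2)]
      simp only [Matrix.mul_assoc]
      rfl
    rw [← h4]
    by_cases hij : i = j
    · subst hij
      rw [Matrix.diagonal_apply_eq, covariance_self (measurable_innov hUm i.2).aemeasurable]
    · rw [Matrix.diagonal_apply_ne _ hij,
        cov_innov_innov hG hUm hU i.2 j.2 (by simpa [Fin.ext_iff] using hij)]
  have h5 := congrArg Matrix.det h1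
  rw [Matrix.det_diagonal, Matrix.det_mul, Matrix.det_mul, Matrix.det_transpose, hT] at h5
  rw [h5]; ring

lemma diffEntropy_block (hG : IsGaussianSpace P G) [IsProbabilityMeasure P]
    (hUm : ∀ j < n, Measurable (U j)) (hU : ∀ j < n, U j ∈ G)
    (hpos : ∀ t < n, 0 < Var[innov P U t; P]) :
    HasDiffEntropy (P.map (block U n)) ∧ diffEntropy (P.map (block U n)) =
      1 / 2 * ∑ t ∈ Finset.range n,
        Real.log (2 * Real.pi * Real.exp 1 * Var[innov P U t; P]) := by
  obtain ⟨T, a, hT, hTa⟩ := exists_innov_affine hG hUm hU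
  have hlaw : HasLaw (block (innov P U) n)
      (Measure.pi fun t : Fin n => gaussianReal 0 Var[innov P U t; P].toNNReal) P := by
    have hm : ∀ t : Fin n, AEMeasurable (innov P U t) P := fun t =>
      (measurable_innov hUm t.2).aemeasurable
    refine ⟨(measurable_block fun t ht => measurable_innov hUm ht).aemeasurable, ?_⟩
    have h := (iIndepFun_iff_map_fun_eq_pi_map hm).1 (iIndepFun_innov hG hUm hU)
    simp_rw [fun t : Fin n => (hasLaw_innov hG hUm hU t.2).map_eq] at h
    exact h
  have h := diffEntropy_of_affine (measurable_block hUm).aemeasurable T hT a hTa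
    (fun t : Fin n => Var[innov P U t; P].toNNReal) (fun t => by simpa using hpos t t.2) hlaw
  refine ⟨h.1, ?_⟩
  rw [h.2, ← Fin.sum_univ_eq_sum_range
    (fun t => Real.log (2 * Real.pi * Real.exp 1 * Var[innov P U t; P]))]
  congr 1
  refine Finset.sum_congr rfl fun t _ => ?_
  rw [Real.coe_toNNReal _ (hpos t t.2).le]

end Innovations

/-! ### One step of the generalized Kalman filter -/

section KalmanAlgebra

variable {V : Type*} [AddCommGroup V] [Module ℝ V] (B : V →ₗ[ℝ] V →ₗ[ℝ] ℝ) {k : ℕ}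
  {E Ξ : Fin k → V} {H : V} {K Q A : Matrix (Fin k) (Fin k) ℝ} {q h : Fin k → ℝ} {r : ℝ}

/-- The linear combination `∑ a_j E_j`. -/
def linComb (E : Fin k → V) (a : Fin k → ℝ) : V := ∑ j, a j • E j

lemma form_linComb (hK : ∀ i j, B (E i) (E j) = K i j) (a b : Fin k → ℝ) :
    B (linComb E a) (linComb E b) = a ⬝ᵥ K *ᵥ b := by
  unfold linComb
  rw [map_sum B, LinearMap.sum_apply]
  refine Finset.sum_congr rfl fun i _ => ?_
  rw [map_smul B, LinearMap.smul_apply, map_sum, smul_eq_mul]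
  congr 1
  refine Finset.sum_congr rfl fun j _ => ?_
  rw [map_smul, hK, smul_eq_mul, mul_comm]

lemma form_linComb_eq_zero {x : V} (hx : ∀ i, B x (E i) = 0) (a : Fin k → ℝ) :
    B x (linComb E a) = 0 := by
  simp [linComb, hx]

variable (hsymm : ∀ x y, B x y = B y x) (hK : ∀ i j, B (E i) (E j) = K i j)
  (hHE : ∀ i, B H (E i) = 0) (hΞE : ∀ i j, B (Ξ i) (E j) = 0) (hH : B H H = r)
  (hΞH : ∀ i, B (Ξ i) H = q i) (hΞ : ∀ i j, B (Ξ i) (Ξ j) = Q i j)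

include hsymm hK hHE hH in
/-- The variance of the innovation `∑ h_j E_j + H`. -/
lemma form_innovation :
    B (linComb E h + H) (linComb E h + H) = h ⬝ᵥ K *ᵥ h + r := by
  simp only [map_add, LinearMap.add_apply, form_linComb B hK, hsymm (linComb E h) H,
    form_linComb_eq_zero B hHE, hH]
  ring

include hsymm hK hHE hΞE hH hΞH in
/-- With the gain `g = v⁻¹ (A K h + q)` the new error is orthogonal to the innovation. -/
lemma form_error_innovation (hv : h ⬝ᵥ K *ᵥ h + r ≠ 0) (i : Fin k) :
    B (linComb E (A i) + Ξ i -
        ((h ⬝ᵥ K *ᵥ h + r)⁻¹ • (A *ᵥ (K *ᵥ h) + q)) i • (linComb E h + H))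
      (linComb E h + H) = 0 := by
  have h1 := form_innovation B (h := h) hsymm hK hHE hH
  rw [map_sub, LinearMap.sub_apply, map_smul, LinearMap.smul_apply, h1]
  simp only [map_add, LinearMap.add_apply, form_linComb B hK, hsymm (linComb E (A i)) H,
    form_linComb_eq_zero B hHE, form_linComb_eq_zero B (hΞE i), hΞH, Pi.smul_apply, Pi.add_apply,
    smul_eq_mul]
  have h2 : (A *ᵥ (K *ᵥ h)) i = A i ⬝ᵥ K *ᵥ h := rfl
  rw [h2]
  field_simp
  ring

include hsymm hK hHE hΞE hH hΞH hΞ in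
/-- The Riccati recursion for the error covariance. -/
lemma form_error_error (hv : h ⬝ᵥ K *ᵥ h + r ≠ 0) (i j : Fin k) :
    B (linComb E (A i) + Ξ i -
        ((h ⬝ᵥ K *ᵥ h + r)⁻¹ • (A *ᵥ (K *ᵥ h) + q)) i • (linComb E h + H))
      (linComb E (A j) + Ξ j -
        ((h ⬝ᵥ K *ᵥ h + r)⁻¹ • (A *ᵥ (K *ᵥ h) + q)) j • (linComb E h + H)) =
    (A * K * Aᵀ + Q - (h ⬝ᵥ K *ᵥ h + r)⁻¹ •
      vecMulVec (A *ᵥ (K *ᵥ h) + q) (A *ᵥ (K *ᵥ h) + q)) i j := by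
  rw [map_sub (B _), map_smul (B _),
    form_error_innovation B hsymm hK hHE hΞE hH hΞH hv i]
  have hKs : h ⬝ᵥ K *ᵥ A j = (A *ᵥ (K *ᵥ h)) j := by
    have h2 : (A *ᵥ (K *ᵥ h)) j = A j ⬝ᵥ K *ᵥ h := rfl
    rw [h2, ← form_linComb B hK, ← form_linComb B hK, hsymm]
  have hAKA : (A * K * Aᵀ) i j = A i ⬝ᵥ K *ᵥ A j := by
    simp only [Matrix.mul_assoc]; rfl
  have hΞE' : B (linComb E (A i)) (Ξ j) = 0 := by
    rw [hsymm]; exact form_linComb_eq_zero B (hΞE j) _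
  have hhΞ : B (linComb E h) (Ξ j) = 0 := by
    rw [hsymm]; exact form_linComb_eq_zero B (hΞE j) _
  simp only [map_add, map_sub, map_smul, LinearMap.add_apply, LinearMap.sub_apply,
    LinearMap.smul_apply, form_linComb B hK, form_linComb_eq_zero B hHE,
    form_linComb_eq_zero B (hΞE _), hΞ, hΞE', hhΞ, hsymm H (Ξ j), hΞH, smul_eq_mul,
    Matrix.sub_apply, Matrix.add_apply, Matrix.smul_apply, vecMulVec_apply, Pi.smul_apply,
    Pi.add_apply, hKs, hAKA]
  ring

end KalmanAlgebra

section KalmanStep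

variable {Ω : Type*} [MeasurableSpace Ω] {P : Measure Ω} {G : Submodule ℝ (Ω → ℝ)}
  {U : ℕ → Ω → ℝ} {t k : ℕ}

lemma errCov_eq_cov [IsProbabilityMeasure P] {U U' : Ω → Fin k → ℝ}
    (h0 : ∀ i, ∫ ω, (U ω i - U' ω i) ∂P = 0) (i j : Fin k) :
    errCov P U U' i j = cov[fun ω => U ω i - U' ω i, fun ω => U ω j - U' ω j; P] := by
  simp only [errCov, Matrix.of_apply, covariance, h0, sub_zero]

lemma errCov_predict (hG : IsGaussianSpace P G) (hUm : ∀ j < t, Measurable (U j))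
    {θ : Ω → Fin k → ℝ} (hθ : ∀ i, (fun ω => θ ω i) ∈ G) (i j : Fin k) :
    errCov P θ (predict P U t θ) i j = cov[fun ω => θ ω i - predict P U t θ ω i,
      fun ω => θ ω j - predict P U t θ ω j; P] :=
  haveI := hG.isProbabilityMeasure
  errCov_eq_cov (fun i => integral_sub_predict_apply hG hUm hθ i) i j

/-- The linear functionals of the prediction error have the error covariance as covariance. -/
lemma cov_dotProduct_error (hG : IsGaussianSpace P G) (hUm : ∀ j < t, Measurable (U j))
    (hU : ∀ j < t, U j ∈ G) {θ : Ω → Fin k → ℝ} (hθ : ∀ i, (fun ω => θ ω i) ∈ G)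
    (a b : Fin k → ℝ) :
    cov[fun ω => a ⬝ᵥ (θ ω - predict P U t θ ω), fun ω => b ⬝ᵥ (θ ω - predict P U t θ ω); P] =
      a ⬝ᵥ errCov P θ (predict P U t θ) *ᵥ b := by
  have he : ∀ i, (fun ω => θ ω i - predict P U t θ ω i) ∈ G := fun i =>
    G.sub_mem (hθ i) (affSpan_block_le hG hU (predict_apply_mem hG hUm hU hθ i))
  rw [covariance_mulVec hG (u := fun ω => θ ω - predict P U t θ ω)
    (w := fun ω => θ ω - predict P U t θ ω) he he]
  congr 2
  ext i j
  rw [errCov_predict hG hUm hθ]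
  rfl

lemma errCov_posSemidef (hG : IsGaussianSpace P G) (hUm : ∀ j < t, Measurable (U j))
    (hU : ∀ j < t, U j ∈ G) {θ : Ω → Fin k → ℝ} (hθ : ∀ i, (fun ω => θ ω i) ∈ G) :
    (errCov P θ (predict P U t θ)).PosSemidef := by
  refine Matrix.PosSemidef.of_dotProduct_mulVec_nonneg ?_ fun x => ?_
  · ext i j
    simp only [conjTranspose_apply, star_trivial]
    simp only [errCov, Matrix.of_apply, mul_comm]
  · have he : ∀ i, (fun ω => θ ω i - predict P U t θ ω i) ∈ G := fun i =>
      G.sub_mem (hθ i) (affSpan_block_le hG hU (predict_apply_mem hG hUm hU hθ i))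
    simp only [star_trivial]
    rw [← cov_dotProduct_error hG hUm hU hθ, covariance_self
      (hG.gauss _ (dotProduct_mem (f := fun ω => θ ω - predict P U t θ ω) he x)).aemeasurable]
    exact variance_nonneg _ _

/-- The prediction error has a nonrandom conditional covariance. -/
lemma predict_error_mul_error (hG : IsGaussianSpace P G) (hUm : ∀ j < t, Measurable (U j))
    (hU : ∀ j < t, U j ∈ G) {θ : Ω → Fin k → ℝ} (hθ : ∀ i, (fun ω => θ ω i) ∈ G)
    (i j : Fin k) :
    predict P U t (fun ω => (θ ω i - predict P U t θ ω i) * (θ ω j - predict P U t θ ω j))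
      =ᵐ[P] fun _ => errCov P θ (predict P U t θ) i j := by
  have := hG.isProbabilityMeasure
  have he : ∀ i, (fun ω => θ ω i - predict P U t θ ω i) ∈ G := fun i =>
    G.sub_mem (hθ i) (affSpan_block_le hG hU (predict_apply_mem hG hUm hU hθ i))
  have hem : AEMeasurable (fun ω => θ ω - predict P U t θ ω) P :=
    aemeasurable_pi_lambda _ fun i => (hG.gauss _ (he i)).aemeasurable
  have hUG : ∀ f ∈ affSpan P (block U t), f ∈ G := affSpan_block_le hG hU
  have hind : IndepFun (fun ω => θ ω - predict P U t θ ω) (block U t) P := by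
    refine hG.indepFun_of_cov hem (measurable_block hUm).aemeasurable
      (memVec_pi_real he) (memVec_pi_real fun j => hU j j.2) fun L L' => ?_
    have h1 : (fun ω => L' (block U t ω)) ∈ affSpan P (block U t) :=
      memVec_pi_real (f := block U t) (fun j => coord_mem_affSpan (block U t) j) L'
    have h2 := memVec_pi_real (G := orthTo P hG (hUG _ h1))
      (f := fun ω => θ ω - predict P U t θ ω)
      (fun i => ⟨he i, by
        rw [covariance_comm]; exact cov_sub_predict_apply hG hUm hU hθ i h1⟩) L
    rw [covariance_comm]
    exact h2.2
  exact predict_comp_of_indepFun hUm hem hind (φ := fun e : Fin k → ℝ => e i * e j) (by fun_prop)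

/-- The mean as a linear form on a Gaussian space. -/
noncomputable def meanForm (hG : IsGaussianSpace P G) : G →ₗ[ℝ] ℝ where
  toFun f := ∫ ω, (f : Ω → ℝ) ω ∂P
  map_add' f g := integral_add (hG.integrable f.2) (hG.integrable g.2)
  map_smul' c _ := integral_const_mul c _

/-- One step of the filter for the observation `U_t = h·θ + R + η`, where `R` depends on the past
of `U`, and the state update `θ' = A θ + ξ`; the noise `(ξ, η)` is centred and uncorrelated with
the state `θ` and the past of `U`. -/
lemma kalman_step (hG : IsGaussianSpace P G) (hUm : ∀ j < t + 1, Measurable (U j))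
    (hU : ∀ j < t + 1, U j ∈ G) {θ θ' ξ : Ω → Fin k → ℝ} {η R : Ω → ℝ}
    (hθ : ∀ i, (fun ω => θ ω i) ∈ G) (hξ : ∀ i, (fun ω => ξ ω i) ∈ G) (hη : η ∈ G)
    (hR : R ∈ affSpan P (block U t)) {A K Q : Matrix (Fin k) (Fin k) ℝ} {h q : Fin k → ℝ} {r : ℝ}
    (hUt : U t =ᵐ[P] fun ω => h ⬝ᵥ θ ω + R ω + η ω)
    (hθ' : θ' =ᵐ[P] fun ω => A *ᵥ θ ω + ξ ω)
    (hη0 : ∫ ω, η ω ∂P = 0) (hξ0 : ∀ i, ∫ ω, ξ ω i ∂P = 0)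
    (hηθ : ∀ i, cov[η, fun ω => θ ω i; P] = 0) (hηU : ∀ j < t, cov[η, U j; P] = 0)
    (hξθ : ∀ i i', cov[fun ω => ξ ω i, fun ω => θ ω i'; P] = 0)
    (hξU : ∀ i, ∀ j < t, cov[fun ω => ξ ω i, U j; P] = 0)
    (hK : errCov P θ (predict P U t θ) = K)
    (hr : cov[η, η; P] = r) (hq : ∀ i, cov[fun ω => ξ ω i, η; P] = q i)
    (hQ : ∀ i j, cov[fun ω => ξ ω i, fun ω => ξ ω j; P] = Q i j)
    (hv : h ⬝ᵥ K *ᵥ h + r ≠ 0) :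
    innov P U t =ᵐ[P] (fun ω => h ⬝ᵥ (θ ω - predict P U t θ ω) + η ω) ∧
    Var[innov P U t; P] = h ⬝ᵥ K *ᵥ h + r ∧
    predict P U (t + 1) θ' =ᵐ[P] (fun ω => A *ᵥ predict P U t θ ω +
      innov P U t ω • (h ⬝ᵥ K *ᵥ h + r)⁻¹ • (A *ᵥ (K *ᵥ h) + q)) ∧
    errCov P θ' (predict P U (t + 1) θ') = A * K * Aᵀ + Q - (h ⬝ᵥ K *ᵥ h + r)⁻¹ •
      vecMulVec (A *ᵥ (K *ᵥ h) + q) (A *ᵥ (K *ᵥ h) + q) := by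
  have := hG.isProbabilityMeasure
  have hUm' : ∀ j < t, Measurable (U j) := fun j hj => hUm j (by omega)
  have hU' : ∀ j < t, U j ∈ G := fun j hj => hU j (by omega)
  have hpθ : ∀ i, (fun ω => predict P U t θ ω i) ∈ affSpan P (block U t) :=
    predict_apply_mem hG hUm' hU' hθ
  have hpθG : ∀ i, (fun ω => predict P U t θ ω i) ∈ G := fun i =>
    affSpan_block_le hG hU' (hpθ i)
  have he : ∀ i, (fun ω => θ ω i - predict P U t θ ω i) ∈ G := fun i =>
    G.sub_mem (hθ i) (hpθG i)
  have he0 : ∀ i, ∫ ω, (θ ω i - predict P U t θ ω i) ∂P = 0 :=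
    integral_sub_predict_apply hG hUm' hθ
  have heU : ∀ i, ∀ j < t, cov[fun ω => θ ω i - predict P U t θ ω i, U j; P] = 0 :=
    fun i j hj => cov_sub_predict_apply hG hUm' hU' hθ i (mem_affSpan_block U hj)
  -- the past of `U`, and hence the prediction, is uncorrelated with the noise
  have hnoise : ∀ {z : Ω → ℝ} (hz : z ∈ G), (∀ i, cov[z, fun ω => θ ω i; P] = 0) →
      (∀ j < t, cov[z, U j; P] = 0) →
      ∀ i, cov[z, fun ω => θ ω i - predict P U t θ ω i; P] = 0 := by
    intro z hz h1 h2 i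
    have h3 : (fun ω => predict P U t θ ω i) ∈ orthTo P hG hz :=
      (isGaussianSpace_orthTo hG hz).affSpan_le (fun j => ⟨hU' j j.2, h2 j j.2⟩) (hpθ i)
    exact ((orthTo P hG hz).sub_mem ⟨hθ i, h1 i⟩ h3).2
  let B := covForm hG
  let E : Fin k → G := fun i => ⟨fun ω => θ ω i - predict P U t θ ω i, he i⟩
  let Ξ : Fin k → G := fun i => ⟨fun ω => ξ ω i, hξ i⟩
  let H : G := ⟨η, hη⟩
  have hBK : ∀ i j, B (E i) (E j) = K i j := fun i j => by
    rw [← hK, errCov_predict hG hUm' hθ]; rfl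
  have hHE : ∀ i, B H (E i) = 0 := hnoise hη hηθ hηU
  have hΞE : ∀ i j, B (Ξ i) (E j) = 0 := fun i => hnoise (hξ i) (hξθ i) (hξU i)
  have hsymm : ∀ x y, B x y = B y x := covForm_symm hG
  have hlin : ∀ (a : Fin k → ℝ) (ω : Ω),
      ((linComb E a : G) : Ω → ℝ) ω = a ⬝ᵥ (θ ω - predict P U t θ ω) := fun a ω => by
    simp [linComb, E, dotProduct]
  set ι : G := linComb E h + H with hι
  have hιω : ∀ ω, (ι : Ω → ℝ) ω = h ⬝ᵥ (θ ω - predict P U t θ ω) + η ω := fun ω => by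
    rw [← hlin]; rfl
  let m := meanForm hG
  have hmE : ∀ i, m (E i) = 0 := he0
  have hmΞ : ∀ i, m (Ξ i) = 0 := hξ0
  have hmH : m H = 0 := hη0
  have hmlin : ∀ a : Fin k → ℝ, m (linComb E a) = 0 := fun a => by simp [linComb, hmE]
  have hmι : m ι = 0 := by rw [hι, map_add, hmlin, hmH, add_zero]
  have hι0 : ∫ ω, (ι : Ω → ℝ) ω ∂P = 0 := hmι
  -- the elements of `G` uncorrelated with an observation `U_j`
  have hlinU : ∀ (j) (hj : j < t) (a : Fin k → ℝ), B ⟨U j, hU' j hj⟩ (linComb E a) = 0 := by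
    intro j hj a
    exact form_linComb_eq_zero B (fun i => by rw [hsymm]; exact heU i j hj) a
  have hιU : ∀ (j) (hj : j < t), B ⟨U j, hU' j hj⟩ ι = 0 := by
    intro j hj
    rw [hι, map_add, hlinU j hj, hsymm _ H, zero_add]
    exact hηU j hj
  -- the innovation
  set p : Ω → ℝ := fun ω => h ⬝ᵥ predict P U t θ ω + R ω with hp
  have hpmem : p ∈ affSpan P (block U t) := add_mem (dotProduct_mem hpθ h) hR
  have hpG : p ∈ G := affSpan_block_le hG hU' hpmem
  have hdiff : (fun ω => U t ω - p ω) =ᵐ[P] (ι : Ω → ℝ) := by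
    filter_upwards [hUt] with ω hω
    rw [hω, hιω, hp, dotProduct_sub]; ring
  have hpred : predict P U t (U t) =ᵐ[P] p := by
    refine predict_eq hG hUm' hU' (hU t (by omega)) hpmem ?_ fun j hj => ?_
    · rw [← sub_eq_zero, ← integral_sub (hG.integrable (hU t (by omega))) (hG.integrable hpG),
        integral_congr_ae hdiff, hι0]
    · rw [covariance_congr_ae hdiff (by rfl : U j =ᵐ[P] U j), covariance_comm]
      exact hιU j hj
  have hinnov : innov P U t =ᵐ[P] (ι : Ω → ℝ) := by
    filter_upwards [hpred, hdiff] with ω h1 h2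
    rw [innov, h1, h2]
  have hvar : Var[innov P U t; P] = h ⬝ᵥ K *ᵥ h + r := by
    rw [variance_congr hinnov, ← covariance_self (hG.gauss _ ι.2).aemeasurable]
    exact form_innovation B hsymm hBK hHE hr
  -- the updated state
  set v := h ⬝ᵥ K *ᵥ h + r with hvdef
  set g : Fin k → ℝ := v⁻¹ • (A *ᵥ (K *ᵥ h) + q) with hg
  let E' : Fin k → G := fun i => linComb E (A i) + Ξ i - g i • ι
  have hE'ω : ∀ i ω, (E' i : Ω → ℝ) ω =
      (A *ᵥ (θ ω - predict P U t θ ω)) i + ξ ω i - g i * (ι : Ω → ℝ) ω := fun i ω => by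
    have : (A *ᵥ (θ ω - predict P U t θ ω)) i = A i ⬝ᵥ (θ ω - predict P U t θ ω) := rfl
    rw [this, ← hlin]; rfl
  have hinnmem : innov P U t ∈ affSpan P (block U (t + 1)) :=
    innov_mem_next hG hUm hU (Nat.lt_succ_self t)
  have hθ'G : ∀ i, (fun ω => θ' ω i) ∈ G := fun i => by
    refine hG.congr _ (G.add_mem (mulVec_mem hθ A i) (hξ i)) _ ?_
    filter_upwards [hθ'] with ω hω
    rw [hω]; rfl
  have hcomp : ∀ i, predict P U (t + 1) (fun ω => θ' ω i) =ᵐ[P]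
      fun ω => (A *ᵥ predict P U t θ ω) i + innov P U t ω * g i := by
    intro i
    have hmem : (fun ω => (A *ᵥ predict P U t θ ω) i + innov P U t ω * g i) ∈
        affSpan P (block U (t + 1)) := by
      refine add_mem (mulVec_mem (fun i => affSpan_block_mono (Nat.le_succ t) (hpθ i)) A i) ?_
      have : (fun ω => innov P U t ω * g i) = g i • innov P U t := by
        ext ω; simp [mul_comm]
      rw [this]; exact Submodule.smul_mem _ _ hinnmem
    have hd : (fun ω => θ' ω i - ((A *ᵥ predict P U t θ ω) i + innov P U t ω * g i)) =ᵐ[P]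
        (E' i : Ω → ℝ) := by
      filter_upwards [hθ', hinnov] with ω h1 h2
      rw [h1, h2, hE'ω, mulVec_sub]; simp only [Pi.add_apply, Pi.sub_apply]; ring
    refine predict_eq hG hUm hU (hθ'G i) hmem ?_ fun j hj => ?_
    · rw [← sub_eq_zero, ← integral_sub (hG.integrable (hθ'G i))
        (hG.integrable (affSpan_block_le hG hU hmem)), integral_congr_ae hd]
      have h1 : m (E' i) = 0 := by
        simp only [E', map_sub, map_add, map_smul, hmlin, hmΞ, hmι]; simp
      exact h1
    · rw [covariance_congr_ae hd (by rfl : U j =ᵐ[P] U j)]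
      rcases Nat.lt_succ_iff_lt_or_eq.1 hj with hj | rfl
      · have h1 : B ⟨U j, hU' j hj⟩ (E' i) = 0 := by
          rw [map_sub, map_add, map_smul, hlinU j hj, hιU j hj, hsymm _ (Ξ i)]
          have : B (Ξ i) ⟨U j, hU' j hj⟩ = 0 := hξU i j hj
          rw [this]; simp
        rw [covariance_comm]; exact h1
      · -- `U_t` is the sum of its prediction and of the innovation
        have h1 : U j =ᵐ[P] fun ω => p ω + (ι : Ω → ℝ) ω := by
          filter_upwards [hdiff] with ω h; rw [← h]; ring
        rw [covariance_congr_ae (by rfl : (E' i : Ω → ℝ) =ᵐ[P] (E' i : Ω → ℝ)) h1]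
        have h2 : p ∈ orthTo P hG (E' i).2 := by
          refine (isGaussianSpace_orthTo hG (E' i).2).affSpan_le
            (fun l => ⟨hU' l l.2, ?_⟩) hpmem
          have h3 : B ⟨U l, hU' l l.2⟩ (E' i) = 0 := by
            rw [map_sub, map_add, map_smul, hlinU l l.2, hιU l l.2, hsymm _ (Ξ i)]
            have : B (Ξ i) ⟨U l, hU' l l.2⟩ = 0 := hξU i l l.2
            rw [this]; simp
          rw [covariance_comm]; exact h3
        have h4 : B (E' i) ι = 0 := form_error_innovation B hsymm hBK hHE hΞE hr hq hv i
        have h5 := ((orthTo P hG (E' i).2).add_mem h2 ⟨ι.2, h4⟩).2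
        exact h5
  have hfilter : ∀ᵐ ω ∂P, ∀ i, predict P U (t + 1) θ' ω i =
      (A *ᵥ predict P U t θ ω) i + innov P U t ω * g i := by
    rw [ae_all_iff]
    intro i
    filter_upwards [hcomp i, predict_apply (U := U) (t := t + 1)
      (fun i => hG.integrable (hθ'G i)) i] with ω h1 h2
    rw [h2, h1]
  refine ⟨?_, hvar, ?_, ?_⟩
  · filter_upwards [hinnov] with ω h1
    rw [h1, hιω]
  · filter_upwards [hfilter] with ω h1
    ext i
    rw [h1 i]; simp
  · ext i j
    have hE'ae : ∀ i, (fun ω => θ' ω i - predict P U (t + 1) θ' ω i) =ᵐ[P] (E' i : Ω → ℝ) := by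
      intro i
      filter_upwards [hfilter, hθ', hinnov] with ω h1 h2 h3
      rw [h1 i, h2, h3, hE'ω, mulVec_sub]; simp only [Pi.add_apply, Pi.sub_apply]; ring
    rw [errCov_predict hG hUm hθ'G, covariance_congr_ae (hE'ae i) (hE'ae j)]
    exact form_error_error B hsymm hBK hHE hΞE hr hq hQ hv i j

end KalmanStep

/-! ### The filter for the noise -/

section MultivariateGaussian

variable {Ω : Type*} [MeasurableSpace Ω] {P : Measure Ω} {k : ℕ} {x : Ω → Fin k → ℝ}
  {m : Fin k → ℝ} {K : Matrix (Fin k) (Fin k) ℝ}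

lemma hasGaussianLaw_of_toLp
    (h : HasLaw (fun ω => WithLp.toLp 2 (x ω)) (multivariateGaussian (WithLp.toLp 2 m) K) P) :
    HasGaussianLaw x P :=
  h.hasGaussianLaw.map_equiv_fun (PiLp.continuousLinearEquiv 2 ℝ fun _ : Fin k => ℝ)

lemma integral_of_toLp
    (h : HasLaw (fun ω => WithLp.toLp 2 (x ω)) (multivariateGaussian (WithLp.toLp 2 m) K) P)
    (i : Fin k) : ∫ ω, x ω i ∂P = m i := by
  have h1 : ∫ y, y i ∂(multivariateGaussian (WithLp.toLp 2 m) K) = m i := by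
    have h2 := (EuclideanSpace.proj (𝕜 := ℝ) i).integral_comp_id_comm
      (μ := multivariateGaussian (WithLp.toLp 2 m) K) IsGaussian.integrable_id
    rw [integral_id_multivariateGaussian] at h2
    exact h2
  rw [← h1, ← h.integral_comp (f := fun y : EuclideanSpace ℝ (Fin k) => y i) (by fun_prop)]
  rfl

lemma covariance_of_toLp (hK : K.PosSemidef)
    (h : HasLaw (fun ω => WithLp.toLp 2 (x ω)) (multivariateGaussian (WithLp.toLp 2 m) K) P)
    (i j : Fin k) : cov[fun ω => x ω i, fun ω => x ω j; P] = K i j := by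
  rw [← covariance_eval_multivariateGaussian (μ := WithLp.toLp 2 m) hK i j,
    ← h.covariance_fun_comp (by fun_prop) (by fun_prop)]

end MultivariateGaussian

namespace NoiseModel

variable {ns nw n : ℕ} {Ω : Type*} {M : NoiseModel ns nw n} {S₁ : Ω → Fin ns → ℝ}
  {W : ℕ → Ω → Fin nw → ℝ}

/-- With `H` the variables uncorrelated with a given one, this yields orthogonality to the state. -/
lemma state_mem_of {H : Submodule ℝ (Ω → ℝ)} (hS : ∀ i, (fun ω => S₁ ω i) ∈ H) {t : ℕ}
    (hW : ∀ s < t, ∀ i, (fun ω => W s ω i) ∈ H) (i : Fin ns) :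
    (fun ω => M.state S₁ W t ω i) ∈ H := by
  induction t generalizing i with
  | zero => exact hS i
  | succ t ih =>
    exact H.add_mem (mulVec_mem (ih fun s hs => hW s (by omega)) (M.A t) i)
      (mulVec_mem (hW t (by omega)) (M.B t) i)

lemma noise_mem_of {H : Submodule ℝ (Ω → ℝ)} (hS : ∀ i, (fun ω => S₁ ω i) ∈ H) {t : ℕ}
    (hW : ∀ s ≤ t, ∀ i, (fun ω => W s ω i) ∈ H) : M.noise S₁ W t ∈ H :=
  H.add_mem (dotProduct_mem (state_mem_of hS fun s hs => hW s hs.le) (M.C t))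
    (dotProduct_mem (hW t le_rfl) (M.N t))

namespace IsDrivenBy

variable [MeasurableSpace Ω] {P : Measure Ω}

lemma measurable_state (h : M.IsDrivenBy P S₁ W) {t : ℕ} (ht : t ≤ n) :
    Measurable (M.state S₁ W t) := by
  induction t with
  | zero => exact h.meas_S
  | succ t ih =>
    have h1 := ih (by omega)
    have h2 := h.meas_W t (by omega)
    have hA : Measurable fun v : Fin ns → ℝ => M.A t *ᵥ v := by fun_prop
    have hB : Measurable fun v : Fin nw → ℝ => M.B t *ᵥ v := by fun_prop
    exact (hA.comp h1).add (hB.comp h2)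

lemma measurable_noise (h : M.IsDrivenBy P S₁ W) : ∀ t < n, Measurable (M.noise S₁ W t) := by
  intro t ht
  have h1 := h.measurable_state ht.le
  have h2 := h.meas_W t ht
  have hC : Measurable fun v : Fin ns → ℝ => M.C t ⬝ᵥ v := by unfold dotProduct; fun_prop
  have hN : Measurable fun v : Fin nw → ℝ => M.N t ⬝ᵥ v := by unfold dotProduct; fun_prop
  exact (hC.comp h1).add (hN.comp h2)

/-- The initial state and the driving noise are jointly Gaussian. -/
lemma exists_gaussianSpace (h : M.IsDrivenBy P S₁ W) : ∃ G, IsGaussianSpace P G ∧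
    (∀ i, (fun ω => S₁ ω i) ∈ G) ∧ ∀ t < n, ∀ i, (fun ω => W t ω i) ∈ G := by
  have hS := hasGaussianLaw_of_toLp h.law_S
  have hW : HasGaussianLaw (block W n) P :=
    iIndepFun.hasGaussianLaw (X := fun t : Fin n => W t)
      (fun t => hasGaussianLaw_of_toLp (m := 0) (h.law_W t t.2)) h.indep_W
  have hSW := h.indep_SW.hasGaussianLaw hS hW
  have hmem := memVec_gaussSpan (P := P) fun ω => (S₁ ω, block W n ω)
  refine ⟨_, isGaussianSpace_gaussSpan hSW, fun i => hmem.fst.eval i, fun t ht i => ?_⟩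
  exact hmem.snd ((ContinuousLinearMap.proj i : (Fin nw → ℝ) →L[ℝ] ℝ) ∘L
    (ContinuousLinearMap.proj (⟨t, ht⟩ : Fin n) : (Fin n → Fin nw → ℝ) →L[ℝ] (Fin nw → ℝ)))

end IsDrivenBy

end NoiseModel

namespace NoiseModel.IsDrivenBy

variable {ns nw n : ℕ} {Ω : Type*} {M : NoiseModel ns nw n} {S₁ : Ω → Fin ns → ℝ}
  {W : ℕ → Ω → Fin nw → ℝ} [MeasurableSpace Ω] {P : Measure Ω}

variable (h : M.IsDrivenBy P S₁ W) {G : Submodule ℝ (Ω → ℝ)} (hG : IsGaussianSpace P G)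
  (hS : ∀ i, (fun ω => S₁ ω i) ∈ G) (hW : ∀ t < n, ∀ i, (fun ω => W t ω i) ∈ G)

include h hG hS hW

/-- The driving noise `W_t` is uncorrelated with the initial state and with `W_s`, `s < t`. -/
lemma mem_orthTo {t : ℕ} (ht : t < n) (i : Fin nw) :
    (∀ j, (fun ω => S₁ ω j) ∈ orthTo P hG (hW t ht i)) ∧
    ∀ s < t, ∀ j, (fun ω => W s ω j) ∈ orthTo P hG (hW t ht i) := by
  have := hG.isProbabilityMeasure
  refine ⟨fun j => ⟨hS j, ?_⟩, fun s hs j => ⟨hW s (hs.trans ht) j, ?_⟩⟩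
  · have h1 : IndepFun (fun ω => W t ω i) (fun ω => S₁ ω j) P :=
      h.indep_SW.symm.comp (φ := fun w : Fin n → Fin nw → ℝ => w ⟨t, ht⟩ i)
        (ψ := fun s : Fin ns → ℝ => s j) (by fun_prop) (by fun_prop)
    exact h1.covariance_eq_zero (hG.memLp (hW t ht i)) (hG.memLp (hS j))
  · have h1 : IndepFun (fun ω => W t ω i) (fun ω => W s ω j) P :=
      (h.indep_W.indepFun (i := ⟨t, ht⟩) (j := ⟨s, hs.trans ht⟩) (by simp; omega)).comp
        (φ := fun w : Fin nw → ℝ => w i) (ψ := fun w : Fin nw → ℝ => w j)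
        (by fun_prop) (by fun_prop)
    exact h1.covariance_eq_zero (hG.memLp (hW t ht i)) (hG.memLp (hW s (hs.trans ht) j))

/-- One step of the filter for the noise. -/
lemma noise_filter_step {t : ℕ} (ht : t < n)
    (hK : errCov P (M.state S₁ W t) (M.est P S₁ W t) = M.Sig t) :
    0 < M.KIhat t ∧
    innov P (M.noise S₁ W) t =ᵐ[P] (fun ω =>
      M.C t ⬝ᵥ (M.state S₁ W t ω - M.est P S₁ W t ω) + M.N t ⬝ᵥ W t ω) ∧
    Var[innov P (M.noise S₁ W) t; P] = M.KIhat t ∧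
    M.est P S₁ W (t + 1) =ᵐ[P] (fun ω =>
      M.A t *ᵥ M.est P S₁ W t ω + innov P (M.noise S₁ W) t ω • M.gainM t) ∧
    errCov P (M.state S₁ W (t + 1)) (M.est P S₁ W (t + 1)) = M.Sig (t + 1) := by
  have hstate : ∀ i, (fun ω => M.state S₁ W t ω i) ∈ G :=
    state_mem_of hS fun s hs => hW s (by omega)
  have hnm : ∀ j < t + 1, Measurable (M.noise S₁ W j) := fun j hj =>
    h.measurable_noise j (by omega)
  have hn : ∀ j < t + 1, M.noise S₁ W j ∈ G := fun j hj =>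
    noise_mem_of hS fun s hs => hW s (by omega)
  have hpsd : (M.Sig t).PosSemidef := hK ▸ errCov_posSemidef hG
    (fun j hj => hnm j (by omega)) (fun j hj => hn j (by omega)) hstate
  have hpos : 0 < M.KIhat t := by
    have h1 := hpsd.dotProduct_mulVec_nonneg (M.C t)
    have h2 := M.R_pos t ht
    rw [star_trivial] at h1
    exact add_pos_of_nonneg_of_pos h1 h2
  have hW0 : ∀ i, ∫ ω, W t ω i ∂P = 0 := fun i =>
    integral_of_toLp (m := 0) (h.law_W t ht) i
  have hWW : (Matrix.of fun i j => cov[fun ω => W t ω i, fun ω => W t ω j; P]) = M.KW t := by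
    ext i j
    exact covariance_of_toLp (m := 0) (M.KW_psd t ht) (h.law_W t ht) i j
  have hdot0 : ∀ a : Fin nw → ℝ, ∫ ω, a ⬝ᵥ W t ω ∂P = 0 := fun a => by
    simp only [dotProduct]
    rw [integral_finsetSum _ fun i _ => (hG.integrable (hW t ht i)).const_mul _]
    simp [integral_const_mul, hW0]
  have horth : ∀ a : Fin nw → ℝ, (∀ i, cov[fun ω => a ⬝ᵥ W t ω,
        fun ω => M.state S₁ W t ω i; P] = 0) ∧
      ∀ j < t, cov[fun ω => a ⬝ᵥ W t ω, M.noise S₁ W j; P] = 0 := fun a => by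
    have h0 : ∀ f, (∀ i, f ∈ orthTo P hG (hW t ht i)) → f ∈ G →
        cov[fun ω => a ⬝ᵥ W t ω, f; P] = 0 := fun f hf hfG => by
      have h1 := dotProduct_mem (G := orthTo P hG hfG) (f := W t)
        (fun i => ⟨hW t ht i, by rw [covariance_comm]; exact (hf i).2⟩) a
      rw [covariance_comm]; exact h1.2
    refine ⟨fun i => h0 _ (fun k => ?_) (hstate i), fun j hj => h0 _ (fun k => ?_)
      (hn j (by omega))⟩
    · have h1 := h.mem_orthTo hG hS hW ht k
      exact state_mem_of h1.1 h1.2 i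
    · have h1 := h.mem_orthTo hG hS hW ht k
      exact noise_mem_of h1.1 fun s hs => h1.2 s (by omega)
  have hcov : ∀ a b : Fin nw → ℝ, cov[fun ω => a ⬝ᵥ W t ω, fun ω => b ⬝ᵥ W t ω; P] =
      a ⬝ᵥ M.KW t *ᵥ b := fun a b => by
    rw [covariance_mulVec hG (hW t ht) (hW t ht), hWW]
  obtain ⟨h1, h2, h3, h4⟩ := kalman_step hG hnm hn (t := t) (θ := M.state S₁ W t)
    (θ' := M.state S₁ W (t + 1)) (ξ := fun ω => M.B t *ᵥ W t ω)
    (η := fun ω => M.N t ⬝ᵥ W t ω) (R := fun _ => 0) (A := M.A t) (K := M.Sig t)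
    (Q := M.B t * M.KW t * (M.B t)ᵀ) (h := M.C t) (q := M.B t *ᵥ (M.KW t *ᵥ M.N t))
    (r := M.N t ⬝ᵥ M.KW t *ᵥ M.N t)
    hstate (mulVec_mem (hW t ht) (M.B t)) (dotProduct_mem (hW t ht) (M.N t))
    (const_mem_affSpan _ 0) (by filter_upwards with ω; simp [noise])
    (by filter_upwards with ω; rfl) (hdot0 _) (fun i => hdot0 _) (horth _).1 (horth _).2
    (fun i => (horth _).1) (fun i => (horth _).2) hK (hcov _ _)
    (fun i => hcov _ _) (fun i j => by
      rw [Matrix.mul_assoc]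
      exact hcov (M.B t i) (M.B t j)) hpos.ne'
  refine ⟨hpos, h1, h2, h3, h4⟩

omit hW in
lemma est_zero : M.est P S₁ W 0 = fun _ => M.mu := by
  have := hG.isProbabilityMeasure
  rw [est, predict_zero]
  ext ω i
  change (∫ ω, S₁ ω ∂P) i = M.mu i
  rw [eval_integral fun i => hG.integrable (hS i)]
  exact integral_of_toLp h.law_S i

/-- The covariance of the error of the filter for the noise solves the first Riccati equation. -/
lemma errCov_est {t : ℕ} (ht : t ≤ n) :
    errCov P (M.state S₁ W t) (M.est P S₁ W t) = M.Sig t := by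
  induction t with
  | zero =>
    ext i j
    rw [h.est_zero hG hS]
    simp only [errCov, Matrix.of_apply]
    have h1 := covariance_of_toLp M.K₁_psd h.law_S i j
    rw [covariance, integral_of_toLp h.law_S, integral_of_toLp h.law_S] at h1
    exact h1
  | succ t ih => exact (h.noise_filter_step hG hS hW (by omega) (ih (by omega))).2.2.2.2

end NoiseModel.IsDrivenBy

namespace NoiseModel.IsDrivenBy

variable {ns nw n : ℕ} {Ω : Type*} {M : NoiseModel ns nw n} {S₁ : Ω → Fin ns → ℝ}
  {W : ℕ → Ω → Fin nw → ℝ} [MeasurableSpace Ω] {P : Measure Ω}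

lemma est_mem (h : M.IsDrivenBy P S₁ W) {t : ℕ} (ht : t ≤ n) (i : Fin ns) :
    (fun ω => M.est P S₁ W t ω i) ∈ affSpan P (block (M.noise S₁ W) t) := by
  obtain ⟨G, hG, hS, hW⟩ := h.exists_gaussianSpace
  exact predict_apply_mem hG (fun j hj => h.measurable_noise j (by omega))
    (fun j hj => noise_mem_of hS fun s hs => hW s (by omega))
    (state_mem_of hS fun s hs => hW s (by omega)) i

lemma measurable_est (h : M.IsDrivenBy P S₁ W) {t : ℕ} (ht : t ≤ n) :
    Measurable (M.est P S₁ W t) :=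
  (stronglyMeasurable_predict (fun j hj => h.measurable_noise j (by omega)) _).measurable

lemma variance_innov_noise (h : M.IsDrivenBy P S₁ W) {t : ℕ} (ht : t < n) :
    Var[innov P (M.noise S₁ W) t; P] = M.KIhat t := by
  obtain ⟨G, hG, hS, hW⟩ := h.exists_gaussianSpace
  exact (h.noise_filter_step hG hS hW ht (h.errCov_est hG hS hW ht.le)).2.2.1

lemma KIhat_pos (h : M.IsDrivenBy P S₁ W) {t : ℕ} (ht : t < n) : 0 < M.KIhat t := by
  obtain ⟨G, hG, hS, hW⟩ := h.exists_gaussianSpace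
  exact (h.noise_filter_step hG hS hW ht (h.errCov_est hG hS hW ht.le)).1

lemma noiseFilterClaims [IsProbabilityMeasure P] (h : M.IsDrivenBy P S₁ W) :
    M.NoiseFilterClaims P S₁ W := by
  obtain ⟨G, hG, hS, hW⟩ := h.exists_gaussianSpace
  have herr : ∀ t ≤ n, errCov P (M.state S₁ W t) (M.est P S₁ W t) = M.Sig t :=
    fun t ht => h.errCov_est hG hS hW ht
  have hstep := fun t (ht : t < n) => h.noise_filter_step hG hS hW ht (herr t ht.le)
  have hm := h.measurable_noise
  have hmem : ∀ t < n, M.noise S₁ W t ∈ G := fun t ht =>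
    noise_mem_of hS fun s hs => hW s (by omega)
  have hstate : ∀ t ≤ n, ∀ i, (fun ω => M.state S₁ W t ω i) ∈ G := fun t ht =>
    state_mem_of hS fun s hs => hW s (by omega)
  have hent := diffEntropy_block hG hm hmem fun t ht => by
    rw [(hstep t ht).2.2.1]; exact (hstep t ht).1
  exact
  { est_init := by rw [h.est_zero hG hS]
    est_step := fun t ht => (hstep t ht).2.2.2.1
    innov_eq := fun t ht => by
      filter_upwards [(hstep t ht).2.1] with ω h1
      rw [h1, noise, dotProduct_sub]; ring
    innov_eq_err := fun t ht => (hstep t ht).2.1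
    KIhat_pos := fun t ht => (hstep t ht).1
    innov_law := fun t ht => by
      rw [← (hstep t ht).2.2.1]; exact hasLaw_innov hG hm hmem ht
    innov_indep := iIndepFun_innov hG hm hmem
    innov_indep_past := fun t ht => indepFun_innov_block hG hm hmem ht
    noise_condVar := fun t ht => by
      rw [← (hstep t ht).2.2.1]; exact predict_innov_sq hG hm hmem ht
    errCov_eq := herr
    condCov_eq := fun t ht i j => by
      rw [← herr t ht]
      exact predict_error_mul_error hG (fun j hj => hm j (by omega))
        (fun j hj => hmem j (by omega)) (hstate t ht) i j
    Sig_psd := fun t ht => by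
      rw [← herr t ht]
      exact errCov_posSemidef hG (fun j hj => hm j (by omega))
        (fun j hj => hmem j (by omega)) (hstate t ht)
    entropy_exists := hent.1
    entropy_eq := by
      rw [hent.2]
      congr 1
      exact Finset.sum_congr rfl fun t ht => by
        rw [(hstep t (Finset.mem_range.1 ht)).2.2.1] }

/-- The determinant of the noise covariance. -/
lemma det_noiseCov (h : M.IsDrivenBy P S₁ W) :
    (M.noiseCov P S₁ W).det = ∏ t ∈ Finset.range n, M.KIhat t := by
  obtain ⟨G, hG, hS, hW⟩ := h.exists_gaussianSpace
  rw [noiseCov, det_covariance_eq_prod_var_innov hG h.measurable_noise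
    fun t ht => noise_mem_of hS fun s hs => hW s (by omega), ← Fin.prod_univ_eq_prod_range]
  exact Finset.prod_congr rfl fun t _ => h.variance_innov_noise t.2

end NoiseModel.IsDrivenBy

/-! ### The filter for the channel output -/

namespace NoiseModel

variable {ns nw n : ℕ} {Ω : Type*} {M : NoiseModel ns nw n} {S₁ : Ω → Fin ns → ℝ}
  {W : ℕ → Ω → Fin nw → ℝ} [MeasurableSpace Ω] {P : Measure Ω}

/-- The input is `X_t = Λ_t Ŝ_t + R_t + ζ_t` within a Gaussian space `G`, where `R_t` depends on
the past of the output, and `ζ_t` is centred, of variance `KZ_t`, and uncorrelated with the past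
of the output, with `Ŝ_t` and with the innovation of the noise; that innovation is uncorrelated
with the past of the output.  Every Gaussian input that is
causal in the noise has such a form, by linear regression. -/
structure IsFilterInput (M : NoiseModel ns nw n) (P : Measure Ω) (S₁ : Ω → Fin ns → ℝ)
    (W : ℕ → Ω → Fin nw → ℝ) (G : Submodule ℝ (Ω → ℝ)) (L : ℕ → Fin ns → ℝ) (KZ : ℕ → ℝ≥0)
    (R ζ X : ℕ → Ω → ℝ) : Prop where
  meas_X : ∀ t < n, Measurable (X t)
  gauss : IsGaussianSpace P G
  noise_mem : ∀ t < n, M.noise S₁ W t ∈ G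
  mem_X : ∀ t < n, X t ∈ G
  mem_ζ : ∀ t < n, ζ t ∈ G
  mem_R : ∀ t < n, R t ∈ affSpan P (block (M.output S₁ W X) t)
  repr : ∀ t < n, X t =ᵐ[P] fun ω => L t ⬝ᵥ M.est P S₁ W t ω + R t ω + ζ t ω
  integral_ζ : ∀ t < n, ∫ ω, ζ t ω ∂P = 0
  cov_ζ : ∀ t < n, cov[ζ t, ζ t; P] = KZ t
  cov_output : ∀ t < n, ∀ j < t, cov[ζ t, M.output S₁ W X j; P] = 0
  cov_est : ∀ t < n, ∀ i, cov[ζ t, fun ω => M.est P S₁ W t ω i; P] = 0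
  cov_noise_innov : ∀ t < n, cov[ζ t, innov P (M.noise S₁ W) t; P] = 0
  innov_output : ∀ t < n, ∀ j < t, cov[innov P (M.noise S₁ W) t, M.output S₁ W X j; P] = 0

namespace IsFilterInput

variable {G : Submodule ℝ (Ω → ℝ)} {L : ℕ → Fin ns → ℝ} {KZ : ℕ → ℝ≥0} {R ζ X : ℕ → Ω → ℝ}

lemma measurable_output (hX : M.IsFilterInput P S₁ W G L KZ R ζ X) (h : M.IsDrivenBy P S₁ W) :
    ∀ t < n, Measurable (M.output S₁ W X t) :=
  fun t ht => (hX.meas_X t ht).add (h.measurable_noise t ht)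

lemma output_mem (hX : M.IsFilterInput P S₁ W G L KZ R ζ X) :
    ∀ t < n, M.output S₁ W X t ∈ G :=
  fun t ht => G.add_mem (hX.mem_X t ht) (hX.noise_mem t ht)

lemma est_mem (hX : M.IsFilterInput P S₁ W G L KZ R ζ X) (h : M.IsDrivenBy P S₁ W) {t : ℕ}
    (ht : t ≤ n) (i : Fin ns) : (fun ω => M.est P S₁ W t ω i) ∈ G :=
  affSpan_block_le hX.gauss (fun j hj => hX.noise_mem j (by omega)) (h.est_mem ht i)

lemma estEst_mem (hX : M.IsFilterInput P S₁ W G L KZ R ζ X) (h : M.IsDrivenBy P S₁ W) {t : ℕ}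
    (ht : t ≤ n) (i : Fin ns) :
    (fun ω => M.estEst P S₁ W X t ω i) ∈ affSpan P (block (M.output S₁ W X) t) :=
  predict_apply_mem hX.gauss (fun j hj => hX.measurable_output h j (by omega))
    (fun j hj => hX.output_mem j (by omega)) (hX.est_mem h ht) i

/-- One step of the filter for the channel output. -/
lemma output_filter_step (hX : M.IsFilterInput P S₁ W G L KZ R ζ X) (h : M.IsDrivenBy P S₁ W)
    {t : ℕ} (ht : t < n) (hK : errCov P (M.est P S₁ W t) (M.estEst P S₁ W X t) = M.KFb L KZ t) :
    0 < M.KI L KZ t ∧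
    innov P (M.output S₁ W X) t =ᵐ[P] (fun ω =>
      (L t + M.C t) ⬝ᵥ (M.est P S₁ W t ω - M.estEst P S₁ W X t ω)
        + (innov P (M.noise S₁ W) t ω + ζ t ω)) ∧
    Var[innov P (M.output S₁ W X) t; P] = M.KI L KZ t ∧
    M.estEst P S₁ W X (t + 1) =ᵐ[P] (fun ω =>
      M.A t *ᵥ M.estEst P S₁ W X t ω + innov P (M.output S₁ W X) t ω • M.gainF L KZ t) ∧
    errCov P (M.est P S₁ W (t + 1)) (M.estEst P S₁ W X (t + 1)) = M.KFb L KZ (t + 1) := by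
  have hG := hX.gauss
  have := hG.isProbabilityMeasure
  have hF := h.noiseFilterClaims
  set V := M.noise S₁ W with hV
  set Y := M.output S₁ W X with hY
  have hYm : ∀ j < t + 1, Measurable (Y j) := fun j hj => hX.measurable_output h j (by omega)
  have hYG : ∀ j < t + 1, Y j ∈ G := fun j hj => hX.output_mem j (by omega)
  have hest := hX.est_mem h ht.le
  have hIG : innov P V t ∈ G := innov_mem hG h.measurable_noise hX.noise_mem ht
  have hI0 : ∫ ω, innov P V t ω ∂P = 0 := integral_innov hG h.measurable_noise hX.noise_mem ht
  have hII : cov[innov P V t, innov P V t; P] = M.KIhat t := by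
    rw [covariance_self (hG.gauss _ hIG).aemeasurable, h.variance_innov_noise ht]
  have hIest : ∀ i, cov[innov P V t, fun ω => M.est P S₁ W t ω i; P] = 0 := fun i =>
    cov_innov hG h.measurable_noise hX.noise_mem ht (h.est_mem ht.le i)
  have hpsd : (M.KFb L KZ t).PosSemidef := hK ▸ errCov_posSemidef hG
    (fun j hj => hYm j (by omega)) (fun j hj => hYG j (by omega)) hest
  have hpos : 0 < M.KI L KZ t := by
    have h1 := hpsd.dotProduct_mulVec_nonneg (L t + M.C t)
    rw [star_trivial] at h1
    have h2 := h.KIhat_pos ht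
    have h3 : (0 : ℝ) ≤ KZ t := (KZ t).2
    unfold KI outVarOf
    positivity
  have hscale : ∀ i, (fun ω => (innov P V t ω • M.gainM t) i) = M.gainM t i • innov P V t :=
    fun i => by ext ω; simp [mul_comm]
  have hζI : cov[innov P V t, ζ t; P] = 0 := by rw [covariance_comm]; exact hX.cov_noise_innov t ht
  have hη : innov P V t + ζ t ∈ G := G.add_mem hIG (hX.mem_ζ t ht)
  have hcovη : ∀ f ∈ G, cov[innov P V t, f; P] = 0 → cov[ζ t, f; P] = 0 →
      cov[innov P V t + ζ t, f; P] = 0 := fun f hf h1 h2 => by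
    rw [covariance_add_left (hG.memLp hIG) (hG.memLp (hX.mem_ζ t ht)) (hG.memLp hf), h1, h2,
      add_zero]
  have hIη : cov[innov P V t, innov P V t + ζ t; P] = M.KIhat t := by
    rw [covariance_add_right (hG.memLp hIG) (hG.memLp hIG) (hG.memLp (hX.mem_ζ t ht)), hII,
      hζI, add_zero]
  have hr : cov[innov P V t + ζ t, innov P V t + ζ t; P] = M.KIhat t + KZ t := by
    rw [covariance_add_left (hG.memLp hIG) (hG.memLp (hX.mem_ζ t ht)) (hG.memLp hη), hIη,
      covariance_add_right (hG.memLp (hX.mem_ζ t ht)) (hG.memLp hIG)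
        (hG.memLp (hX.mem_ζ t ht)), hX.cov_noise_innov t ht, hX.cov_ζ t ht, zero_add]
  have hkey : (L t + M.C t) ⬝ᵥ M.KFb L KZ t *ᵥ (L t + M.C t) + (M.KIhat t + KZ t) =
      M.KI L KZ t := by rw [KI, outVarOf]; ring
  obtain ⟨h1, h2, h3, h4⟩ := kalman_step hG hYm hYG (t := t) (θ := M.est P S₁ W t)
    (θ' := M.est P S₁ W (t + 1)) (ξ := fun ω => innov P V t ω • M.gainM t)
    (η := innov P V t + ζ t) (R := R t) (A := M.A t) (K := M.KFb L KZ t)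
    (Q := M.KIhat t • vecMulVec (M.gainM t) (M.gainM t)) (h := L t + M.C t)
    (q := M.KIhat t • M.gainM t) (r := M.KIhat t + KZ t)
    hest (fun i => by rw [hscale]; exact G.smul_mem _ hIG) hη (hX.mem_R t ht)
    (by
      filter_upwards [hX.repr t ht, hF.innov_eq t ht] with ω h1 h2
      rw [hY, output, h1, Pi.add_apply, hV, h2, add_dotProduct]; ring)
    (hF.est_step t ht)
    (by
      simp only [Pi.add_apply]
      rw [integral_add (hG.integrable hIG) (hG.integrable (hX.mem_ζ t ht)), hI0,
        hX.integral_ζ t ht, add_zero])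
    (fun i => by
      have : ∀ ω, (innov P V t ω • M.gainM t) i = innov P V t ω * M.gainM t i := fun ω => rfl
      simp only [this]
      rw [integral_mul_const, hI0, zero_mul])
    (fun i => hcovη _ (hest i) (hIest i) (hX.cov_est t ht i))
    (fun j hj => hcovη _ (hYG j (by omega)) (hX.innov_output t ht j hj)
      (hX.cov_output t ht j hj))
    (fun i i' => by rw [hscale, covariance_smul_left, hIest, mul_zero])
    (fun i j hj => by rw [hscale, covariance_smul_left, hX.innov_output t ht j hj, mul_zero])
    hK hr (fun i => by
      rw [hscale, covariance_smul_left, hIη, Pi.smul_apply, smul_eq_mul, mul_comm])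
    (fun i j => by
      rw [hscale, hscale, covariance_smul_left, covariance_smul_right, hII, Matrix.smul_apply,
        vecMulVec_apply, smul_eq_mul]; ring) (by rw [hkey]; exact hpos.ne')
  rw [hkey] at h2 h3 h4
  exact ⟨hpos, h1, h2, h3, h4⟩

lemma estEst_zero (hX : M.IsFilterInput P S₁ W G L KZ R ζ X) (h : M.IsDrivenBy P S₁ W) :
    M.estEst P S₁ W X 0 = fun _ => M.mu := by
  have := hX.gauss.isProbabilityMeasure
  rw [estEst, predict_zero, integral_congr_ae h.noiseFilterClaims.est_init]
  simp

/-- The covariance of the error of the filter for the output solves the second Riccati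
equation. -/
lemma errCov_estEst (hX : M.IsFilterInput P S₁ W G L KZ R ζ X) (h : M.IsDrivenBy P S₁ W)
    {t : ℕ} (ht : t ≤ n) :
    errCov P (M.est P S₁ W t) (M.estEst P S₁ W X t) = M.KFb L KZ t := by
  have := hX.gauss.isProbabilityMeasure
  induction t with
  | zero =>
    ext i j
    rw [hX.estEst_zero h, errCov, Matrix.of_apply, KFb, Matrix.zero_apply]
    rw [integral_congr_ae (g := fun _ => (0 : ℝ)), integral_zero]
    filter_upwards [h.noiseFilterClaims.est_init] with ω hω
    rw [hω]; simp
  | succ t ih => exact (hX.output_filter_step h (by omega) (ih (by omega))).2.2.2.2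

lemma filter_step (hX : M.IsFilterInput P S₁ W G L KZ R ζ X) (h : M.IsDrivenBy P S₁ W)
    {t : ℕ} (ht : t < n) :
    0 < M.KI L KZ t ∧
    innov P (M.output S₁ W X) t =ᵐ[P] (fun ω =>
      (L t + M.C t) ⬝ᵥ (M.est P S₁ W t ω - M.estEst P S₁ W X t ω)
        + (innov P (M.noise S₁ W) t ω + ζ t ω)) ∧
    Var[innov P (M.output S₁ W X) t; P] = M.KI L KZ t ∧
    M.estEst P S₁ W X (t + 1) =ᵐ[P] (fun ω =>
      M.A t *ᵥ M.estEst P S₁ W X t ω + innov P (M.output S₁ W X) t ω • M.gainF L KZ t) := by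
  have h1 := hX.output_filter_step h ht (hX.errCov_estEst h ht.le)
  exact ⟨h1.1, h1.2.1, h1.2.2.1, h1.2.2.2.1⟩

lemma KFb_posSemidef (hX : M.IsFilterInput P S₁ W G L KZ R ζ X) (h : M.IsDrivenBy P S₁ W)
    {t : ℕ} (ht : t ≤ n) : (M.KFb L KZ t).PosSemidef := by
  rw [← hX.errCov_estEst h ht]
  exact errCov_posSemidef hX.gauss (fun j hj => hX.measurable_output h j (by omega))
    (fun j hj => hX.output_mem j (by omega)) (hX.est_mem h ht)

/-- The part of the input that is a function of the past of the output, when the rest is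
`Λ_t (Ŝ_t - E{Ŝ_t | Y^{t-1}}) + ζ_t`. -/
noncomputable def outputPart (M : NoiseModel ns nw n) (P : Measure Ω) (S₁ : Ω → Fin ns → ℝ)
    (W : ℕ → Ω → Fin nw → ℝ) (L : ℕ → Fin ns → ℝ) (R X : ℕ → Ω → ℝ) (t : ℕ) : Ω → ℝ :=
  fun ω => R t ω + L t ⬝ᵥ M.estEst P S₁ W X t ω

lemma outputPart_mem (hX : M.IsFilterInput P S₁ W G L KZ R ζ X) (h : M.IsDrivenBy P S₁ W)
    {t : ℕ} (ht : t < n) :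
    outputPart M P S₁ W L R X t ∈ affSpan P (block (M.output S₁ W X) t) :=
  add_mem (hX.mem_R t ht) (dotProduct_mem (hX.estEst_mem h ht.le) (L t))

lemma repr_outputPart (hX : M.IsFilterInput P S₁ W G L KZ R ζ X) {t : ℕ} (ht : t < n) :
    X t =ᵐ[P] fun ω => (L t ⬝ᵥ (M.est P S₁ W t ω - M.estEst P S₁ W X t ω) + ζ t ω)
      + outputPart M P S₁ W L R X t ω := by
  filter_upwards [hX.repr t ht] with ω h1
  rw [h1, outputPart, dotProduct_sub]; ring

/-- The part of the input that depends on the past of the output only costs power. -/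
lemma integral_sq_input (hX : M.IsFilterInput P S₁ W G L KZ R ζ X) (h : M.IsDrivenBy P S₁ W)
    {t : ℕ} (ht : t < n) :
    Var[X t; P] = L t ⬝ᵥ M.KFb L KZ t *ᵥ L t + KZ t + Var[outputPart M P S₁ W L R X t; P] ∧
    ∫ ω, X t ω ^ 2 ∂P =
      L t ⬝ᵥ M.KFb L KZ t *ᵥ L t + KZ t + ∫ ω, outputPart M P S₁ W L R X t ω ^ 2 ∂P := by
  have hG := hX.gauss
  have := hG.isProbabilityMeasure
  have hYm : ∀ j < t, Measurable (M.output S₁ W X j) :=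
    fun j hj => hX.measurable_output h j (by omega)
  have hYG : ∀ j < t, M.output S₁ W X j ∈ G := fun j hj => hX.output_mem j (by omega)
  have hest := hX.est_mem h ht.le
  have hee : ∀ i, (fun ω => M.estEst P S₁ W X t ω i) ∈ affSpan P (block (M.output S₁ W X) t) :=
    hX.estEst_mem h ht.le
  have heeG : ∀ i, (fun ω => M.estEst P S₁ W X t ω i) ∈ G := fun i =>
    affSpan_block_le hG hYG (hee i)
  set ρ := outputPart M P S₁ W L R X t with hρ
  have hρm : ρ ∈ affSpan P (block (M.output S₁ W X) t) := hX.outputPart_mem h ht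
  have hρG : ρ ∈ G := affSpan_block_le hG hYG hρm
  set e : Ω → ℝ := fun ω => L t ⬝ᵥ (M.est P S₁ W t ω - M.estEst P S₁ W X t ω) with he
  have heρ : e ∈ orthTo P hG hρG := dotProduct_mem (G := orthTo P hG hρG)
    (f := fun ω => M.est P S₁ W t ω -
      M.estEst P S₁ W X t ω) (fun i => ⟨G.sub_mem (hest i) (heeG i), by
        rw [covariance_comm]; exact cov_sub_predict_apply hG hYm hYG hest i hρm⟩) (L t)
  have heG : e ∈ G := heρ.1
  have hζG := hX.mem_ζ t ht
  have hζY : ∀ f ∈ affSpan P (block (M.output S₁ W X) t), f ∈ orthTo P hG hζG :=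
    (isGaussianSpace_orthTo hG hζG).affSpan_le fun j =>
      ⟨hYG j j.2, hX.cov_output t ht j j.2⟩
  have hζe : e ∈ orthTo P hG hζG := dotProduct_mem (G := orthTo P hG hζG)
    (f := fun ω => M.est P S₁ W t ω -
      M.estEst P S₁ W X t ω) (fun i => (orthTo P hG hζG).sub_mem
        (show _ ∈ orthTo P hG hζG from ⟨hest i, hX.cov_est t ht i⟩) (hζY _ (hee i))) (L t)
  have hee' : cov[e, e; P] = L t ⬝ᵥ M.KFb L KZ t *ᵥ L t := by
    rw [← hX.errCov_estEst h ht.le]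
    exact cov_dotProduct_error hG hYm hYG hest (L t) (L t)
  have heζ : e + ζ t ∈ G := G.add_mem heG hζG
  have hXeq : X t =ᵐ[P] (e + ζ t) + ρ := hX.repr_outputPart ht
  have hvar : Var[X t; P] = L t ⬝ᵥ M.KFb L KZ t *ᵥ L t + KZ t + Var[ρ; P] := by
    rw [variance_congr hXeq, variance_add (hG.memLp heζ) (hG.memLp hρG),
      variance_add (hG.memLp heG) (hG.memLp hζG),
      covariance_add_left (hG.memLp heG) (hG.memLp hζG) (hG.memLp hρG), (hζY _ hρm).2,
      covariance_comm e ρ, heρ.2, covariance_comm e, hζe.2,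
      ← covariance_self (hG.gauss _ heG).aemeasurable, hee',
      ← covariance_self (hG.gauss _ hζG).aemeasurable, hX.cov_ζ t ht]
    ring
  refine ⟨hvar, ?_⟩
  have he0 : ∫ ω, e ω ∂P = 0 := by
    simp only [he, dotProduct]
    have hi : ∀ i, Integrable (fun ω => (M.est P S₁ W t ω - M.estEst P S₁ W X t ω) i) P :=
      fun i => hG.integrable (G.sub_mem (hest i) (heeG i))
    rw [integral_finsetSum _ fun i _ => (hi i).const_mul _]
    refine Finset.sum_eq_zero fun i _ => ?_
    have h0 := integral_sub_predict_apply hG hYm hest i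
    rw [integral_const_mul]
    exact mul_eq_zero_of_right _ h0
  have hmean : ∫ ω, X t ω ∂P = ∫ ω, ρ ω ∂P := by
    rw [integral_congr_ae hXeq]
    rw [integral_add' (hG.integrable heζ) (hG.integrable hρG),
      integral_add' (hG.integrable heG) (hG.integrable hζG), he0, hX.integral_ζ t ht]
    simp
  have h1 := variance_eq_sub (hG.memLp (hX.mem_X t ht))
  have h2 := variance_eq_sub (hG.memLp hρG)
  simp only [Pi.pow_apply] at h1 h2
  rw [hmean] at h1
  linarith

/-- The average power splits into that of the sufficient statistic and that of the function of the
past of the output. -/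
lemma avgPower_eq (hX : M.IsFilterInput P S₁ W G L KZ R ζ X) (h : M.IsDrivenBy P S₁ W) :
    avgPower P n X = (n : ℝ)⁻¹ * ∑ t ∈ Finset.range n, (L t ⬝ᵥ M.KFb L KZ t *ᵥ L t + KZ t)
      + (n : ℝ)⁻¹ * ∑ t ∈ Finset.range n, ∫ ω, outputPart M P S₁ W L R X t ω ^ 2 ∂P := by
  rw [avgPower, integral_finsetSum _ fun t ht =>
    (hX.gauss.memLp (hX.mem_X t (Finset.mem_range.1 ht))).integrable_sq, ← mul_add,
    ← Finset.sum_add_distrib]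
  congr 1
  exact Finset.sum_congr rfl fun t ht => (hX.integral_sq_input h (Finset.mem_range.1 ht)).2

/-- The rate through the variances of the innovations. -/
lemma sum_log_variance (hX : M.IsFilterInput P S₁ W G L KZ R ζ X) (h : M.IsDrivenBy P S₁ W) :
    ∑ t ∈ Finset.range n, Real.log (Var[innov P (M.output S₁ W X) t; P] /
      Var[innov P (M.noise S₁ W) t; P]) =
    ∑ t ∈ Finset.range n, Real.log (M.KI L KZ t / M.KIhat t) :=
  Finset.sum_congr rfl fun t ht => by
    rw [(hX.filter_step h (Finset.mem_range.1 ht)).2.2.1,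
      h.variance_innov_noise (Finset.mem_range.1 ht)]

lemma inputRate_eq [IsProbabilityMeasure P] (hX : M.IsFilterInput P S₁ W G L KZ R ζ X)
    (h : M.IsDrivenBy P S₁ W) :
    M.inputRate P S₁ W X =
      1 / 2 * ∑ t ∈ Finset.range n, Real.log (M.KI L KZ t / M.KIhat t) := by
  rw [inputRate, h.noiseFilterClaims.entropy_eq, Finset.mul_sum, Finset.mul_sum,
    ← Finset.sum_sub_distrib]
  refine Finset.sum_congr rfl fun t ht => ?_
  have ht := Finset.mem_range.1 ht
  have h1 := hX.filter_step h ht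
  have h2 := h.KIhat_pos ht
  rw [(condDiffEntropy_eq hX.gauss (hX.measurable_output h) hX.output_mem ht
    (by rw [h1.2.2.1]; exact h1.1)).2, h1.2.2.1, Real.log_div h1.1.ne' h2.ne',
    Real.log_mul (by positivity) h1.1.ne', Real.log_mul (by positivity) h2.ne']
  ring

end IsFilterInput

end NoiseModel

/-! ### Inputs with independent noise -/

namespace NoiseModel

variable {ns nw n : ℕ} {Ω : Type*} {M : NoiseModel ns nw n} {S₁ : Ω → Fin ns → ℝ}
  {W : ℕ → Ω → Fin nw → ℝ} [MeasurableSpace Ω] {P : Measure Ω}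

/-- The input is `X_t = Λ_t Ŝ_t + R_t + Z_t`, where `R_t` is an affine function of the past of the
output and the `Z_t ∼ N(0, KZ_t)` are independent, and independent of the noise. -/
structure IsAffineInput (M : NoiseModel ns nw n) (P : Measure Ω) (S₁ : Ω → Fin ns → ℝ)
    (W : ℕ → Ω → Fin nw → ℝ) (L : ℕ → Fin ns → ℝ) (KZ : ℕ → ℝ≥0) (R Z X : ℕ → Ω → ℝ) :
    Prop where
  meas_X : ∀ t < n, Measurable (X t)
  meas_Z : ∀ t < n, Measurable (Z t)
  law_Z : ∀ t < n, HasLaw (Z t) (gaussianReal 0 (KZ t)) P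
  indep_Z : iIndepFun (fun (t : Fin n) => Z t) P
  indep_ZV : IndepFun (block Z n) (block (M.noise S₁ W) n) P
  mem_R : ∀ t < n, R t ∈ affSpan P (block (M.output S₁ W X) t)
  repr : ∀ t < n, X t =ᵐ[P] fun ω => L t ⬝ᵥ M.est P S₁ W t ω + R t ω + Z t ω

/-- The input at time `t` belongs to every Gaussian space that contains the noise before `t` and
the input noise up to `t`. -/
lemma input_mem_of (h : M.IsDrivenBy P S₁ W) {H : Submodule ℝ (Ω → ℝ)}
    (hH : IsGaussianSpace P H) {L : ℕ → Fin ns → ℝ} {R Z X : ℕ → Ω → ℝ}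
    (hR : ∀ t < n, R t ∈ affSpan P (block (M.output S₁ W X) t))
    (hrepr : ∀ t < n, X t =ᵐ[P] fun ω => L t ⬝ᵥ M.est P S₁ W t ω + R t ω + Z t ω) {t : ℕ}
    (ht : t < n) (hV : ∀ s < t, M.noise S₁ W s ∈ H) (hZ : ∀ s ≤ t, Z s ∈ H) : X t ∈ H := by
  induction t using Nat.strong_induction_on with
  | _ t ih =>
    have hX : ∀ s < t, X s ∈ H := fun s hs =>
      ih s hs (by omega) (fun r hr => hV r (by omega)) (fun r hr => hZ r (by omega))
    have hest : ∀ i, (fun ω => M.est P S₁ W t ω i) ∈ H := fun i =>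
      affSpan_block_le hH hV (h.est_mem ht.le i)
    have hRH : R t ∈ H := affSpan_block_le hH (fun s hs => H.add_mem (hX s hs) (hV s hs)) (hR t ht)
    exact hH.congr _ (H.add_mem (H.add_mem (dotProduct_mem hest (L t)) hRH) (hZ t le_rfl)) _
      (hrepr t ht).symm

namespace IsAffineInput

variable {L : ℕ → Fin ns → ℝ} {KZ : ℕ → ℝ≥0} {R Z X : ℕ → Ω → ℝ}

/-- The affine functions of the noise and of the input noise. -/
noncomputable def space (n : ℕ) (P : Measure Ω) (V Z : ℕ → Ω → ℝ) : Submodule ℝ (Ω → ℝ) :=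
  gaussSpan P fun ω => (block V n ω, block Z n ω)

lemma isGaussianSpace (hX : M.IsAffineInput P S₁ W L KZ R Z X) (h : M.IsDrivenBy P S₁ W) :
    IsGaussianSpace P (space n P (M.noise S₁ W) Z) := by
  obtain ⟨G, hG, hS, hW⟩ := h.exists_gaussianSpace
  have hV : HasGaussianLaw (block (M.noise S₁ W) n) P :=
    hG.hasGaussianLaw (measurable_block h.measurable_noise).aemeasurable
      (memVec_pi_real fun j => noise_mem_of hS fun s hs => hW s (by omega))
  have hZ : HasGaussianLaw (block Z n) P :=
    iIndepFun.hasGaussianLaw (X := fun t : Fin n => Z t)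
      (fun t => (hX.law_Z t t.2).hasGaussianLaw) hX.indep_Z
  exact isGaussianSpace_gaussSpan (hX.indep_ZV.symm.hasGaussianLaw hV hZ)

lemma noise_mem_space {V Z : ℕ → Ω → ℝ} {t : ℕ} (ht : t < n) : V t ∈ space n P V Z :=
  (memVec_gaussSpan (P := P) fun ω => (block V n ω, block Z n ω)).fst.eval ⟨t, ht⟩

lemma inputNoise_mem_space {V Z : ℕ → Ω → ℝ} {t : ℕ} (ht : t < n) : Z t ∈ space n P V Z :=
  (memVec_gaussSpan (P := P) fun ω => (block V n ω, block Z n ω)).snd.eval ⟨t, ht⟩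

lemma cov_inputNoise_noise (hX : M.IsAffineInput P S₁ W L KZ R Z X) (h : M.IsDrivenBy P S₁ W)
    {s t : ℕ} (hs : s < n) (ht : t < n) : cov[Z s, M.noise S₁ W t; P] = 0 := by
  have hG := hX.isGaussianSpace h
  have := hG.isProbabilityMeasure
  exact (hX.indep_ZV.comp (φ := fun z : Fin n → ℝ => z ⟨s, hs⟩)
    (ψ := fun v : Fin n → ℝ => v ⟨t, ht⟩) (by fun_prop) (by fun_prop)).covariance_eq_zero
      (hG.memLp (inputNoise_mem_space hs)) (hG.memLp (noise_mem_space ht))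

lemma cov_inputNoise_inputNoise (hX : M.IsAffineInput P S₁ W L KZ R Z X)
    (h : M.IsDrivenBy P S₁ W) {s t : ℕ} (hs : s < n) (ht : t < n) (hst : s ≠ t) :
    cov[Z s, Z t; P] = 0 := by
  have hG := hX.isGaussianSpace h
  have := hG.isProbabilityMeasure
  exact (hX.indep_Z.indepFun (i := ⟨s, hs⟩) (j := ⟨t, ht⟩)
    (by simpa using hst)).covariance_eq_zero
      (hG.memLp (inputNoise_mem_space hs)) (hG.memLp (inputNoise_mem_space ht))

/-- The noise and the past of the input noise are orthogonal to `Z_t`, hence so is the past of the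
input. -/
lemma mem_orthTo_inputNoise (hX : M.IsAffineInput P S₁ W L KZ R Z X) (h : M.IsDrivenBy P S₁ W)
    {t : ℕ} (ht : t < n) :
    (∀ s < n, M.noise S₁ W s ∈
      orthTo P (hX.isGaussianSpace h) (inputNoise_mem_space (Z := Z) ht)) ∧
    ∀ s < t, X s ∈ orthTo P (hX.isGaussianSpace h) (inputNoise_mem_space (Z := Z) ht) := by
  have hV : ∀ s < n, M.noise S₁ W s ∈
      orthTo P (hX.isGaussianSpace h) (inputNoise_mem_space (Z := Z) ht) := fun s hs =>
    ⟨noise_mem_space hs, hX.cov_inputNoise_noise h ht hs⟩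
  refine ⟨hV, fun s hs => ?_⟩
  exact input_mem_of h (isGaussianSpace_orthTo _ _) hX.mem_R hX.repr (hs.trans ht)
    (fun r hr => hV r (by omega)) fun r hr => ⟨inputNoise_mem_space (by omega),
      hX.cov_inputNoise_inputNoise h ht (by omega) (by omega)⟩

lemma innov_mem_space (hX : M.IsAffineInput P S₁ W L KZ R Z X) (h : M.IsDrivenBy P S₁ W)
    {t : ℕ} (ht : t < n) : innov P (M.noise S₁ W) t ∈ space n P (M.noise S₁ W) Z :=
  innov_mem (hX.isGaussianSpace h) h.measurable_noise (fun _ hj => noise_mem_space hj) ht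

/-- The input up to time `t` is orthogonal to the innovation of the noise at time `t`. -/
lemma mem_orthTo_innov (hX : M.IsAffineInput P S₁ W L KZ R Z X) (h : M.IsDrivenBy P S₁ W)
    {t : ℕ} (ht : t < n) :
    (∀ s < t, M.noise S₁ W s ∈ orthTo P (hX.isGaussianSpace h) (hX.innov_mem_space h ht)) ∧
    (∀ s < n, Z s ∈ orthTo P (hX.isGaussianSpace h) (hX.innov_mem_space h ht)) ∧
    ∀ s ≤ t, X s ∈ orthTo P (hX.isGaussianSpace h) (hX.innov_mem_space h ht) := by
  have hG := hX.isGaussianSpace h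
  have hV : ∀ s < t, M.noise S₁ W s ∈
      orthTo P (hX.isGaussianSpace h) (hX.innov_mem_space h ht) := fun s hs =>
    ⟨noise_mem_space (by omega), cov_innov hG h.measurable_noise
      (fun _ hj => noise_mem_space hj) ht (mem_affSpan_block _ hs)⟩
  have hZ : ∀ s < n, Z s ∈ orthTo P (hX.isGaussianSpace h) (hX.innov_mem_space h ht) :=
    fun s hs => by
      refine ⟨inputNoise_mem_space hs, ?_⟩
      have h1 : innov P (M.noise S₁ W) t ∈ orthTo P hG (inputNoise_mem_space (Z := Z) hs) :=
        innov_mem (isGaussianSpace_orthTo _ _) h.measurable_noise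
          (hX.mem_orthTo_inputNoise h hs).1 ht
      rw [covariance_comm]; exact h1.2
  refine ⟨hV, hZ, fun s hs => ?_⟩
  exact input_mem_of h (isGaussianSpace_orthTo _ _) hX.mem_R hX.repr (by omega)
    (fun r hr => hV r (by omega)) fun r hr => hZ r (by omega)

lemma input_mem_space (hX : M.IsAffineInput P S₁ W L KZ R Z X) (h : M.IsDrivenBy P S₁ W)
    {t : ℕ} (ht : t < n) : X t ∈ space n P (M.noise S₁ W) Z :=
  input_mem_of h (hX.isGaussianSpace h) hX.mem_R hX.repr ht
    (fun _ _ => noise_mem_space (by omega)) fun _ _ => inputNoise_mem_space (by omega)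

/-- Independent input noise is uncorrelated with everything that the filter requires, as the input
is a causal function of the noise and the input noise. -/
lemma isFilterInput (hX : M.IsAffineInput P S₁ W L KZ R Z X) (h : M.IsDrivenBy P S₁ W) :
    M.IsFilterInput P S₁ W (space n P (M.noise S₁ W) Z) L KZ R Z X where
  meas_X := hX.meas_X
  gauss := hX.isGaussianSpace h
  noise_mem := fun _ ht => noise_mem_space ht
  mem_X := fun _ ht => hX.input_mem_space h ht
  mem_ζ := fun _ ht => inputNoise_mem_space ht
  mem_R := hX.mem_R
  repr := hX.repr
  integral_ζ := fun t ht => by rw [(hX.law_Z t ht).integral_eq]; simp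
  cov_ζ := fun t ht => by
    rw [covariance_self (hX.law_Z t ht).aemeasurable, (hX.law_Z t ht).variance_eq]; simp
  cov_output := fun t ht j hj => (Submodule.add_mem _ ((hX.mem_orthTo_inputNoise h ht).2 j hj)
    ((hX.mem_orthTo_inputNoise h ht).1 j (by omega))).2
  cov_est := fun t ht i => (affSpan_block_le (isGaussianSpace_orthTo (hX.isGaussianSpace h)
    (inputNoise_mem_space (Z := Z) ht)) (fun j hj => (hX.mem_orthTo_inputNoise h ht).1 j (by omega))
    (h.est_mem ht.le i)).2
  cov_noise_innov := fun t ht => by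
    rw [covariance_comm]; exact ((hX.mem_orthTo_innov h ht).2.1 t ht).2
  innov_output := fun t ht j hj => (Submodule.add_mem _ ((hX.mem_orthTo_innov h ht).2.2 j hj.le)
    ((hX.mem_orthTo_innov h ht).1 j hj)).2

/-- A Gaussian space that contains the noise before `t` and the input before `t` contains all the
estimates up to time `t`. -/
lemma estEst_mem_of (hX : M.IsAffineInput P S₁ W L KZ R Z X) (h : M.IsDrivenBy P S₁ W)
    {H : Submodule ℝ (Ω → ℝ)} (hH : IsGaussianSpace P H) {t : ℕ} (ht : t ≤ n)
    (hVH : ∀ s < t, M.noise S₁ W s ∈ H) (hXH : ∀ s < t, X s ∈ H) :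
    (∀ s ≤ t, ∀ i, (fun ω => M.est P S₁ W s ω i) ∈ H) ∧
    ∀ s ≤ t, ∀ i, (fun ω => M.estEst P S₁ W X s ω i) ∈ H :=
  ⟨fun _ hs i => affSpan_block_le hH (fun j hj => hVH j (by omega)) (h.est_mem (by omega) i),
   fun _ hs i => affSpan_block_le hH
    (fun j hj => H.add_mem (hXH j (by omega)) (hVH j (by omega)))
    ((hX.isFilterInput h).estEst_mem h (by omega) i)⟩

lemma measurable_estEst (hX : M.IsAffineInput P S₁ W L KZ R Z X) (h : M.IsDrivenBy P S₁ W)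
    {t : ℕ} (ht : t ≤ n) : Measurable (M.estEst P S₁ W X t) :=
  (stronglyMeasurable_predict (fun j hj =>
    (hX.isFilterInput h).measurable_output h j (by omega)) _).measurable

/-- An input with independent noise is generated by Gaussian conditional distributions. -/
lemma generates (hX : M.IsAffineInput P S₁ W L KZ R Z X) (h : M.IsDrivenBy P S₁ W)
    {a : ℕ → ℝ} {g : ∀ t, Fin t → ℝ}
    (hR : ∀ t < n, R t =ᵐ[P] fun ω => a t + g t ⬝ᵥ block (M.output S₁ W X) t ω)
    {π : InputKernels ns} (hπ : ∀ t < n, ∀ (s : Fin ns → ℝ) (y : Fin t → ℝ),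
      π t (s, y) = gaussianReal (a t + L t ⬝ᵥ s + g t ⬝ᵥ y) (KZ t)) :
    M.Generates P S₁ W π X := by
  have hF := hX.isFilterInput h
  have := hF.gauss.isProbabilityMeasure
  refine ⟨hX.meas_X, fun t ht => ?_⟩
  have hm : Measurable fun τ : ((Fin t → ℝ) × (Fin n → ℝ)) × ((Fin ns → ℝ) × (Fin t → ℝ)) =>
      a t + L t ⬝ᵥ τ.2.1 + g t ⬝ᵥ τ.2.2 := by unfold dotProduct; fun_prop
  have hπm : IsMarkovKernel (π t) := ⟨fun p => by rw [hπ t ht p.1 p.2]; infer_instance⟩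
  have hT : AEMeasurable (fun ω => ((block X t ω, block (M.noise S₁ W) n ω),
      (M.est P S₁ W t ω, block (M.output S₁ W X) t ω))) P :=
    (((measurable_block fun j hj => hX.meas_X j (by omega)).prodMk
      (measurable_block h.measurable_noise)).prodMk ((h.measurable_est ht.le).prodMk
        (measurable_block fun j hj => hF.measurable_output h j (by omega)))).aemeasurable
  have horth := hX.mem_orthTo_inputNoise h ht
  refine hasCondDistrib_gaussianReal hm (fun τ => ?_) hT (Z := Z t) ?_ (hX.law_Z t ht) ?_
  · rw [Kernel.prodMkLeft_apply, ← hπ t ht]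
  · filter_upwards [hX.repr t ht, hR t ht] with ω h1 h2
    rw [h1, h2]; ring
  · refine hF.gauss.indepFun_orthTo (inputNoise_mem_space ht) hT (MemVec.prodMk (MemVec.prodMk
      (memVec_pi_real fun j => horth.2 j j.2) (memVec_pi_real fun j => horth.1 j j.2))
      (MemVec.prodMk (memVec_pi_real ?_) (memVec_pi_real fun j => ?_)))
    · exact fun i => affSpan_block_le (isGaussianSpace_orthTo _ _)
        (fun j hj => horth.1 j (by omega)) (h.est_mem ht.le i)
    · exact Submodule.add_mem _ (horth.2 j j.2) (horth.1 j (by omega))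

lemma exists_generates (hX : M.IsAffineInput P S₁ W L KZ R Z X) (h : M.IsDrivenBy P S₁ W) :
    ∃ π : InputKernels ns, IsGaussianInput n π ∧ M.Generates P S₁ W π X := by
  have h1 : ∀ t, ∃ (a : ℝ) (g : Fin t → ℝ), t < n →
      R t =ᵐ[P] fun ω => a + g ⬝ᵥ block (M.output S₁ W X) t ω := fun t => by
    by_cases ht : t < n
    · obtain ⟨a, g, hag⟩ := hX.mem_R t ht
      exact ⟨a, g, fun _ => hag⟩
    · exact ⟨0, 0, fun h => absurd h ht⟩
  choose a g hag using h1
  let π : InputKernels ns := fun t =>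
    ⟨fun p => gaussianReal (a t + L t ⬝ᵥ p.1 + g t ⬝ᵥ p.2) (KZ t), by
      have hm : Measurable fun p : (Fin ns → ℝ) × (Fin t → ℝ) =>
          (a t + L t ⬝ᵥ p.1 + g t ⬝ᵥ p.2, KZ t) := by unfold dotProduct; fun_prop
      exact measurable_gaussianReal.comp hm⟩
  exact ⟨π, fun t _ => ⟨a t, L t, g t, KZ t, fun s y => rfl⟩,
    hX.generates h hag fun t _ s y => rfl⟩

end IsAffineInput

/-- An input that is a function of the sufficient statistic plus independent noise is an affine
input. -/
lemma IsSuffStatInput.isAffineInput {L : ℕ → Fin ns → ℝ} {KZ : ℕ → ℝ≥0} {Z X : ℕ → Ω → ℝ}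
    (hX : M.IsSuffStatInput P S₁ W L KZ Z X) (h : M.IsDrivenBy P S₁ W) :
    M.IsAffineInput P S₁ W L KZ (fun t ω => -(L t ⬝ᵥ M.estEst P S₁ W X t ω)) Z X := by
  have hrepr : ∀ t < n, X t =ᵐ[P] fun ω => L t ⬝ᵥ M.est P S₁ W t ω +
      -(L t ⬝ᵥ M.estEst P S₁ W X t ω) + Z t ω := fun t ht => by
    filter_upwards [hX.repr t ht] with ω h1
    rw [h1, dotProduct_sub]; ring
  obtain ⟨G, hG, hS, hW⟩ := h.exists_gaussianSpace
  have hVn : HasGaussianLaw (block (M.noise S₁ W) n) P :=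
    hG.hasGaussianLaw (measurable_block h.measurable_noise).aemeasurable
      (memVec_pi_real fun j => noise_mem_of hS fun s hs => hW s (by omega))
  have hZn : HasGaussianLaw (block Z n) P :=
    iIndepFun.hasGaussianLaw (X := fun t : Fin n => Z t)
      (fun t => (hX.law_Z t t.2).hasGaussianLaw) hX.indep_Z
  have hH := isGaussianSpace_gaussSpan (hX.indep_ZV.symm.hasGaussianLaw hVn hZn)
  have hmem := memVec_gaussSpan (P := P) fun ω => (block (M.noise S₁ W) n ω, block Z n ω)
  set H := gaussSpan P fun ω => (block (M.noise S₁ W) n ω, block Z n ω)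
  have hVH : ∀ t < n, M.noise S₁ W t ∈ H := fun t ht => hmem.fst.eval ⟨t, ht⟩
  have hZH : ∀ t < n, Z t ∈ H := fun t ht => hmem.snd.eval ⟨t, ht⟩
  have hYm : ∀ t < n, Measurable (M.output S₁ W X t) := fun t ht =>
    (hX.meas_X t ht).add (h.measurable_noise t ht)
  have hest : ∀ t ≤ n, ∀ i, (fun ω => M.est P S₁ W t ω i) ∈ H := fun t ht i =>
    affSpan_block_le hH (fun j hj => hVH j (by omega)) (h.est_mem ht i)
  have hRspan : ∀ t < n, (∀ s < t, X s ∈ H) → (fun ω => -(L t ⬝ᵥ M.estEst P S₁ W X t ω)) ∈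
      affSpan P (block (M.output S₁ W X) t) := fun t ht hXs => by
    refine Submodule.neg_mem _ (dotProduct_mem (predict_apply_mem hH
      (fun j hj => hYm j (by omega)) (fun j hj => H.add_mem (hXs j hj) (hVH j (by omega)))
      (hest t ht.le)) (L t))
  have hXH : ∀ t, t < n → X t ∈ H := by
    intro t
    induction t using Nat.strong_induction_on with
    | _ t ih =>
      intro ht
      have hXs : ∀ s < t, X s ∈ H := fun s hs => ih s hs (by omega)
      have hRH := affSpan_block_le hH
        (fun j hj => H.add_mem (hXs j hj) (hVH j (by omega))) (hRspan t ht hXs)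
      exact hH.congr _ (H.add_mem (H.add_mem (dotProduct_mem (hest t ht.le) (L t)) hRH)
        (hZH t ht)) _ (hrepr t ht).symm
  exact ⟨hX.meas_X, hX.meas_Z, hX.law_Z, hX.indep_Z, hX.indep_ZV,
    fun t ht => hRspan t ht fun s hs => hXH s (by omega), hrepr⟩

/-- The function of the past of the output vanishes for an input in terms of the sufficient
statistic. -/
lemma outputPart_eq_zero (L : ℕ → Fin ns → ℝ) (X : ℕ → Ω → ℝ) (t : ℕ) :
    IsFilterInput.outputPart M P S₁ W L (fun t ω => -(L t ⬝ᵥ M.estEst P S₁ W X t ω)) X t =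
      fun _ => 0 := by
  ext ω; simp [IsFilterInput.outputPart]

lemma IsSuffStatInput.feedbackFilterClaims [IsProbabilityMeasure P] {L : ℕ → Fin ns → ℝ}
    {KZ : ℕ → ℝ≥0} {Z X : ℕ → Ω → ℝ} (hX : M.IsSuffStatInput P S₁ W L KZ Z X)
    (h : M.IsDrivenBy P S₁ W) : M.FeedbackFilterClaims P S₁ W L KZ Z X := by
  have hA := hX.isAffineInput h
  have hF := hA.isFilterInput h
  have hG := hF.gauss
  have hYm := hF.measurable_output h
  have hstep := fun t (ht : t < n) => hF.filter_step h ht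
  have hVm := h.measurable_noise
  have hXb : ∀ t < n, Measurable (block X t) := fun t ht =>
    measurable_block fun j hj => hX.meas_X j (by omega)
  have hVb : ∀ t < n, Measurable (block (M.noise S₁ W) t) := fun t ht =>
    measurable_block fun j hj => hVm j (by omega)
  have hYb : ∀ t < n, Measurable (block (M.output S₁ W X) t) := fun t ht =>
    measurable_block fun j hj => hYm j (by omega)
  have hestb : ∀ t < n, Measurable (block (M.est P S₁ W) (t + 1)) := fun t ht =>
    measurable_block fun j hj => h.measurable_est (by omega)
  have hestEstb : ∀ t < n, Measurable (block (M.estEst P S₁ W X) (t + 1)) := fun t ht =>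
    measurable_block fun j hj => hA.measurable_estEst h (by omega)
  have hIb : ∀ t < n, Measurable (block (innov P (M.noise S₁ W)) (t + 1)) := fun t ht =>
    measurable_block fun j hj => measurable_innov hVm (by omega)
  exact
  { in_class := hA.exists_generates h
    indep_Z_past := fun t ht => by
      have ho := hA.mem_orthTo_inputNoise h ht
      have he := hA.estEst_mem_of h (isGaussianSpace_orthTo _ _) ht.le
        (fun s hs => ho.1 s (by omega)) ho.2
      refine hG.indepFun_orthTo (IsAffineInput.inputNoise_mem_space ht)
        ((hXb t ht).prodMk ((hVb t ht).prodMk ((hestb t ht).prodMk ((hestEstb t ht).prodMk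
          ((hIb t ht).prodMk (hYb t ht)))))).aemeasurable ?_
      refine MemVec.prodMk (memVec_pi_real fun j => ho.2 j j.2)
        (MemVec.prodMk (memVec_pi_real fun j => ho.1 j (by omega))
        (MemVec.prodMk (memVec_pi fun j => memVec_pi_real (he.1 j (by omega)))
        (MemVec.prodMk (memVec_pi fun j => memVec_pi_real (he.2 j (by omega)))
        (MemVec.prodMk (memVec_pi_real fun j => ?_) (memVec_pi_real fun j => ?_)))))
      · exact innov_mem (isGaussianSpace_orthTo _ _) hVm ho.1 (by omega)
      · exact Submodule.add_mem _ (ho.2 j j.2) (ho.1 j (by omega))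
    indep_innov_past := fun t ht => by
      have ho := hA.mem_orthTo_innov h ht
      have he := hA.estEst_mem_of h (isGaussianSpace_orthTo _ _) ht.le ho.1
        (fun s hs => ho.2.2 s hs.le)
      refine hG.indepFun_orthTo (hA.innov_mem_space h ht)
        ((hXb t ht).prodMk ((hVb t ht).prodMk ((hestb t ht).prodMk ((hYb t ht).prodMk
          (hestEstb t ht))))).aemeasurable ?_
      refine MemVec.prodMk (memVec_pi_real fun j => ho.2.2 j j.2.le)
        (MemVec.prodMk (memVec_pi_real fun j => ho.1 j j.2)
        (MemVec.prodMk (memVec_pi fun j => memVec_pi_real (he.1 j (by omega)))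
        (MemVec.prodMk (memVec_pi_real fun j => ?_)
        (memVec_pi fun j => memVec_pi_real (he.2 j (by omega))))))
      exact Submodule.add_mem _ (ho.2.2 j j.2.le) (ho.1 j j.2)
    output_eq := fun t ht => by
      filter_upwards [hX.repr t ht, h.noiseFilterClaims.innov_eq t ht] with ω h1 h2
      rw [output, h1, h2]; ring
    power_eq := by
      rw [hF.avgPower_eq h]
      simp [outputPart_eq_zero]
    estEst_init := by rw [hF.estEst_zero h]
    estEst_step := fun t ht => (hstep t ht).2.2.2
    innov_eq := fun t ht => by
      filter_upwards [(hstep t ht).2.1, hX.repr t ht, h.noiseFilterClaims.innov_eq t ht]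
        with ω h1 h2 h3
      rw [h1, output, h2, h3, add_dotProduct, dotProduct_sub, dotProduct_sub]; ring
    innov_eq_err := fun t ht => by
      filter_upwards [(hstep t ht).2.1] with ω h1
      rw [h1]; ring
    KI_pos := fun t ht => (hstep t ht).1
    innov_law := fun t ht => by
      rw [← (hstep t ht).2.2.1]; exact hasLaw_innov hG hYm hF.output_mem ht
    innov_indep := iIndepFun_innov hG hYm hF.output_mem
    innov_indep_past := fun t ht => indepFun_innov_block hG hYm hF.output_mem ht
    output_condVar := fun t ht => by
      rw [← (hstep t ht).2.2.1]; exact predict_innov_sq hG hYm hF.output_mem ht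
    errCov_eq := fun t ht => hF.errCov_estEst h ht
    condCov_eq := fun t ht i j => by
      rw [← hF.errCov_estEst h ht]
      exact predict_error_mul_error hG (fun j hj => hYm j (by omega))
        (fun j hj => hF.output_mem j (by omega)) (hF.est_mem h ht) i j
    KFb_psd := fun t ht => hF.KFb_posSemidef h ht }

end NoiseModel

/-! ### Inputs generated by Gaussian conditional distributions -/

/-- The Gaussian channel turns a Gaussian input into a Gaussian output. -/
lemma gaussianReal_bind_gaussianReal (m c : ℝ) (v w : ℝ≥0) {κ : Kernel ℝ ℝ}
    (hκ : ∀ x, κ x = gaussianReal (x + c) w) :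
    (gaussianReal m v).bind κ = gaussianReal (m + c) (v + w) := by
  have : IsMarkovKernel κ := ⟨fun x => by rw [hκ]; infer_instance⟩
  have hm : Measurable fun x : ℝ => x + c := by fun_prop
  have h1 := map_prod_gaussianReal (gaussianReal m v) hm hκ
  rw [← Measure.snd_compProd, ← h1, Measure.snd, Measure.map_map measurable_snd (by fun_prop)]
  have h2 : (Prod.snd ∘ fun p : ℝ × ℝ => (p.1, p.1 + c + p.2)) =
      (fun x => x + c) ∘ fun p : ℝ × ℝ => p.1 + p.2 := by
    ext p; simp only [Function.comp_apply]; ring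
  have h3 : ((gaussianReal m v).prod (gaussianReal 0 w)).map (fun p : ℝ × ℝ => p.1 + p.2) =
      gaussianReal (m + 0) (v + w) := gaussianReal_conv_gaussianReal
  rw [h2, ← Measure.map_map (by fun_prop) (by fun_prop), h3, gaussianReal_map_add_const, add_zero]

namespace NoiseModel

variable {ns nw n : ℕ} {Ω : Type*} {M : NoiseModel ns nw n} {S₁ : Ω → Fin ns → ℝ}
  {W : ℕ → Ω → Fin nw → ℝ} [MeasurableSpace Ω] {P : Measure Ω}

lemma IsGaussianInput.exists_coeff {π : InputKernels ns} (hπ : IsGaussianInput n π) :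
    ∃ (a : ℕ → ℝ) (L : ℕ → Fin ns → ℝ) (g : ∀ t, Fin t → ℝ) (KZ : ℕ → ℝ≥0),
      ∀ t < n, ∀ (s : Fin ns → ℝ) (y : Fin t → ℝ),
        π t (s, y) = gaussianReal (a t + L t ⬝ᵥ s + g t ⬝ᵥ y) (KZ t) := by
  have h1 : ∀ t, ∃ (a : ℝ) (b : Fin ns → ℝ) (g : Fin t → ℝ) (v : ℝ≥0), t < n →
      ∀ (s : Fin ns → ℝ) (y : Fin t → ℝ), π t (s, y) = gaussianReal (a + b ⬝ᵥ s + g ⬝ᵥ y) v :=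
    fun t => by
      by_cases ht : t < n
      · obtain ⟨a, b, g, v, hv⟩ := hπ t ht
        exact ⟨a, b, g, v, fun _ => hv⟩
      · exact ⟨0, 0, 0, 0, fun h => absurd h ht⟩
  choose a L g KZ hK using h1
  exact ⟨a, L, g, KZ, hK⟩

/-- An input that is generated by Gaussian conditional distributions has independent noise. -/
lemma Generates.exists_isAffineInput [IsProbabilityMeasure P] {π : InputKernels ns}
    {X : ℕ → Ω → ℝ} (h : M.IsDrivenBy P S₁ W) (hπ : IsGaussianInput n π)
    (hX : M.Generates P S₁ W π X) :
    ∃ (a : ℕ → ℝ) (L : ℕ → Fin ns → ℝ) (g : ∀ t, Fin t → ℝ) (KZ : ℕ → ℝ≥0) (Z : ℕ → Ω → ℝ),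
      (∀ t < n, ∀ (s : Fin ns → ℝ) (y : Fin t → ℝ),
        π t (s, y) = gaussianReal (a t + L t ⬝ᵥ s + g t ⬝ᵥ y) (KZ t)) ∧
      M.IsAffineInput P S₁ W L KZ (fun t ω => a t + g t ⬝ᵥ block (M.output S₁ W X) t ω) Z X := by
  obtain ⟨a, L, g, KZ, hK⟩ := hπ.exists_coeff
  set V := M.noise S₁ W with hV
  set Y := M.output S₁ W X with hY
  set Z : ℕ → Ω → ℝ := fun t ω => X t ω - (a t + L t ⬝ᵥ M.est P S₁ W t ω + g t ⬝ᵥ block Y t ω)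
    with hZ
  have hVm := h.measurable_noise
  have hYm : ∀ t < n, Measurable (Y t) := fun t ht => (hX.meas t ht).add (hVm t ht)
  have hdot : ∀ {k : ℕ} (c : Fin k → ℝ) {f : Ω → Fin k → ℝ}, Measurable f →
      Measurable fun ω => c ⬝ᵥ f ω := fun c f hf => by
    have : Measurable fun v => c ⬝ᵥ v := by unfold dotProduct; fun_prop
    exact this.comp hf
  have hYb : ∀ t < n, Measurable (block Y t) := fun t ht =>
    measurable_block fun j hj => hYm j (by omega)
  have hZm : ∀ t < n, Measurable (Z t) := fun t ht =>
    (hX.meas t ht).sub (((hdot (L t) (h.measurable_est ht.le)).const_add (a t)).add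
      (hdot (g t) (hYb t ht)))
  have hcond : ∀ t < n, HasLaw (Z t) (gaussianReal 0 (KZ t)) P ∧
      IndepFun (Z t) (fun ω => (block X t ω, block V n ω)) P := fun t ht => by
    have hm : Measurable fun τ : ((Fin t → ℝ) × (Fin n → ℝ)) × ((Fin ns → ℝ) × (Fin t → ℝ)) =>
        a t + L t ⬝ᵥ τ.2.1 + g t ⬝ᵥ τ.2.2 := by unfold dotProduct; fun_prop
    have hπm : IsMarkovKernel (π t) := ⟨fun p => by rw [hK t ht p.1 p.2]; infer_instance⟩
    have h2 := (hX.cond t ht).indepFun_sub hm (v := KZ t) fun τ => by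
      rw [Kernel.prodMkLeft_apply, ← hK t ht]
    exact ⟨h2.1, h2.2.comp measurable_id measurable_fst⟩
  obtain ⟨G₀, hG₀, hS, hW⟩ := h.exists_gaussianSpace
  -- the noise and the inputs are jointly Gaussian, as each `Z_t` is independent of the past
  have hspace : ∀ t ≤ n, ∃ G, IsGaussianSpace P G ∧ (∀ j < n, V j ∈ G) ∧ ∀ j < t, X j ∈ G := by
    intro t
    induction t with
    | zero => exact fun _ => ⟨G₀, hG₀, fun j hj => noise_mem_of hS fun s hs => hW s (by omega),
        fun j hj => absurd hj (by omega)⟩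
    | succ t ih =>
      intro ht
      obtain ⟨G, hG, hVG, hXG⟩ := ih (by omega)
      have hT : HasGaussianLaw (fun ω => (block X t ω, block V n ω)) P :=
        hG.hasGaussianLaw ((measurable_block fun j hj => hX.meas j (by omega)).prodMk
          (measurable_block hVm)).aemeasurable
          (MemVec.prodMk (memVec_pi_real fun j => hXG j j.2) (memVec_pi_real fun j => hVG j j.2))
      have hTZ := ((hcond t (by omega)).2.symm).hasGaussianLaw hT
        (hcond t (by omega)).1.hasGaussianLaw
      have hmem := memVec_gaussSpan (P := P) fun ω => ((block X t ω, block V n ω), Z t ω)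
      have hG' := isGaussianSpace_gaussSpan hTZ
      set G' := gaussSpan P fun ω => ((block X t ω, block V n ω), Z t ω)
      have hV' : ∀ j < n, V j ∈ G' := fun j hj => hmem.fst.snd.eval ⟨j, hj⟩
      have hX' : ∀ j < t, X j ∈ G' := fun j hj => hmem.fst.fst.eval ⟨j, hj⟩
      refine ⟨G', hG', hV', fun j hj => ?_⟩
      rcases Nat.lt_succ_iff_lt_or_eq.1 hj with hj | rfl
      · exact hX' j hj
      · have hest : ∀ i, (fun ω => M.est P S₁ W j ω i) ∈ G' := fun i =>
          affSpan_block_le hG' (fun l hl => hV' l (by omega)) (h.est_mem (by omega) i)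
        have hYG : (fun ω => g j ⬝ᵥ block Y j ω) ∈ G' := dotProduct_mem (f := block Y j)
          (fun l => G'.add_mem (hX' l l.2) (hV' l (by omega))) (g j)
        have hZG : Z j ∈ G' := memVec_real.1 hmem.snd
        have hsum := G'.add_mem (G'.add_mem (G'.add_mem (hG'.const (a j))
          (dotProduct_mem hest (L j))) hYG) hZG
        convert hsum using 1
        ext ω
        simp only [Pi.add_apply, hZ]
        ring
  obtain ⟨G, hG, hVG, hXG⟩ := hspace n le_rfl
  have hYG : ∀ j < n, Y j ∈ G := fun j hj => G.add_mem (hXG j hj) (hVG j hj)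
  have hZmem : ∀ {H : Submodule ℝ (Ω → ℝ)} (hH : IsGaussianSpace P H) (t : ℕ), t < n →
      (∀ j < t, V j ∈ H) → (∀ j ≤ t, X j ∈ H) → Z t ∈ H := by
    intro H hH t ht hVH hXH
    have hest : ∀ i, (fun ω => M.est P S₁ W t ω i) ∈ H := fun i =>
      affSpan_block_le hH (fun l hl => hVH l hl) (h.est_mem ht.le i)
    have hYH : (fun ω => g t ⬝ᵥ block Y t ω) ∈ H := dotProduct_mem (f := block Y t)
      (fun l => H.add_mem (hXH l l.2.le) (hVH l l.2)) (g t)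
    exact H.sub_mem (hXH t le_rfl) (H.add_mem (H.add_mem (hH.const (a t))
      (dotProduct_mem hest (L t))) hYH)
  have hZG : ∀ t < n, Z t ∈ G := fun t ht =>
    hZmem hG t ht (fun j hj => hVG j (by omega)) fun j hj => hXG j (by omega)
  have hcovV : ∀ t < n, ∀ j < n, cov[Z t, V j; P] = 0 := fun t ht j hj =>
    ((hcond t ht).2.comp (φ := id) (ψ := fun p : (Fin t → ℝ) × (Fin n → ℝ) => p.2 ⟨j, hj⟩)
      measurable_id (by fun_prop)).covariance_eq_zero (hG.memLp (hZG t ht)) (hG.memLp (hVG j hj))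
  have hcovX : ∀ t < n, ∀ j < t, cov[Z t, X j; P] = 0 := fun t ht j hj =>
    ((hcond t ht).2.comp (φ := id) (ψ := fun p : (Fin t → ℝ) × (Fin n → ℝ) => p.1 ⟨j, hj⟩)
      measurable_id (by fun_prop)).covariance_eq_zero (hG.memLp (hZG t ht))
      (hG.memLp (hXG j (by omega)))
  have hcovZ : ∀ s t, s < t → t < n → cov[Z t, Z s; P] = 0 := fun s t hst ht =>
    (hZmem (isGaussianSpace_orthTo hG (hZG t ht)) s (by omega)
      (fun j hj => ⟨hVG j (by omega), hcovV t ht j (by omega)⟩)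
      fun j hj => ⟨hXG j (by omega), hcovX t ht j (by omega)⟩).2
  have hZn : HasGaussianLaw (fun ω => fun t : Fin n => Z t ω) P :=
    hG.hasGaussianLaw (measurable_block hZm).aemeasurable (memVec_pi_real fun t => hZG t t.2)
  refine ⟨a, L, g, KZ, Z, hK, hX.meas, hZm, fun t ht => (hcond t ht).1, ?_, ?_, ?_, ?_⟩
  · refine hZn.iIndepFun_of_covariance_eq_zero fun s t hst => ?_
    rcases lt_or_gt_of_ne (fun h => hst (Fin.ext h) : (s : ℕ) ≠ t) with hlt | hlt
    · rw [covariance_comm]; exact hcovZ s t hlt t.2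
    · exact hcovZ t s hlt s.2
  · refine HasGaussianLaw.indepFun_of_covariance_eval (X := fun t : Fin n => Z t)
      (Y := fun t : Fin n => V t) ?_ fun s t => hcovV s s.2 t t.2
    exact hG.hasGaussianLaw ((measurable_block hZm).prodMk (measurable_block hVm)).aemeasurable
      (MemVec.prodMk (memVec_pi_real fun t => hZG t t.2) (memVec_pi_real fun t => hVG t t.2))
  · exact fun t _ => ⟨a t, g t, by rfl⟩
  · intro t _
    filter_upwards with ω
    simp only [hZ]; ring

namespace IsAffineInput

variable {L : ℕ → Fin ns → ℝ} {KZ : ℕ → ℝ≥0} {R Z X : ℕ → Ω → ℝ}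

lemma hasLaw_inputNoise_add_innov [IsProbabilityMeasure P]
    (hX : M.IsAffineInput P S₁ W L KZ R Z X) (h : M.IsDrivenBy P S₁ W) {t : ℕ} (ht : t < n) :
    HasLaw (Z t + innov P (M.noise S₁ W) t)
      (gaussianReal 0 (KZ t + (M.KIhat t).toNNReal)) P := by
  have hG := hX.isGaussianSpace h
  have hI := h.noiseFilterClaims.innov_law t ht
  have hind : IndepFun (innov P (M.noise S₁ W) t) (Z t) P :=
    hG.indepFun_orthTo (hX.innov_mem_space h ht) (hX.law_Z t ht).aemeasurable
      (memVec_real.2 ((hX.mem_orthTo_innov h ht).2.1 t ht))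
  have h1 := gaussianReal_add_gaussianReal_of_indepFun hind.symm (hX.law_Z t ht).map_eq hI.map_eq
  rw [add_zero] at h1
  exact ⟨(hX.law_Z t ht).aemeasurable.add hI.aemeasurable, h1⟩

lemma inducedLawClaims [IsProbabilityMeasure P] (hX : M.IsAffineInput P S₁ W L KZ R Z X)
    (h : M.IsDrivenBy P S₁ W) {a : ℕ → ℝ} {g : ∀ t, Fin t → ℝ}
    (hR : ∀ t < n, R t =ᵐ[P] fun ω => a t + g t ⬝ᵥ block (M.output S₁ W X) t ω)
    {π : InputKernels ns} (hπ : ∀ t < n, ∀ (s : Fin ns → ℝ) (y : Fin t → ℝ),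
      π t (s, y) = gaussianReal (a t + L t ⬝ᵥ s + g t ⬝ᵥ y) (KZ t)) :
    M.InducedLawClaims P S₁ W π X := by
  have hF := hX.isFilterInput h
  have hG := hF.gauss
  have hN := h.noiseFilterClaims
  have hYm := hF.measurable_output h
  have hYG := hF.output_mem
  have hYb : ∀ t < n, Measurable (block (M.output S₁ W X) t) := fun t ht =>
    measurable_block fun j hj => hYm j (by omega)
  have hent := fun t (ht : t < n) => (condDiffEntropy_eq hG hYm hYG ht
    (by rw [(hF.filter_step h ht).2.2.1]; exact (hF.filter_step h ht).1)).1
  refine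
  { jointly_gaussian := hG.hasGaussianLaw ((measurable_block hX.meas_X).prodMk
      (measurable_block hYm)).aemeasurable (MemVec.prodMk (memVec_pi_real fun t => hF.mem_X t t.2)
        (memVec_pi_real fun t => hYG t t.2))
    noise_eq := fun t ht => by
      filter_upwards [hN.innov_eq t ht] with ω h1
      rw [h1]; ring
    channel_law := fun t ht => ?_
    output_law := fun t ht => ?_
    output_gaussian := fun t ht => by
      obtain ⟨a, g, hag⟩ := exists_hasCondDistrib_block hG hYm hYG ht
      exact ⟨a, g, _, hag⟩
    entropy_exists := hent }
  · have hch : ∀ p : ℝ × (Fin ns → ℝ), M.channel t p =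
        gaussianReal (p.1 + M.C t ⬝ᵥ p.2) (M.KIhat t).toNNReal := fun p => rfl
    have : IsMarkovKernel (M.channel t) := ⟨fun p => by rw [hch]; infer_instance⟩
    have hm : Measurable fun τ : ((Fin t → ℝ) × (Fin t → ℝ)) × (ℝ × (Fin ns → ℝ)) =>
        τ.2.1 + M.C t ⬝ᵥ τ.2.2 := by unfold dotProduct; fun_prop
    have hT : AEMeasurable (fun ω => ((block (M.output S₁ W X) t ω, block X t ω),
        (X t ω, M.est P S₁ W t ω))) P :=
      (((hYb t ht).prodMk (measurable_block fun j hj => hX.meas_X j (by omega))).prodMk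
        ((hX.meas_X t ht).prodMk (h.measurable_est ht.le))).aemeasurable
    have ho := hX.mem_orthTo_innov h ht
    refine hasCondDistrib_gaussianReal hm (fun τ => ?_) hT ?_ (hN.innov_law t ht) ?_
    · rw [Kernel.prodMkLeft_apply, hch]
    · filter_upwards [hN.innov_eq t ht] with ω h1
      rw [h1, output]; ring
    · refine hG.indepFun_orthTo (hX.innov_mem_space h ht) hT (MemVec.prodMk (MemVec.prodMk
        (memVec_pi_real fun j => ?_) (memVec_pi_real fun j => ho.2.2 j j.2.le))
        (MemVec.prodMk (memVec_real.2 (ho.2.2 t le_rfl)) (memVec_pi_real fun i => ?_)))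
      · exact Submodule.add_mem _ (ho.2.2 j j.2.le) (ho.1 j j.2)
      · exact affSpan_block_le (isGaussianSpace_orthTo _ _) (fun j hj => ho.1 j hj)
          (h.est_mem ht.le i)
  · set Y := M.output S₁ W X with hY
    -- given `(Y^{t-1}, Ŝ_t)` the output is Gaussian
    have hm : Measurable fun p : (Fin t → ℝ) × (Fin ns → ℝ) =>
        a t + L t ⬝ᵥ p.2 + g t ⬝ᵥ p.1 + M.C t ⬝ᵥ p.2 := by unfold dotProduct; fun_prop
    let κ : Kernel ((Fin t → ℝ) × (Fin ns → ℝ)) ℝ :=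
      ⟨fun p => gaussianReal (a t + L t ⬝ᵥ p.2 + g t ⬝ᵥ p.1 + M.C t ⬝ᵥ p.2)
        (KZ t + (M.KIhat t).toNNReal),
        measurable_gaussianReal.comp (hm.prodMk measurable_const)⟩
    have hκ : ∀ p : (Fin t → ℝ) × (Fin ns → ℝ), κ p =
        gaussianReal (a t + L t ⬝ᵥ p.2 + g t ⬝ᵥ p.1 + M.C t ⬝ᵥ p.2)
          (KZ t + (M.KIhat t).toNNReal) := fun p => rfl
    have : IsMarkovKernel κ := ⟨fun p => by rw [hκ]; infer_instance⟩
    have hT : AEMeasurable (fun ω => (block Y t ω, M.est P S₁ W t ω)) P :=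
      ((hYb t ht).prodMk (h.measurable_est ht.le)).aemeasurable
    have hoZ := hX.mem_orthTo_inputNoise h ht
    have hoI := hX.mem_orthTo_innov h ht
    have hsum : Z t + innov P (M.noise S₁ W) t ∈ space n P (M.noise S₁ W) Z :=
      Submodule.add_mem _ (inputNoise_mem_space ht) (hX.innov_mem_space h ht)
    have horth : ∀ f, f ∈ orthTo P hG (inputNoise_mem_space (Z := Z) ht) →
        f ∈ orthTo P hG (hX.innov_mem_space h ht) → f ∈ orthTo P hG hsum := fun f h1 h2 =>
      ⟨h1.1, by
        rw [covariance_add_left (hG.memLp (inputNoise_mem_space ht))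
          (hG.memLp (hX.innov_mem_space h ht)) (hG.memLp h1.1), h1.2, h2.2, add_zero]⟩
    have h2 : HasCondDistrib (Y t) (fun ω => (block Y t ω, M.est P S₁ W t ω)) κ P := by
      refine hasCondDistrib_gaussianReal hm hκ hT ?_ (hX.hasLaw_inputNoise_add_innov h ht) ?_
      · filter_upwards [hX.repr t ht, hR t ht, hN.innov_eq t ht] with ω h1 h2 h3
        rw [Pi.add_apply, h3, hY, output, h1, h2]; ring
      · refine hG.indepFun_orthTo hsum hT (MemVec.prodMk (memVec_pi_real fun j => ?_)
          (memVec_pi_real fun i => ?_))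
        · exact horth _ (Submodule.add_mem _ (hoZ.2 j j.2) (hoZ.1 j (by omega)))
            (Submodule.add_mem _ (hoI.2.2 j j.2.le) (hoI.1 j j.2))
        · exact horth _ (affSpan_block_le (isGaussianSpace_orthTo _ _)
            (fun j hj => hoZ.1 j (by omega)) (h.est_mem ht.le i))
            (affSpan_block_le (isGaussianSpace_orthTo _ _) (fun j hj => hoI.1 j hj)
              (h.est_mem ht.le i))
    have h1 : HasCondDistrib (M.est P S₁ W t) (block Y t)
        (condDistrib (M.est P S₁ W t) (block Y t) P) P :=
      ⟨(hYb t ht).aemeasurable.prodMk (h.measurable_est ht.le).aemeasurable,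
        (compProd_map_condDistrib (h.measurable_est ht.le).aemeasurable).symm⟩
    have h3 := (h1.compProd h2).snd
    have h4 := condDistrib_ae_eq_of_measure_eq_compProd _ (hYm t ht).aemeasurable h3.map_eq
    filter_upwards [h4] with y hy
    rw [hy]
    have h5 : ∀ s : Fin ns → ℝ, (π t (s, y)).bind (fun x => M.channel t (x, s)) = κ (y, s) := by
      intro s
      rw [hπ t ht, hκ]
      let η : Kernel ℝ ℝ := (M.channel t).comap (fun x => (x, s)) (by fun_prop)
      exact gaussianReal_bind_gaussianReal _ _ _ _ (κ := η) fun x => rfl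
    simp_rw [h5]
    ext B hB
    have h6 : Measurable fun s => κ (y, s) := κ.measurable.comp measurable_prodMk_left
    rw [Kernel.snd_apply' _ _ hB, Kernel.compProd_apply (measurable_snd hB),
      Measure.bind_apply hB h6.aemeasurable]
    rfl

end IsAffineInput

end NoiseModel

/-! ### Existence of the processes -/

namespace NoiseModel

variable {ns nw n : ℕ} {Ω : Type*} {M : NoiseModel ns nw n} {S₁ : Ω → Fin ns → ℝ}
  {W : ℕ → Ω → Fin nw → ℝ} [MeasurableSpace Ω] {P : Measure Ω}

/-- The joint law of the initial state and of the driving noise. -/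
noncomputable def drivingLaw (M : NoiseModel ns nw n) :
    Measure ((Fin ns → ℝ) × (Fin n → Fin nw → ℝ)) :=
  ((multivariateGaussian (WithLp.toLp 2 M.mu) M.K₁).map WithLp.ofLp).prod
    (Measure.pi fun t : Fin n => (multivariateGaussian 0 (M.KW t)).map WithLp.ofLp)

/-- The driving noise `W_t`, `t < n`, as a function on the canonical space, and `0` later. -/
def drivingNoise (ns nw n : ℕ) (t : ℕ) (e : (Fin ns → ℝ) × (Fin n → Fin nw → ℝ)) : Fin nw → ℝ :=
  if ht : t < n then e.2 ⟨t, ht⟩ else 0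

lemma isProbabilityMeasure_map_ofLp {k : ℕ} (m : EuclideanSpace ℝ (Fin k))
    (K : Matrix (Fin k) (Fin k) ℝ) :
    IsProbabilityMeasure ((multivariateGaussian m K).map WithLp.ofLp) :=
  Measure.isProbabilityMeasure_map (by fun_prop)

instance : IsProbabilityMeasure M.drivingLaw := by
  have := isProbabilityMeasure_map_ofLp (WithLp.toLp 2 M.mu) M.K₁
  have := fun t : Fin n => isProbabilityMeasure_map_ofLp 0 (M.KW t)
  unfold drivingLaw; infer_instance

lemma hasLaw_ofLp {k : ℕ} {x : Ω → Fin k → ℝ} {m : EuclideanSpace ℝ (Fin k)}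
    {K : Matrix (Fin k) (Fin k) ℝ} :
    HasLaw (fun ω => WithLp.toLp 2 (x ω)) (multivariateGaussian m K) P ↔
      HasLaw x ((multivariateGaussian m K).map WithLp.ofLp) P := by
  constructor
  · intro h
    have h1 : HasLaw (WithLp.ofLp : EuclideanSpace ℝ (Fin k) → Fin k → ℝ)
      ((multivariateGaussian m K).map WithLp.ofLp) (multivariateGaussian m K) := ⟨by fun_prop, rfl⟩
    exact h1.fun_comp h
  · intro h
    have h1 : HasLaw (fun v : Fin k → ℝ => WithLp.toLp 2 v) (multivariateGaussian m K)
        ((multivariateGaussian m K).map WithLp.ofLp) := by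
      refine ⟨by fun_prop, ?_⟩
      rw [Measure.map_map (by fun_prop) (by fun_prop)]
      exact Measure.map_id
    exact h1.fun_comp h

lemma IsDrivenBy.hasLaw_drivingLaw [IsProbabilityMeasure P] (h : M.IsDrivenBy P S₁ W) :
    HasLaw (fun ω => (S₁ ω, block W n ω)) M.drivingLaw P := by
  have hS := hasLaw_ofLp.1 h.law_S
  have hWt := fun t : Fin n => hasLaw_ofLp.1 (h.law_W t t.2)
  have hW : HasLaw (block W n) (Measure.pi fun t : Fin n =>
      (multivariateGaussian 0 (M.KW t)).map WithLp.ofLp) P :=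
    h.indep_W.hasLaw_pi hWt
  refine ⟨hS.aemeasurable.prodMk hW.aemeasurable, ?_⟩
  rw [h.indep_SW.map_prod_eq_prod_map_map hS.aemeasurable hW.aemeasurable, hS.map_eq, hW.map_eq]
  rfl

/-- A random vector with the law `drivingLaw`, on any probability space, drives the noise. -/
lemma isDrivenBy_of_hasLaw [IsProbabilityMeasure P]
    {T : Ω → (Fin ns → ℝ) × (Fin n → Fin nw → ℝ)} (hT : Measurable T)
    (h : HasLaw T M.drivingLaw P) :
    M.IsDrivenBy P (fun ω => (T ω).1) (fun t ω => drivingNoise ns nw n t (T ω)) := by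
  have := isProbabilityMeasure_map_ofLp (WithLp.toLp 2 M.mu) M.K₁
  have := fun t : Fin n => isProbabilityMeasure_map_ofLp 0 (M.KW t)
  have hfst : HasLaw (fun ω => (T ω).1)
      ((multivariateGaussian (WithLp.toLp 2 M.mu) M.K₁).map WithLp.ofLp) P :=
    HasLaw.fun_comp (μ := M.drivingLaw) (Y := Prod.fst)
      ⟨by fun_prop, by simp [drivingLaw]⟩ h
  have hsnd : HasLaw (fun ω => (T ω).2) (Measure.pi fun t : Fin n =>
      (multivariateGaussian 0 (M.KW t)).map WithLp.ofLp) P :=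
    HasLaw.fun_comp (μ := M.drivingLaw) (Y := Prod.snd)
      ⟨by fun_prop, by simp [drivingLaw]⟩ h
  have hblock : block (fun t ω => drivingNoise ns nw n t (T ω)) n = fun ω => (T ω).2 := by
    ext ω t; simp [block, drivingNoise]
  have hW : ∀ t (ht : t < n), (fun ω => drivingNoise ns nw n t (T ω)) =
      fun ω => (T ω).2 ⟨t, ht⟩ := fun t ht => by ext ω; simp [drivingNoise, ht]
  have hWlaw : ∀ t : Fin n, HasLaw (fun ω => (T ω).2 t)
      ((multivariateGaussian 0 (M.KW t)).map WithLp.ofLp) P := fun t =>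
    (measurePreserving_eval (fun t : Fin n =>
      (multivariateGaussian 0 (M.KW t)).map WithLp.ofLp) t).hasLaw.fun_comp hsnd
  refine ⟨by fun_prop, fun t ht => ?_, hasLaw_ofLp.2 hfst, fun t ht => hasLaw_ofLp.2 ?_, ?_, ?_⟩
  · rw [hW t ht]; fun_prop
  · rw [hW t ht]; exact hWlaw ⟨t, ht⟩
  · have h1 : iIndepFun (fun (t : Fin n) ω => (T ω).2 t) P := by
      rw [iIndepFun_iff_map_fun_eq_pi_map fun t => (hWlaw t).aemeasurable]
      simp_rw [fun t => (hWlaw t).map_eq]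
      exact hsnd.map_eq
    convert h1 using 2 with t
    exact hW t t.2
  · rw [hblock, indepFun_iff_map_prod_eq_prod_map_map hfst.aemeasurable hsnd.aemeasurable,
      hfst.map_eq, hsnd.map_eq]
    exact h.map_eq

omit [MeasurableSpace Ω] in
/-- The state up to time `n` factors through the canonical space. -/
lemma state_eq_canonical {t : ℕ} (ht : t ≤ n) (ω : Ω) :
    M.state S₁ W t ω = M.state Prod.fst (drivingNoise ns nw n) t (S₁ ω, block W n ω) := by
  induction t with
  | zero => rfl
  | succ t ih =>
    have : t < n := by omega
    simp only [state, ih this.le]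
    simp [drivingNoise, this, block]

omit [MeasurableSpace Ω] in
lemma noise_eq_canonical {t : ℕ} (ht : t < n) (ω : Ω) :
    M.noise S₁ W t ω = M.noise Prod.fst (drivingNoise ns nw n) t (S₁ ω, block W n ω) := by
  simp only [noise, state_eq_canonical ht.le ω]
  simp [drivingNoise, ht, block]

lemma isDrivenBy_canonical : M.IsDrivenBy M.drivingLaw Prod.fst (drivingNoise ns nw n) :=
  isDrivenBy_of_hasLaw measurable_id HasLaw.id

/-- The covariance of the noise depends on the model only. -/
lemma IsDrivenBy.noiseCov_eq [IsProbabilityMeasure P] (h : M.IsDrivenBy P S₁ W) :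
    M.noiseCov P S₁ W = M.noiseCov M.drivingLaw Prod.fst (drivingNoise ns nw n) := by
  ext i j
  have hm := (isDrivenBy_canonical (M := M)).measurable_noise
  simp only [noiseCov, Matrix.of_apply]
  rw [← h.hasLaw_drivingLaw.covariance_fun_comp (hm i i.2).aemeasurable (hm j j.2).aemeasurable]
  congr 1
  · ext ω; exact noise_eq_canonical i.2 ω
  · ext ω; exact noise_eq_canonical j.2 ω

/-- The noise together with an independent vector of arbitrary law. -/
lemma exists_isDrivenBy (M : NoiseModel ns nw n) (ν : Measure (Fin n → ℝ))
    [IsProbabilityMeasure ν] :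
    ∃ (Ω : Type) (_ : MeasurableSpace Ω) (P : Measure Ω) (_ : IsProbabilityMeasure P)
      (S₁ : Ω → Fin ns → ℝ) (W : ℕ → Ω → Fin nw → ℝ) (Z : ℕ → Ω → ℝ),
      M.IsDrivenBy P S₁ W ∧ (∀ t, Measurable (Z t)) ∧ HasLaw (block Z n) ν P ∧
      IndepFun (block Z n) (block (M.noise S₁ W) n) P := by
  refine ⟨((Fin ns → ℝ) × (Fin n → Fin nw → ℝ)) × (Fin n → ℝ), inferInstance,
    M.drivingLaw.prod ν, inferInstance, fun ω => ω.1.1,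
    fun t ω => drivingNoise ns nw n t ω.1, fun t ω => if ht : t < n then ω.2 ⟨t, ht⟩ else 0,
    ?_, ?_, ?_, ?_⟩
  · exact isDrivenBy_of_hasLaw measurable_fst ⟨by fun_prop, by simp⟩
  · intro t
    by_cases ht : t < n <;> simp only [ht, dif_pos, dif_neg, not_false_eq_true] <;> fun_prop
  · have : block (fun t (ω : ((Fin ns → ℝ) × (Fin n → Fin nw → ℝ)) × (Fin n → ℝ)) =>
        if ht : t < n then ω.2 ⟨t, ht⟩ else 0) n = Prod.snd := by
      ext ω t; simp [block]
    rw [this]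
    exact ⟨by fun_prop, by simp⟩
  · have h1 : block (fun t (ω : ((Fin ns → ℝ) × (Fin n → Fin nw → ℝ)) × (Fin n → ℝ)) =>
        if ht : t < n then ω.2 ⟨t, ht⟩ else 0) n = fun ω => id ω.2 := by
      ext ω t; simp [block]
    have h2 : block (M.noise (fun ω : ((Fin ns → ℝ) × (Fin n → Fin nw → ℝ)) × (Fin n → ℝ) =>
        ω.1.1) fun t ω => drivingNoise ns nw n t ω.1) n =
        fun ω => block (M.noise Prod.fst (drivingNoise ns nw n)) n ω.1 := by
      ext ω t
      simp only [block]
      rw [noise_eq_canonical t.2]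
      congr 1
      ext s <;> simp [block, drivingNoise]
    rw [h1, h2]
    exact (indepFun_prod (measurable_block isDrivenBy_canonical.measurable_noise)
      measurable_id).symm

end NoiseModel

/-- Causal recursions have a solution. -/
lemma exists_causal_recursion {α : Type*} [Nonempty α] (F : ℕ → (ℕ → α) → α)
    (hF : ∀ t x x', (∀ s < t, x s = x' s) → F t x = F t x') :
    ∃ x : ℕ → α, ∀ t, x t = F t x := by
  classical
  let x : ℕ → α := Nat.strongRec fun t ih =>
    F t fun s => if h : s < t then ih s h else Classical.arbitrary α
  have hx : ∀ t, x t = F t fun s => if s < t then x s else Classical.arbitrary α := fun t => by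
    have h1 : x t = F t fun s => if h : s < t then x s else Classical.arbitrary α := by
      simp only [x]; rw [Nat.strongRec_eq]
    rw [h1]; rfl
  refine ⟨x, fun t => (hx t).trans (hF t _ _ fun s hs => by simp [hs])⟩

namespace NoiseModel

variable {ns nw n : ℕ} {Ω : Type*} {M : NoiseModel ns nw n} {S₁ : Ω → Fin ns → ℝ}
  {W : ℕ → Ω → Fin nw → ℝ} [MeasurableSpace Ω] {P : Measure Ω}

omit [MeasurableSpace Ω] in
lemma block_output_congr {X X' : ℕ → Ω → ℝ} {t : ℕ} (h : ∀ s < t, X s = X' s) :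
    block (M.output S₁ W X) t = block (M.output S₁ W X') t := by
  ext ω j
  simp only [block, output]
  rw [h j j.2]

lemma estEst_congr {X X' : ℕ → Ω → ℝ} {t : ℕ} (h : ∀ s < t, X s = X' s) :
    M.estEst P S₁ W X t = M.estEst P S₁ W X' t := by
  unfold estEst predict pastSigma
  rw [block_output_congr h]

lemma independent_of_hasLaw_pi [IsProbabilityMeasure P] {Z : ℕ → Ω → ℝ} {KZ : ℕ → ℝ≥0}
    (hZ : HasLaw (block Z n) (Measure.pi fun t : Fin n => gaussianReal 0 (KZ t)) P) :
    (∀ t < n, HasLaw (Z t) (gaussianReal 0 (KZ t)) P) ∧ iIndepFun (fun t : Fin n => Z t) P := by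
  have hlaw : ∀ t : Fin n, HasLaw (Z t) (gaussianReal 0 (KZ t)) P := fun t =>
    (measurePreserving_eval (fun t : Fin n => gaussianReal 0 (KZ t)) t).hasLaw.fun_comp hZ
  refine ⟨fun t ht => hlaw ⟨t, ht⟩, ?_⟩
  rw [iIndepFun_iff_map_fun_eq_pi_map fun t => (hlaw t).aemeasurable]
  simp_rw [fun t => (hlaw t).map_eq]
  exact hZ.map_eq

lemma measurable_dotProduct_comp {k : ℕ} (c : Fin k → ℝ) {f : Ω → Fin k → ℝ}
    (hf : Measurable f) : Measurable fun ω => c ⬝ᵥ f ω := by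
  have : Measurable fun v => c ⬝ᵥ v := by unfold dotProduct; fun_prop
  exact this.comp hf

/-- The input is defined recursively from the noise and an independent Gaussian vector. -/
lemma exists_generates (M : NoiseModel ns nw n) {π : InputKernels ns} (hπ : IsGaussianInput n π) :
    ∃ (Ω : Type) (_ : MeasurableSpace Ω) (P : Measure Ω) (_ : IsProbabilityMeasure P)
      (S₁ : Ω → Fin ns → ℝ) (W : ℕ → Ω → Fin nw → ℝ) (X : ℕ → Ω → ℝ),
      M.IsDrivenBy P S₁ W ∧ M.Generates P S₁ W π X := by
  obtain ⟨a, L, g, KZ, hK⟩ := hπ.exists_coeff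
  obtain ⟨Ω, _, P, _, S₁, W, Z, h, hZm, hZ, hZV⟩ :=
    M.exists_isDrivenBy (Measure.pi fun t : Fin n => gaussianReal 0 (KZ t))
  obtain ⟨X, hX⟩ := exists_causal_recursion (fun t (X : ℕ → Ω → ℝ) ω => L t ⬝ᵥ M.est P S₁ W t ω +
    (a t + g t ⬝ᵥ block (M.output S₁ W X) t ω) + Z t ω) fun t X X' hXX => by
      rw [block_output_congr hXX]
  have hXm : ∀ t, t < n → Measurable (X t) := by
    intro t
    induction t using Nat.strong_induction_on with
    | _ t ih =>
      intro ht
      rw [hX t]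
      exact ((measurable_dotProduct_comp _ (h.measurable_est ht.le)).add
        ((measurable_dotProduct_comp _ (measurable_block fun j hj => (ih j hj (by omega)).add
          (h.measurable_noise j (by omega)))).const_add _)).add (hZm t)
  have hA : M.IsAffineInput P S₁ W L KZ
      (fun t ω => a t + g t ⬝ᵥ block (M.output S₁ W X) t ω) Z X :=
    ⟨hXm, fun t _ => hZm t, (independent_of_hasLaw_pi hZ).1, (independent_of_hasLaw_pi hZ).2, hZV,
      fun t _ => ⟨a t, g t, by rfl⟩, fun t _ => by rw [hX t]⟩
  exact ⟨Ω, _, P, ‹_›, S₁, W, X, h, hA.generates h (fun t _ => by rfl) hK⟩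

/-- The process exists: the estimate of `Ŝ_t` depends on the earlier inputs only, so the recursion
is causal. -/
lemma exists_isSuffStatInput (M : NoiseModel ns nw n) (L : ℕ → Fin ns → ℝ) (KZ : ℕ → ℝ≥0) :
    ∃ (Ω : Type) (_ : MeasurableSpace Ω) (P : Measure Ω) (_ : IsProbabilityMeasure P)
      (S₁ : Ω → Fin ns → ℝ) (W : ℕ → Ω → Fin nw → ℝ) (Z X : ℕ → Ω → ℝ),
      M.IsDrivenBy P S₁ W ∧ M.IsSuffStatInput P S₁ W L KZ Z X := by
  obtain ⟨Ω, _, P, _, S₁, W, Z, h, hZm, hZ, hZV⟩ :=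
    M.exists_isDrivenBy (Measure.pi fun t : Fin n => gaussianReal 0 (KZ t))
  obtain ⟨X, hX⟩ := exists_causal_recursion (fun t (X : ℕ → Ω → ℝ) ω =>
    L t ⬝ᵥ (M.est P S₁ W t ω - M.estEst P S₁ W X t ω) + Z t ω) fun t X X' hXX => by
      rw [estEst_congr hXX]
  have hXm : ∀ t, t < n → Measurable (X t) := by
    intro t
    induction t using Nat.strong_induction_on with
    | _ t ih =>
      intro ht
      have h1 : Measurable (M.estEst P S₁ W X t) := (stronglyMeasurable_predict (fun j hj =>
        (ih j hj (by omega)).add (h.measurable_noise j (by omega))) _).measurable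
      rw [hX t]
      exact (measurable_dotProduct_comp _ ((h.measurable_est ht.le).sub h1)).add (hZm t)
  exact ⟨Ω, _, P, ‹_›, S₁, W, Z, X, h, hXm, fun t _ => hZm t, (independent_of_hasLaw_pi hZ).1,
    (independent_of_hasLaw_pi hZ).2, hZV, fun t _ => by rw [hX t]⟩

end NoiseModel

/-! ### The maximum defining the Cover-Pombra capacity -/

section Compactness

variable {n : ℕ} {K KV : Matrix (Fin n) (Fin n) ℝ} {κ : ℝ}

lemma Matrix.PosSemidef.apply_self_le_trace (hK : K.PosSemidef) (i : Fin n) :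
    K i i ≤ K.trace :=
  Finset.single_le_sum (f := fun i => K i i) (fun _ _ => hK.diag_nonneg) (Finset.mem_univ i)

lemma Matrix.PosSemidef.abs_apply_le_trace (hK : K.PosSemidef) (i j : Fin n) :
    |K i j| ≤ K.trace := by
  have hs : K j i = K i j := by simpa using hK.isHermitian.apply i j
  have h1 := hK.dotProduct_mulVec_nonneg (Pi.single i 1 + Pi.single j 1)
  have h2 := hK.dotProduct_mulVec_nonneg (Pi.single i 1 - Pi.single j 1)
  simp only [star_trivial, mulVec_add, mulVec_sub, dotProduct_add, dotProduct_sub, add_dotProduct,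
    sub_dotProduct, mulVec_single_one, single_one_dotProduct, col_apply, hs] at h1 h2
  have h3 := hK.apply_self_le_trace i
  have h4 := hK.apply_self_le_trace j
  rw [abs_le]
  constructor <;> linarith

/-- The Cauchy-Schwarz inequality for a positive definite form and its dual. -/
lemma Matrix.PosDef.sq_apply_le (hKV : KV.PosDef) (x : Fin n → ℝ) (j : Fin n) :
    x j ^ 2 ≤ (KV⁻¹ j j + 1) * (x ⬝ᵥ KV *ᵥ x) := by
  have hc : 0 ≤ KV⁻¹ j j := hKV.posSemidef.inv.diag_nonneg
  set c := KV⁻¹ j j with hcdef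
  have hdet : IsUnit KV.det := (isUnit_iff_isUnit_det KV).1 hKV.isUnit
  have hsymm : KVᵀ = KV := by simpa [IsHermitian, conjTranspose] using hKV.isHermitian
  set w : Fin n → ℝ := KV⁻¹ *ᵥ Pi.single j 1 with hw
  have hKw : KV *ᵥ w = Pi.single j 1 := by
    rw [hw, mulVec_mulVec, mul_nonsing_inv _ hdet, one_mulVec]
  have hwK : w ⬝ᵥ KV *ᵥ x = x j := by
    rw [dotProduct_mulVec, ← mulVec_transpose, hsymm, hKw, single_one_dotProduct]
  have hwj : w j = c := by rw [hw, mulVec_single_one, col_apply]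
  set s := x j / (c + 1) with hs
  have h1 := hKV.posSemidef.dotProduct_mulVec_nonneg (x - s • w)
  simp only [star_trivial, mulVec_sub, mulVec_smul, dotProduct_sub, sub_dotProduct,
    dotProduct_smul, smul_dotProduct, hwK, hKw, dotProduct_single_one,
    Pi.sub_apply, Pi.smul_apply, hwj, smul_eq_mul] at h1
  have h2 : s * (c + 1) = x j := by rw [hs]; field_simp
  rw [← h2] at h1 ⊢
  have hc1 : 0 ≤ c + 1 := by linarith
  nlinarith [mul_nonneg hc1 h1, mul_nonneg (sq_nonneg s) hc1]

lemma det_add_one_of_strictLower {B : Matrix (Fin n) (Fin n) ℝ} (hB : ∀ i j, i ≤ j → B i j = 0) :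
    (B + 1).det = 1 := by
  rw [Matrix.det_of_isLowerTriangular]
  · exact Finset.prod_eq_one fun i _ => by simp [hB i i le_rfl]
  · intro i j hij
    have hij' : i < j := hij
    simp [hB i j hij'.le, hij'.ne]

/-- `B + 1` is unimodular, so the output covariance is nonsingular whatever the input. -/
lemma det_output_pos (hKV : KV.PosDef) (hK : K.PosSemidef) {B : Matrix (Fin n) (Fin n) ℝ}
    (hB : ∀ i j, i ≤ j → B i j = 0) : 0 < ((B + 1) * KV * (B + 1)ᵀ + K).det := by
  have h1 : ((B + 1) * KV * (B + 1)ᵀ).PosSemidef := by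
    rw [← conjTranspose_eq_transpose_of_trivial]
    exact hKV.posSemidef.mul_mul_conjTranspose_same (B + 1)
  have h2 : ((B + 1) * KV * (B + 1)ᵀ).PosDef := by
    rw [h1.posDef_iff_det_ne_zero, det_mul, det_mul, det_transpose, det_add_one_of_strictLower hB]
    simpa using hKV.det_pos.ne'
  exact (h2.add_posSemidef hK).det_pos

/-- The pairs `(B, K_Z)` of power at most `κ`. -/
def coverPombraInputs (KV : Matrix (Fin n) (Fin n) ℝ) (κ : ℝ) :
    Set (Matrix (Fin n) (Fin n) ℝ × Matrix (Fin n) (Fin n) ℝ) :=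
  {p | (∀ i j, i ≤ j → p.1 i j = 0) ∧ p.2.PosSemidef ∧
    (n : ℝ)⁻¹ * (p.1 * KV * p.1ᵀ + p.2).trace ≤ κ}

lemma isClosed_posSemidef : IsClosed {K : Matrix (Fin n) (Fin n) ℝ | K.PosSemidef} := by
  have h1 : {K : Matrix (Fin n) (Fin n) ℝ | K.PosSemidef} =
      {K | Kᵀ = K} ∩ ⋂ x : Fin n → ℝ, {K | 0 ≤ x ⬝ᵥ K *ᵥ x} := by
    ext K
    simp only [Set.mem_ofPred_eq, Set.mem_inter_iff, Set.mem_iInter,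
      posSemidef_iff_dotProduct_mulVec, star_trivial, IsHermitian,
      conjTranspose_eq_transpose_of_trivial]
  rw [h1]
  refine (isClosed_eq continuous_id.matrix_transpose continuous_id).inter
    (isClosed_iInter fun x => isClosed_le continuous_const ?_)
  exact continuous_const.dotProduct (continuous_id.matrix_mulVec continuous_const)

/-- The power constraint bounds `K_Z` through its trace, and `B` through the definiteness of the
noise covariance. -/
lemma isCompact_coverPombraInputs (hn : 0 < n) (hKV : KV.PosDef) :
    IsCompact (coverPombraInputs KV κ) := by
  set c := (n * κ) with hc
  set C := 1 + (KV⁻¹.trace + 1) * c with hC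
  let box : Set (Matrix (Fin n) (Fin n) ℝ) := Set.pi Set.univ fun _ => Set.pi Set.univ fun _ =>
    Set.Icc (-(C + c)) (C + c)
  have hbox : IsCompact box := isCompact_univ_pi fun _ => isCompact_univ_pi fun _ => isCompact_Icc
  refine (hbox.prod hbox).of_isClosed_subset ?_ ?_
  · have h1 : IsClosed {p : Matrix (Fin n) (Fin n) ℝ × Matrix (Fin n) (Fin n) ℝ |
        ∀ i j, i ≤ j → p.1 i j = 0} := by
      simp only [Set.ofPred_forall]
      exact isClosed_iInter fun i => isClosed_iInter fun j => isClosed_iInter fun _ =>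
        isClosed_eq (continuous_fst.matrix_elem i j) continuous_const
    have h2 : IsClosed {p : Matrix (Fin n) (Fin n) ℝ × Matrix (Fin n) (Fin n) ℝ |
        (n : ℝ)⁻¹ * (p.1 * KV * p.1ᵀ + p.2).trace ≤ κ} := by
      refine isClosed_le (continuous_const.mul (Continuous.matrix_trace ?_)) continuous_const
      exact ((continuous_fst.matrix_mul continuous_const).matrix_mul
        continuous_fst.matrix_transpose).add continuous_snd
    exact h1.inter ((isClosed_posSemidef.preimage continuous_snd).inter h2)
  · rintro ⟨B, K⟩ ⟨-, hK, hp⟩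
    simp only at hK hp
    have hBpsd : (B * KV * Bᵀ).PosSemidef := by
      rw [← conjTranspose_eq_transpose_of_trivial]
      exact hKV.posSemidef.mul_mul_conjTranspose_same B
    have hn' : (0 : ℝ) < n := by exact_mod_cast hn
    rw [trace_add, inv_mul_le_iff₀ hn'] at hp
    have hKt := hK.trace_nonneg
    have hBt := hBpsd.trace_nonneg
    have hc0 : 0 ≤ c := by linarith
    have hinv := hKV.posSemidef.inv.trace_nonneg
    have hC0 : 0 ≤ C := by positivity
    refine ⟨fun i _ j _ => ?_, fun i _ j _ => ?_⟩
    · have h1 := hKV.sq_apply_le (B i) j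
      have h2 : B i ⬝ᵥ KV *ᵥ B i = (B * KV * Bᵀ) i i := by
        rw [Matrix.mul_assoc]; rfl
      have h3 := hBpsd.apply_self_le_trace i
      have h4 := hKV.posSemidef.inv.apply_self_le_trace j
      have h5 : B i j ^ 2 ≤ (KV⁻¹.trace + 1) * c := by
        refine h1.trans (mul_le_mul (by linarith) (by rw [h2]; linarith) ?_ (by linarith))
        rw [h2]; exact hBpsd.diag_nonneg
      have h6 : |B i j| ≤ C + c := by
        have := abs_nonneg (B i j)
        nlinarith [sq_abs (B i j), sq_nonneg (|B i j| - 1)]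
      exact abs_le.1 h6
    · have h1 := hK.abs_apply_le_trace i j
      exact abs_le.1 (by linarith : |K i j| ≤ C + c)

/-- The maximum defining the capacity is attained, by compactness. -/
lemma isGreatest_ftfiCapacity (hn : 0 < n) (hKV : KV.PosDef) (hκ : 0 ≤ κ) :
    IsGreatest (coverPombraRates KV κ) (ftfiCapacity KV κ) := by
  let f : Matrix (Fin n) (Fin n) ℝ × Matrix (Fin n) (Fin n) ℝ → ℝ := fun p =>
    1 / 2 * Real.log (((p.1 + 1) * KV * (p.1 + 1)ᵀ + p.2).det / KV.det)
  have himage : coverPombraRates KV κ = f '' coverPombraInputs KV κ := by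
    ext r
    constructor
    · rintro ⟨B, K, h1, h2, h3, h4⟩
      exact ⟨(B, K), ⟨h1, h2, h3⟩, h4.symm⟩
    · rintro ⟨⟨B, K⟩, ⟨h1, h2, h3⟩, h4⟩
      exact ⟨B, K, h1, h2, h3, h4.symm⟩
  have hf : ContinuousOn f (coverPombraInputs KV κ) := by
    refine continuousOn_const.mul (ContinuousOn.log ?_ fun p hp => ?_)
    · refine ContinuousOn.div_const (Continuous.continuousOn (Continuous.matrix_det ?_)) _
      exact (((continuous_fst.add continuous_const).matrix_mul continuous_const).matrix_mul
        (continuous_fst.add continuous_const).matrix_transpose).add continuous_snd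
    · exact (div_pos (det_output_pos hKV hp.2.1 hp.1) hKV.det_pos).ne'
  have hne : (coverPombraInputs KV κ).Nonempty :=
    ⟨(0, 0), by simp, PosSemidef.zero, by simpa using hκ⟩
  have hcomp := (isCompact_coverPombraInputs (κ := κ) hn hKV).image_of_continuousOn hf
  obtain ⟨r, hr⟩ := hcomp.exists_isGreatest (hne.image f)
  rw [ftfiCapacity, himage, hr.csSup_eq]
  exact hr

end Compactness

/-! ### Linear inputs and the filter for the output -/

namespace NoiseModel

variable {ns nw n : ℕ} {Ω : Type*} {M : NoiseModel ns nw n} {S₁ : Ω → Fin ns → ℝ}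
  {W : ℕ → Ω → Fin nw → ℝ} [MeasurableSpace Ω] {P : Measure Ω}

/-- The innovations of the noise have positive variances, hence so has the determinant. -/
lemma IsDrivenBy.noiseCov_posDef [IsProbabilityMeasure P] (h : M.IsDrivenBy P S₁ W) :
    (M.noiseCov P S₁ W).PosDef := by
  obtain ⟨G, hG, hS, hW⟩ := h.exists_gaussianSpace
  have hV : ∀ t < n, M.noise S₁ W t ∈ G := fun t ht => noise_mem_of hS fun s hs => hW s (by omega)
  have hpsd : (M.noiseCov P S₁ W).PosSemidef := by
    refine PosSemidef.of_dotProduct_mulVec_nonneg ?_ fun x => ?_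
    · ext i j
      simp only [conjTranspose_apply, star_trivial, noiseCov, Matrix.of_apply]
      exact covariance_comm _ _
    · have h1 := covariance_mulVec hG (u := block (M.noise S₁ W) n)
        (w := block (M.noise S₁ W) n) (fun i => hV i i.2) (fun i => hV i i.2) x x
      rw [star_trivial]
      have h2 : x ⬝ᵥ M.noiseCov P S₁ W *ᵥ x = cov[fun ω => x ⬝ᵥ block (M.noise S₁ W) n ω,
        fun ω => x ⬝ᵥ block (M.noise S₁ W) n ω; P] := h1.symm
      rw [h2, covariance_self (hG.gauss _ (dotProduct_mem (f := block (M.noise S₁ W) n)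
        (fun i => hV i i.2) x)).aemeasurable]
      exact variance_nonneg _ _
  rw [hpsd.posDef_iff_det_ne_zero, h.det_noiseCov]
  exact Finset.prod_ne_zero_iff.2 fun t ht => (h.KIhat_pos (Finset.mem_range.1 ht)).ne'

/-- The covariances of linear functions of the noise with additional uncorrelated terms. -/
lemma covariance_linear_add {G : Submodule ℝ (Ω → ℝ)} (hG : IsGaussianSpace P G)
    {V Q : Ω → Fin n → ℝ} (hV : ∀ i, (fun ω => V ω i) ∈ G) (hQ : ∀ i, (fun ω => Q ω i) ∈ G)
    (hVQ : ∀ i j, cov[fun ω => V ω i, fun ω => Q ω j; P] = 0) {x y : Ω → ℝ} {a a' : ℝ}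
    {b c : Fin n → ℝ} {i j : Fin n} (hx : x =ᵐ[P] fun ω => a + (b ⬝ᵥ V ω + Q ω i))
    (hy : y =ᵐ[P] fun ω => a' + (c ⬝ᵥ V ω + Q ω j)) :
    cov[x, y; P] = b ⬝ᵥ (Matrix.of fun i j => cov[fun ω => V ω i, fun ω => V ω j; P]) *ᵥ c +
      cov[fun ω => Q ω i, fun ω => Q ω j; P] := by
  have := hG.isProbabilityMeasure
  have hdot := fun b => dotProduct_mem hV b
  have horth : ∀ (b : Fin n → ℝ) k, cov[fun ω => b ⬝ᵥ V ω, fun ω => Q ω k; P] = 0 :=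
    fun b k => by
      rw [covariance_comm]
      exact (dotProduct_mem (G := orthTo P hG (hQ k))
        (fun i => ⟨hV i, by rw [covariance_comm]; exact hVQ i k⟩) b).2
  have hsum : ∀ b k, (fun ω => b ⬝ᵥ V ω + Q ω k) ∈ G := fun b k => G.add_mem (hdot b) (hQ k)
  have hbi : (fun ω => b ⬝ᵥ V ω + Q ω i) = (fun ω => b ⬝ᵥ V ω) + fun ω => Q ω i := rfl
  have hcj : (fun ω => c ⬝ᵥ V ω + Q ω j) = (fun ω => c ⬝ᵥ V ω) + fun ω => Q ω j := rfl
  rw [covariance_congr_ae hx hy, covariance_const_add_left (hG.integrable (hsum b i)),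
    covariance_const_add_right (hG.integrable (hsum c j)), hbi,
    covariance_add_left (hG.memLp (hdot b)) (hG.memLp (hQ i)) (hG.memLp (hsum c j)), hcj,
    covariance_add_right (hG.memLp (hdot b)) (hG.memLp (hdot c)) (hG.memLp (hQ j)),
    covariance_add_right (hG.memLp (hQ i)) (hG.memLp (hdot c)) (hG.memLp (hQ j)), horth b j,
    covariance_comm (fun ω => Q ω i), horth c i, covariance_mulVec hG hV hV]
  ring

/-- The Cover-Pombra rate and power of a linear input, through the filter for the output. -/
lemma IsFilterInput.coverPombra_eq [IsProbabilityMeasure P] {G : Submodule ℝ (Ω → ℝ)}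
    {L : ℕ → Fin ns → ℝ} {KZ : ℕ → ℝ≥0} {R ζ X : ℕ → Ω → ℝ}
    (hX : M.IsFilterInput P S₁ W G L KZ R ζ X) (h : M.IsDrivenBy P S₁ W)
    {B K : Matrix (Fin n) (Fin n) ℝ} {a : Fin n → ℝ} {Q : Ω → Fin n → ℝ}
    (hQ : ∀ i, (fun ω => Q ω i) ∈ G)
    (hVQ : ∀ i j : Fin n, cov[M.noise S₁ W i, fun ω => Q ω j; P] = 0)
    (hQQ : ∀ i j, cov[fun ω => Q ω i, fun ω => Q ω j; P] = K i j)
    (hrepr : ∀ t : Fin n, X t =ᵐ[P]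
      fun ω => a t + (B t ⬝ᵥ block (M.noise S₁ W) n ω + Q ω t)) :
    1 / 2 * Real.log (((B + 1) * M.noiseCov P S₁ W * (B + 1)ᵀ + K).det /
      (M.noiseCov P S₁ W).det) =
      1 / 2 * ∑ t ∈ Finset.range n, Real.log (M.KI L KZ t / M.KIhat t) ∧
    (B * M.noiseCov P S₁ W * Bᵀ + K).trace = ∑ t ∈ Finset.range n, Var[X t; P] := by
  have hG := hX.gauss
  have hV : ∀ i : Fin n, (fun ω => block (M.noise S₁ W) n ω i) ∈ G := fun i =>
    hX.noise_mem i i.2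
  have hentry : ∀ (D : Matrix (Fin n) (Fin n) ℝ) (i j : Fin n),
      (D * M.noiseCov P S₁ W * Dᵀ) i j = D i ⬝ᵥ (Matrix.of fun i j =>
        cov[fun ω => block (M.noise S₁ W) n ω i, fun ω => block (M.noise S₁ W) n ω j; P]) *ᵥ
        D j := fun D i j => by rw [Matrix.mul_assoc]; rfl
  constructor
  · have hY : ∀ t : Fin n, M.output S₁ W X t =ᵐ[P] fun ω =>
        a t + ((B + 1) t ⬝ᵥ block (M.noise S₁ W) n ω + Q ω t) := fun t => by
      filter_upwards [hrepr t] with ω h1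
      have h2 : (B + 1) t ⬝ᵥ block (M.noise S₁ W) n ω =
          B t ⬝ᵥ block (M.noise S₁ W) n ω + M.noise S₁ W t ω := by
        have h3 : (1 : Matrix (Fin n) (Fin n) ℝ) t ⬝ᵥ block (M.noise S₁ W) n ω =
            M.noise S₁ W t ω := by
          change ((1 : Matrix (Fin n) (Fin n) ℝ) *ᵥ block (M.noise S₁ W) n ω) t = _
          rw [one_mulVec]; rfl
        rw [← h3, ← add_dotProduct]; rfl
      rw [output, h1, h2]; ring
    have h1 : (B + 1) * M.noiseCov P S₁ W * (B + 1)ᵀ + K =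
        Matrix.of fun i j : Fin n => cov[M.output S₁ W X i, M.output S₁ W X j; P] := by
      ext i j
      rw [Matrix.of_apply, covariance_linear_add hG hV hQ hVQ (hY i) (hY j), Matrix.add_apply,
        hentry, hQQ]
    rw [h1, det_covariance_eq_prod_var_innov hG (hX.measurable_output h) hX.output_mem,
      h.det_noiseCov, Fin.prod_univ_eq_prod_range
        (fun t => Var[innov P (M.output S₁ W X) t; P]), ← Finset.prod_div_distrib,
      Real.log_prod]
    · congr 1
      exact Finset.sum_congr rfl fun t ht => by
        rw [(hX.filter_step h (Finset.mem_range.1 ht)).2.2.1]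
    · intro t ht
      have ht := Finset.mem_range.1 ht
      rw [(hX.filter_step h ht).2.2.1]
      exact (div_pos (hX.filter_step h ht).1 (h.KIhat_pos ht)).ne'
  · rw [← Fin.sum_univ_eq_sum_range (fun t => Var[X t; P]), Matrix.trace]
    refine Finset.sum_congr rfl fun t _ => ?_
    rw [← covariance_self (hG.gauss _ (hX.mem_X t t.2)).aemeasurable,
      covariance_linear_add hG hV hQ hVQ (hrepr t) (hrepr t), Matrix.diag_apply,
      Matrix.add_apply, hentry, hQQ]

/-- Any causal Gaussian input is an input for the filter for the output: regress `X_t` on the past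
of the output and on the error `Ŝ_t - E{Ŝ_t | Y^{t-1}}`, and let `ζ_t` be the residual. The
residuals at different times need not be uncorrelated, which the filter does not require. -/
lemma exists_isFilterInput [IsProbabilityMeasure P] (h : M.IsDrivenBy P S₁ W)
    {G : Submodule ℝ (Ω → ℝ)} (hG : IsGaussianSpace P G) {X : ℕ → Ω → ℝ}
    (hXm : ∀ t < n, Measurable (X t)) (hV : ∀ t < n, M.noise S₁ W t ∈ G)
    (hX : ∀ t < n, X t ∈ G)
    (hI : ∀ t < n, ∀ s ≤ t, cov[innov P (M.noise S₁ W) t, X s; P] = 0) :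
    ∃ (L : ℕ → Fin ns → ℝ) (KZ : ℕ → ℝ≥0) (R ζ : ℕ → Ω → ℝ),
      M.IsFilterInput P S₁ W G L KZ R ζ X := by
  set V := M.noise S₁ W with hVdef
  set Y := M.output S₁ W X with hYdef
  have hVm := h.measurable_noise
  have hYm : ∀ t < n, Measurable (Y t) := fun t ht => (hXm t ht).add (hVm t ht)
  have hY : ∀ t < n, Y t ∈ G := fun t ht => G.add_mem (hX t ht) (hV t ht)
  have hest : ∀ t ≤ n, ∀ i, (fun ω => M.est P S₁ W t ω i) ∈ G := fun t ht i =>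
    affSpan_block_le hG (fun j hj => hV j (by omega)) (h.est_mem ht i)
  have hee : ∀ t ≤ n, ∀ i, (fun ω => M.estEst P S₁ W X t ω i) ∈ affSpan P (block Y t) :=
    fun t ht => predict_apply_mem hG (fun j hj => hYm j (by omega))
      (fun j hj => hY j (by omega)) (hest t ht)
  have heeG : ∀ t ≤ n, ∀ i, (fun ω => M.estEst P S₁ W X t ω i) ∈ G := fun t ht i =>
    affSpan_block_le hG (fun j hj => hY j (by omega)) (hee t ht i)
  have he : ∀ t ≤ n, ∀ i, (fun ω => M.est P S₁ W t ω i - M.estEst P S₁ W X t ω i) ∈ G :=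
    fun t ht i => G.sub_mem (hest t ht i) (heeG t ht i)
  have hreg : ∀ t, ∃ g : Fin ns → ℝ, t < n → ∀ i,
      cov[fun ω => X t ω - g ⬝ᵥ (M.est P S₁ W t ω - M.estEst P S₁ W X t ω),
        fun ω => M.est P S₁ W t ω i - M.estEst P S₁ W X t ω i; P] = 0 := fun t => by
    by_cases ht : t < n
    · obtain ⟨g, hg⟩ := exists_sub_affine_orthogonal hG
        (u := fun ω => M.est P S₁ W t ω - M.estEst P S₁ W X t ω) (he t ht.le) (hX t ht)
      exact ⟨g, fun _ => hg⟩
    · exact ⟨0, fun h => absurd h ht⟩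
  choose L hL using hreg
  set p : ℕ → Ω → ℝ := fun t => predict P Y t (X t) with hp
  set D : ℕ → Ω → ℝ := fun t ω =>
    L t ⬝ᵥ (M.est P S₁ W t ω - M.estEst P S₁ W X t ω) with hD
  set ζ : ℕ → Ω → ℝ := fun t => X t - p t - D t with hζ
  have hpmem : ∀ t < n, p t ∈ affSpan P (block Y t) := fun t ht =>
    predict_mem hG (fun j hj => hYm j (by omega)) (fun j hj => hY j (by omega)) (hX t ht)
  have hpG : ∀ t < n, p t ∈ G := fun t ht =>
    affSpan_block_le hG (fun j hj => hY j (by omega)) (hpmem t ht)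
  have hDmem : ∀ {H : Submodule ℝ (Ω → ℝ)} (t : ℕ),
      (∀ i, (fun ω => M.est P S₁ W t ω i - M.estEst P S₁ W X t ω i) ∈ H) → D t ∈ H :=
    fun t hH => dotProduct_mem (f := fun ω => M.est P S₁ W t ω - M.estEst P S₁ W X t ω) hH (L t)
  have hDG : ∀ t < n, D t ∈ G := fun t ht => hDmem t (he t ht.le)
  have hζG : ∀ t < n, ζ t ∈ G := fun t ht =>
    G.sub_mem (G.sub_mem (hX t ht) (hpG t ht)) (hDG t ht)
  have hζY : ∀ t < n, ∀ j < t, cov[ζ t, Y j; P] = 0 := fun t ht j hj => by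
    have hYj := hY j (by omega)
    have h1 : X t - p t ∈ orthTo P hG hYj := ⟨G.sub_mem (hX t ht) (hpG t ht), by
      rw [covariance_comm]
      exact cov_sub_predict hG (fun j hj => hYm j (by omega)) (fun j hj => hY j (by omega))
        (hX t ht) (mem_affSpan_block Y hj)⟩
    have h2 : D t ∈ orthTo P hG hYj := hDmem t fun i => ⟨he t ht.le i, by
      rw [covariance_comm]
      exact cov_sub_predict_apply hG (fun j hj => hYm j (by omega)) (fun j hj => hY j (by omega))
        (hest t ht.le) i (mem_affSpan_block Y hj)⟩
    rw [covariance_comm]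
    exact ((orthTo P hG hYj).sub_mem h1 h2).2
  refine ⟨L, fun t => Var[ζ t; P].toNNReal,
    fun t ω => p t ω - L t ⬝ᵥ M.estEst P S₁ W X t ω, ζ, ?_⟩
  refine ⟨hXm, hG, hV, hX, hζG, fun t ht => ?_, fun t ht => ?_, fun t ht => ?_, fun t ht => ?_,
    hζY, fun t ht i => ?_, fun t ht => ?_, fun t ht j hj => ?_⟩
  · exact Submodule.sub_mem _ (hpmem t ht) (dotProduct_mem (hee t ht.le) (L t))
  · filter_upwards with ω
    simp only [hζ, hD, Pi.sub_apply, dotProduct_sub]; ring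
  · have h1 : ∫ ω, p t ω ∂P = ∫ ω, X t ω ∂P :=
      integral_predict (fun j hj => hYm j (by omega)) (X t)
    have h2 : ∫ ω, D t ω ∂P = 0 := by
      have hi : ∀ i, Integrable (fun ω => (M.est P S₁ W t ω - M.estEst P S₁ W X t ω) i) P :=
        fun i => hG.integrable (he t ht.le i)
      simp only [hD, dotProduct]
      rw [integral_finsetSum _ fun i _ => (hi i).const_mul _]
      refine Finset.sum_eq_zero fun i _ => ?_
      rw [integral_const_mul]
      exact mul_eq_zero_of_right _ (integral_sub_predict_apply hG
        (fun j hj => hYm j (by omega)) (hest t ht.le) i)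
    rw [hζ, integral_sub' (hG.integrable (G.sub_mem (hX t ht) (hpG t ht)))
      (hG.integrable (hDG t ht)), integral_sub' (hG.integrable (hX t ht))
      (hG.integrable (hpG t ht)), h1, h2]
    ring
  · rw [covariance_self (hG.gauss _ (hζG t ht)).aemeasurable,
      Real.coe_toNNReal _ (variance_nonneg _ _)]
  · -- `Ŝ_t` is the sum of its prediction from the output and of the error
    have hei := he t ht.le i
    have h1 : X t - D t ∈ orthTo P hG hei := ⟨G.sub_mem (hX t ht) (hDG t ht), by
      rw [covariance_comm]; exact hL t ht i⟩
    have h2 : p t ∈ orthTo P hG hei := ⟨hpG t ht,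
      cov_sub_predict_apply hG (fun j hj => hYm j (by omega)) (fun j hj => hY j (by omega))
        (hest t ht.le) i (hpmem t ht)⟩
    have h3 : ζ t ∈ orthTo P hG hei := by
      have : ζ t = X t - D t - p t := by simp only [hζ]; abel
      rw [this]; exact Submodule.sub_mem _ h1 h2
    have h4 : (fun ω => M.est P S₁ W t ω i - M.estEst P S₁ W X t ω i) ∈
        orthTo P hG (hζG t ht) := ⟨hei, by rw [covariance_comm]; exact h3.2⟩
    have h5 : (fun ω => M.estEst P S₁ W X t ω i) ∈ orthTo P hG (hζG t ht) :=
      (isGaussianSpace_orthTo hG (hζG t ht)).affSpan_le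
        (fun j => ⟨hY j (by omega), hζY t ht j j.2⟩) (hee t ht.le i)
    have h6 := ((orthTo P hG (hζG t ht)).add_mem h4 h5).2
    convert h6 using 2
    ext ω; simp
  · have hIG : innov P V t ∈ G := innov_mem hG hVm hV ht
    have hVo : ∀ j < t, V j ∈ orthTo P hG hIG := fun j hj =>
      ⟨hV j (by omega), cov_innov hG hVm hV ht (mem_affSpan_block V hj)⟩
    have hXo : ∀ j ≤ t, X j ∈ orthTo P hG hIG := fun j hj => ⟨hX j (by omega), hI t ht j hj⟩
    have hH := isGaussianSpace_orthTo hG hIG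
    have hYo : affSpan P (block Y t) ≤ orthTo P hG hIG :=
      affSpan_block_le hH fun j hj => Submodule.add_mem _ (hXo j hj.le) (hVo j hj)
    have h1 : D t ∈ orthTo P hG hIG := hDmem t fun i =>
      (orthTo P hG hIG).sub_mem (affSpan_block_le hH hVo (h.est_mem ht.le i))
        (hYo (hee t ht.le i))
    rw [covariance_comm]
    exact ((orthTo P hG hIG).sub_mem ((orthTo P hG hIG).sub_mem (hXo t le_rfl)
      (hYo (hpmem t ht))) h1).2
  · have hIG : innov P V t ∈ G := innov_mem hG hVm hV ht
    have h1 : X j ∈ orthTo P hG hIG := ⟨hX j (by omega), hI t ht j hj.le⟩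
    have h2 : V j ∈ orthTo P hG hIG :=
      ⟨hV j (by omega), cov_innov hG hVm hV ht (mem_affSpan_block V hj)⟩
    exact ((orthTo P hG hIG).add_mem h1 h2).2

end NoiseModel

/-! ### The four sets of rates coincide -/

namespace NoiseModel

variable {ns nw n : ℕ} {Ω : Type*} {M : NoiseModel ns nw n} {S₁ : Ω → Fin ns → ℝ}
  {W : ℕ → Ω → Fin nw → ℝ} [MeasurableSpace Ω] {P : Measure Ω} {κ : ℝ}

/-- The rate of a linear input is attained by Riccati coefficients with at most the same power:
realize the input and regress it. -/
lemma IsDrivenBy.coverPombraRates_subset [IsProbabilityMeasure P] (h : M.IsDrivenBy P S₁ W) :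
    coverPombraRates (M.noiseCov P S₁ W) κ ⊆ M.riccatiRates κ := by
  rintro r ⟨B, K, hB, hK, hpow, rfl⟩
  have := isProbabilityMeasure_map_ofLp 0 K
  obtain ⟨Ω', _, P', _, S', W', Z, h', hZm, hZ, hZV⟩ :=
    M.exists_isDrivenBy ((multivariateGaussian 0 K).map WithLp.ofLp)
  have hcov : M.noiseCov P S₁ W = M.noiseCov P' S' W' := by rw [h.noiseCov_eq, h'.noiseCov_eq]
  rw [hcov] at hpow ⊢
  set V := M.noise S' W' with hVdef
  have hVm := h'.measurable_noise
  have hZlaw := hasLaw_ofLp.2 hZ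
  obtain ⟨G₀, hG₀, hS, hW⟩ := h'.exists_gaussianSpace
  have hVgauss : HasGaussianLaw (block V n) P' :=
    hG₀.hasGaussianLaw (measurable_block hVm).aemeasurable
      (memVec_pi_real fun j => noise_mem_of hS fun s hs => hW s (by omega))
  have hG := isGaussianSpace_gaussSpan
    (hZV.symm.hasGaussianLaw hVgauss (hasGaussianLaw_of_toLp (m := 0) hZlaw))
  have hmem := memVec_gaussSpan (P := P') fun ω => (block V n ω, block Z n ω)
  set G := gaussSpan P' fun ω => (block V n ω, block Z n ω)
  have hVG : ∀ t < n, V t ∈ G := fun t ht => hmem.fst.eval ⟨t, ht⟩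
  have hZG : ∀ t < n, Z t ∈ G := fun t ht => hmem.snd.eval ⟨t, ht⟩
  let b : ℕ → Fin n → ℝ := fun t => if ht : t < n then B ⟨t, ht⟩ else 0
  let X : ℕ → Ω' → ℝ := fun t ω => b t ⬝ᵥ block V n ω + Z t ω
  -- the input at time `t` is a combination of the noise before `t` and of `Z_t`
  have hXmem : ∀ {H : Submodule ℝ (Ω' → ℝ)} (t : ℕ), t < n → (∀ j < t, V j ∈ H) → Z t ∈ H →
      X t ∈ H := by
    intro H t ht hVH hZH
    have h1 : (fun ω => b t ⬝ᵥ block V n ω) = ∑ j : Fin n, b t j • V j := by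
      ext ω; simp [dotProduct, block]
    have h2 : (fun ω => b t ⬝ᵥ block V n ω) ∈ H := by
      rw [h1]
      refine H.sum_mem fun j _ => ?_
      by_cases hj : (j : ℕ) < t
      · exact H.smul_mem _ (hVH j hj)
      · have : b t j = 0 := by
          simp only [b, ht, dif_pos]
          exact hB _ _ (Fin.mk_le_of_le_val (by omega))
        rw [this, zero_smul]; exact H.zero_mem
    exact H.add_mem h2 hZH
  have hXm : ∀ t < n, Measurable (X t) := fun t _ =>
    (measurable_dotProduct_comp _ (measurable_block hVm)).add (hZm t)
  have hVZ : ∀ i < n, ∀ j < n, cov[V i, Z j; P'] = 0 := fun i hi j hj =>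
    (hZV.symm.comp (φ := fun v : Fin n → ℝ => v ⟨i, hi⟩) (ψ := fun z : Fin n → ℝ => z ⟨j, hj⟩)
      (by fun_prop) (by fun_prop)).covariance_eq_zero (hG.memLp (hVG i hi)) (hG.memLp (hZG j hj))
  have hI : ∀ t < n, ∀ s ≤ t, cov[innov P' V t, X s; P'] = 0 := by
    intro t ht s hs
    have hIG : innov P' V t ∈ G := innov_mem hG hVm hVG ht
    have hZs : s < n := by omega
    have h1 : innov P' V t ∈ orthTo P' hG (hZG s hZs) :=
      innov_mem (isGaussianSpace_orthTo _ _) hVm (fun j hj => ⟨hVG j hj, by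
        rw [covariance_comm]; exact hVZ j hj s hZs⟩) ht
    refine (hXmem (H := orthTo P' hG hIG) s hZs (fun j hj => ⟨hVG j (by omega),
      cov_innov hG hVm hVG ht (mem_affSpan_block V (by omega))⟩) ⟨hZG s hZs, ?_⟩).2
    rw [covariance_comm]; exact h1.2
  obtain ⟨L, KZ, R, ζ, hF⟩ := exists_isFilterInput h' hG hXm hVG
    (fun t ht => hXmem t ht (fun j hj => hVG j (by omega)) (hZG t ht)) hI
  obtain ⟨hrate, hpower⟩ := hF.coverPombra_eq h' (B := B) (K := K) (a := 0) (Q := block Z n)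
    (fun i => hZG i i.2) (fun i j => hVZ i i.2 j j.2)
    (fun i j => covariance_of_toLp (m := 0) hK hZlaw i j)
    (fun t => by filter_upwards with ω; simp [X, b, block]; rfl)
  refine ⟨L, KZ, le_trans ?_ hpow, hrate⟩
  rw [hpower]
  refine mul_le_mul_of_nonneg_left (Finset.sum_le_sum fun t ht => ?_) (by positivity)
  rw [(hF.integral_sq_input h' (Finset.mem_range.1 ht)).1]
  linarith [variance_nonneg (IsFilterInput.outputPart M P' S' W' L R X t) P']

/-- An affine input is, step by step, a linear function of the past of the noise and of the input
noise. -/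
lemma IsAffineInput.exists_linear {L : ℕ → Fin ns → ℝ} {KZ : ℕ → ℝ≥0} {R Z X : ℕ → Ω → ℝ}
    (hX : M.IsAffineInput P S₁ W L KZ R Z X) (h : M.IsDrivenBy P S₁ W) {t : ℕ} (ht : t < n) :
    ∃ (a : ℝ) (b g : Fin n → ℝ), (∀ j : Fin n, t ≤ j → b j = 0) ∧
      X t =ᵐ[P] fun ω => a + (b ⬝ᵥ block (M.noise S₁ W) n ω + g ⬝ᵥ block Z n ω) := by
  have hG := hX.isGaussianSpace h
  set V := M.noise S₁ W with hV
  set H := affSpan P (block V t) ⊔ affSpan P (block Z n) with hHdef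
  have hHG : H ≤ space n P V Z := sup_le
    (affSpan_block_le hG fun j hj => noise_mem_space (by omega))
    (affSpan_block_le hG fun j hj => inputNoise_mem_space hj)
  have hH : IsGaussianSpace P H := by
    refine ⟨fun f hf => hG.gauss f (hHG hf),
      fun c => Submodule.mem_sup_left (const_mem_affSpan _ c), fun f hf g hfg => ?_⟩
    obtain ⟨f₁, h₁, f₂, h₂, rfl⟩ := Submodule.mem_sup.1 hf
    refine Submodule.mem_sup.2 ⟨f₁, h₁, g - f₁, affSpan_congr h₂ ?_, by abel⟩
    filter_upwards [hfg] with ω hω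
    rw [Pi.sub_apply, ← hω, Pi.add_apply]; ring
  have hXH : X t ∈ H := input_mem_of h hH hX.mem_R hX.repr ht
    (fun s hs => Submodule.mem_sup_left (mem_affSpan_block V hs))
    fun s hs => Submodule.mem_sup_right (mem_affSpan_block Z (by omega))
  obtain ⟨f₁, ⟨a₁, b, h₁⟩, f₂, ⟨a₂, g, h₂⟩, hf⟩ := Submodule.mem_sup.1 hXH
  refine ⟨a₁ + a₂, fun j => if hj : (j : ℕ) < t then b ⟨j, hj⟩ else 0, g,
    fun j hj => dif_neg (by omega), ?_⟩
  filter_upwards [h₁, h₂] with ω h₁ h₂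
  have h3 : (fun j : Fin n => if hj : (j : ℕ) < t then b ⟨j, hj⟩ else 0) ⬝ᵥ block V n ω =
      b ⬝ᵥ block V t ω := by
    rw [dotProduct_block ht.le, dotProduct]
    refine Finset.sum_congr rfl fun j _ => ?_
    by_cases hj : (j : ℕ) < t <;> simp [hj, block]
  rw [← hf, Pi.add_apply, h₁, h₂, h3]; ring

/-- An input in terms of the sufficient statistic is a linear input. -/
lemma IsDrivenBy.riccatiRates_subset [IsProbabilityMeasure P] (h : M.IsDrivenBy P S₁ W) :
    M.riccatiRates κ ⊆ coverPombraRates (M.noiseCov P S₁ W) κ := by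
  rintro r ⟨L, KZ, hpow, rfl⟩
  obtain ⟨Ω', _, P', _, S', W', Z, X, h', hX⟩ := M.exists_isSuffStatInput L KZ
  have hcov : M.noiseCov P S₁ W = M.noiseCov P' S' W' := by rw [h.noiseCov_eq, h'.noiseCov_eq]
  rw [hcov]
  have hA := hX.isAffineInput h'
  have hF := hA.isFilterInput h'
  choose a b g hb hrepr using fun t : Fin n => hA.exists_linear h' t.2
  let B : Matrix (Fin n) (Fin n) ℝ := Matrix.of b
  let Γ : Matrix (Fin n) (Fin n) ℝ := Matrix.of g
  let D : Matrix (Fin n) (Fin n) ℝ := Matrix.diagonal fun t => (KZ t : ℝ)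
  have hZG : ∀ i : Fin n, (fun ω => block Z n ω i) ∈
      IsAffineInput.space n P' (M.noise S' W') Z := fun i =>
    IsAffineInput.inputNoise_mem_space i.2
  have hcovZ : (Matrix.of fun i j : Fin n =>
      cov[fun ω => block Z n ω i, fun ω => block Z n ω j; P']) = D := by
    ext i j
    by_cases hij : i = j
    · subst hij
      simp only [Matrix.of_apply, D, Matrix.diagonal_apply_eq]
      exact hF.cov_ζ i i.2
    · simp only [Matrix.of_apply, D, Matrix.diagonal_apply_ne _ hij]
      exact hA.cov_inputNoise_inputNoise h' i.2 j.2 (by simpa [Fin.ext_iff] using hij)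
  obtain ⟨hrate, hpower⟩ := hF.coverPombra_eq h' (B := B) (K := Γ * D * Γᵀ) (a := a)
    (Q := fun ω => Γ *ᵥ block Z n ω) (fun i => mulVec_mem hZG Γ i)
    (fun i j => (mulVec_mem (G := orthTo P' hF.gauss (hF.noise_mem i i.2)) (f := block Z n)
      (fun k => ⟨hZG k, by
        rw [covariance_comm]; exact hA.cov_inputNoise_noise h' k.2 i.2⟩) Γ j).2)
    (fun i j => by
      rw [Matrix.mul_assoc]
      exact (covariance_mulVec hF.gauss hZG hZG (Γ i) (Γ j)).trans (by rw [hcovZ]; rfl))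
    hrepr
  refine ⟨B, Γ * D * Γᵀ, fun i j hij => hb i j hij, ?_, ?_, hrate.symm⟩
  · rw [← conjTranspose_eq_transpose_of_trivial]
    have hD : D.PosSemidef := PosSemidef.diagonal fun t => (KZ t).2
    exact hD.mul_mul_conjTranspose_same Γ
  · rw [hpower]
    refine le_of_eq_of_le ?_ hpow
    congr 1
    refine Finset.sum_congr rfl fun t ht => ?_
    rw [(hF.integral_sq_input h' (Finset.mem_range.1 ht)).1, outputPart_eq_zero]
    simp [← covariance_self aemeasurable_const]

lemma suffStatRates_eq : M.suffStatRates κ = M.riccatiRates κ := by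
  ext r
  constructor
  · rintro ⟨L, KZ, Ω', _, P', _, S', W', Z, X, h', hX, hpow, rfl⟩
    refine ⟨L, KZ, ?_, ?_⟩
    · rwa [← (hX.feedbackFilterClaims h').power_eq]
    · rw [((hX.isAffineInput h').isFilterInput h').sum_log_variance h']
      rfl
  · rintro ⟨L, KZ, hpow, rfl⟩
    obtain ⟨Ω', _, P', _, S', W', Z, X, h', hX⟩ := M.exists_isSuffStatInput L KZ
    refine ⟨L, KZ, Ω', _, P', ‹_›, S', W', Z, X, h', hX, ?_, ?_⟩
    · rwa [(hX.feedbackFilterClaims h').power_eq]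
    · rw [((hX.isAffineInput h').isFilterInput h').sum_log_variance h']
      rfl

/-- General Gaussian inputs reach no other rates, as the part that depends on the past of the output
only costs power. -/
lemma inputRates_eq : M.inputRates κ = M.riccatiRates κ := by
  ext r
  constructor
  · rintro ⟨Ω', _, P', _, S', W', π, X, h', hπ, hX, hpow, rfl⟩
    obtain ⟨a, L, g, KZ, Z, -, hA⟩ := hX.exists_isAffineInput h' hπ
    have hF := hA.isFilterInput h'
    refine ⟨L, KZ, le_trans ?_ hpow, hF.inputRate_eq h'⟩
    rw [hF.avgPower_eq h', le_add_iff_nonneg_right]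
    exact mul_nonneg (by positivity) (Finset.sum_nonneg fun t _ =>
      integral_nonneg fun ω => sq_nonneg _)
  · rintro ⟨L, KZ, hpow, rfl⟩
    obtain ⟨Ω', _, P', _, S', W', Z, X, h', hX⟩ := M.exists_isSuffStatInput L KZ
    obtain ⟨π, hπ, hgen⟩ := (hX.feedbackFilterClaims h').in_class
    refine ⟨Ω', _, P', ‹_›, S', W', π, X, h', hπ, hgen, ?_, ?_⟩
    · rwa [(hX.feedbackFilterClaims h').power_eq]
    · rw [((hX.isAffineInput h').isFilterInput h').inputRate_eq h']
      rfl

/-- The error covariance at time `t` depends on the variances of the input noise before `t`. -/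
lemma KFb_congr {L : ℕ → Fin ns → ℝ} {KZ KZ' : ℕ → ℝ≥0} {t : ℕ} (h : ∀ s < t, KZ s = KZ' s) :
    M.KFb L KZ t = M.KFb L KZ' t := by
  induction t with
  | zero => rfl
  | succ t ih => simp only [KFb, outVarOf, ih fun s hs => h s (by omega), h t (by omega)]

/-- Power spent on a function of the past of the output would be better spent on the last input
noise variance. -/
lemma IsFilterInput.outputPart_eq_zero_of_optimal [IsProbabilityMeasure P] (hn : 0 < n)
    {G : Submodule ℝ (Ω → ℝ)} {L : ℕ → Fin ns → ℝ} {KZ : ℕ → ℝ≥0} {R ζ X : ℕ → Ω → ℝ}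
    (hX : M.IsFilterInput P S₁ W G L KZ R ζ X) (h : M.IsDrivenBy P S₁ W)
    (hpow : avgPower P n X ≤ κ)
    (hopt : M.inputRate P S₁ W X ∈ upperBounds (M.riccatiRates κ)) {t : ℕ} (ht : t < n) :
    outputPart M P S₁ W L R X t =ᵐ[P] 0 := by
  set ρ := outputPart M P S₁ W L R X with hρ
  set δ := ∑ t ∈ Finset.range n, ∫ ω, ρ t ω ^ 2 ∂P with hδ
  have hnonneg : ∀ t ∈ Finset.range n, 0 ≤ ∫ ω, ρ t ω ^ 2 ∂P := fun t _ =>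
    integral_nonneg fun ω => sq_nonneg _
  have hδ0 : 0 ≤ δ := Finset.sum_nonneg hnonneg
  have hρG : ∀ t < n, ρ t ∈ G := fun t ht =>
    affSpan_block_le hX.gauss (fun j hj => hX.output_mem j (by omega)) (hX.outputPart_mem h ht)
  rcases hδ0.eq_or_lt with h0 | hpos
  · have h1 := (Finset.sum_eq_zero_iff_of_nonneg hnonneg).1 h0.symm t (Finset.mem_range.2 ht)
    rw [integral_eq_zero_iff_of_nonneg (fun ω => sq_nonneg _)
      (hX.gauss.memLp (hρG t ht)).integrable_sq] at h1
    filter_upwards [h1] with ω hω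
    simpa using hω
  · exfalso
    obtain ⟨m, rfl⟩ : ∃ m, n = m + 1 := ⟨n - 1, by omega⟩
    let KZ' : ℕ → ℝ≥0 := Function.update KZ m (KZ m + δ.toNNReal)
    have hlt : ∀ s < m, KZ' s = KZ s := fun s hs => Function.update_of_ne hs.ne _ _
    have hm : (KZ' m : ℝ) = KZ m + δ := by
      simp [KZ', Real.coe_toNNReal _ hδ0]
    have hK : ∀ s ≤ m, M.KFb L KZ' s = M.KFb L KZ s := fun s hs =>
      KFb_congr fun r hr => hlt r (by omega)
    have hpow' : ((m + 1 : ℕ) : ℝ)⁻¹ * ∑ t ∈ Finset.range (m + 1),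
        (L t ⬝ᵥ M.KFb L KZ' t *ᵥ L t + KZ' t) ≤ κ := by
      refine le_trans (le_of_eq ?_) hpow
      rw [hX.avgPower_eq h, ← mul_add]
      congr 1
      rw [Finset.sum_range_succ, Finset.sum_range_succ _ m, hm, hK m le_rfl,
        Finset.sum_congr rfl fun s hs => by
          rw [hK s (Finset.mem_range.1 hs).le, hlt s (Finset.mem_range.1 hs)]]
      ring
    have hle := hopt ⟨L, KZ', hpow', rfl⟩
    rw [hX.inputRate_eq h, Finset.sum_range_succ, Finset.sum_range_succ _ m, hm, hK m le_rfl,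
      Finset.sum_congr rfl fun s hs => by
        rw [hK s (Finset.mem_range.1 hs).le, hlt s (Finset.mem_range.1 hs)]] at hle
    have h1 := (hX.filter_step h (Nat.lt_succ_self m)).1
    have h2 := h.KIhat_pos (Nat.lt_succ_self m)
    have h3 : Real.log (M.KI L KZ m / M.KIhat m) <
        Real.log (((L m + M.C m) ⬝ᵥ M.KFb L KZ m *ᵥ (L m + M.C m) + M.KIhat m + (KZ m + δ)) /
          M.KIhat m) := by
      refine Real.log_lt_log (div_pos h1 h2) ((div_lt_div_iff_of_pos_right h2).2 ?_)
      rw [KI, outVarOf]; linarith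
    have h4 : ∀ s, M.KI L KZ s = (L s + M.C s) ⬝ᵥ M.KFb L KZ s *ᵥ (L s + M.C s) +
        M.KIhat s + KZ s := fun s => rfl
    simp only [h4] at hle h3
    linarith

end NoiseModel

theorem theorem2 {ns nw n : ℕ} (hn : 0 < n) (M : NoiseModel ns nw n) (κ : ℝ) (hκ : 0 ≤ κ)
    {Ω : Type*} [MeasurableSpace Ω] (P : Measure Ω) [IsProbabilityMeasure P]
    (S₁ : Ω → Fin ns → ℝ) (W : ℕ → Ω → Fin nw → ℝ) (hnoise : M.IsDrivenBy P S₁ W) :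
    -- the filter for the noise
    M.NoiseFilterClaims P S₁ W ∧
    -- the maximum defining the capacity exists
    IsGreatest (coverPombraRates (M.noiseCov P S₁ W) κ) (ftfiCapacity (M.noiseCov P S₁ W) κ) ∧
    -- (a) inputs distributed according to `P_t(dx_t | ŝ_t, y^{t-1})`
    IsGreatest (M.inputRates κ) (ftfiCapacity (M.noiseCov P S₁ W) κ) ∧
    (∀ π : NoiseModel.InputKernels ns, NoiseModel.IsGaussianInput n π →
      ∃ (Ω' : Type) (_ : MeasurableSpace Ω') (P' : Measure Ω') (_ : IsProbabilityMeasure P')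
        (S₁' : Ω' → Fin ns → ℝ) (W' : ℕ → Ω' → Fin nw → ℝ) (X' : ℕ → Ω' → ℝ),
        M.IsDrivenBy P' S₁' W' ∧ M.Generates P' S₁' W' π X') ∧
    (∀ (π : NoiseModel.InputKernels ns) (X : ℕ → Ω → ℝ), NoiseModel.IsGaussianInput n π →
      M.Generates P S₁ W π X → M.InducedLawClaims P S₁ W π X) ∧
    -- (b) optimal inputs are functions of the sufficient statistic
    (∀ (π : NoiseModel.InputKernels ns) (X : ℕ → Ω → ℝ), NoiseModel.IsGaussianInput n π →
      M.Generates P S₁ W π X → avgPower P n X ≤ κ →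
      M.inputRate P S₁ W X = ftfiCapacity (M.noiseCov P S₁ W) κ →
      ∃ (L : ℕ → Fin ns → ℝ) (KZ : ℕ → ℝ≥0) (Z : ℕ → Ω → ℝ),
        M.IsSuffStatInput P S₁ W L KZ Z X) ∧
    (∀ (L : ℕ → Fin ns → ℝ) (KZ : ℕ → ℝ≥0),
      ∃ (Ω' : Type) (_ : MeasurableSpace Ω') (P' : Measure Ω') (_ : IsProbabilityMeasure P')
        (S₁' : Ω' → Fin ns → ℝ) (W' : ℕ → Ω' → Fin nw → ℝ) (Z' X' : ℕ → Ω' → ℝ),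
        M.IsDrivenBy P' S₁' W' ∧ M.IsSuffStatInput P' S₁' W' L KZ Z' X') ∧
    (∀ (L : ℕ → Fin ns → ℝ) (KZ : ℕ → ℝ≥0) (Z X : ℕ → Ω → ℝ),
      M.IsSuffStatInput P S₁ W L KZ Z X → M.FeedbackFilterClaims P S₁ W L KZ Z X) ∧
    -- (c) the capacity through the innovations, and through the two Riccati equations
    IsGreatest (M.suffStatRates κ) (ftfiCapacity (M.noiseCov P S₁ W) κ) ∧
    IsGreatest (M.riccatiRates κ) (ftfiCapacity (M.noiseCov P S₁ W) κ) := by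
  have hmax := isGreatest_ftfiCapacity hn hnoise.noiseCov_posDef hκ
  have hric : IsGreatest (M.riccatiRates κ) (ftfiCapacity (M.noiseCov P S₁ W) κ) := by
    rwa [← (hnoise.coverPombraRates_subset (κ := κ)).antisymm hnoise.riccatiRates_subset]
  refine ⟨hnoise.noiseFilterClaims, hmax, by rwa [NoiseModel.inputRates_eq],
    fun π hπ => M.exists_generates hπ, fun π X hπ hX => ?_, fun π X hπ hX hpow hopt => ?_,
    M.exists_isSuffStatInput, fun L KZ Z X hX => hX.feedbackFilterClaims hnoise,
    by rwa [NoiseModel.suffStatRates_eq], hric⟩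
  · obtain ⟨a, L, g, KZ, Z, hK, hA⟩ := hX.exists_isAffineInput hnoise hπ
    exact hA.inducedLawClaims hnoise (fun t _ => by rfl) hK
  · obtain ⟨a, L, g, KZ, Z, -, hA⟩ := hX.exists_isAffineInput hnoise hπ
    have hF := hA.isFilterInput hnoise
    refine ⟨L, KZ, Z, hA.meas_X, hA.meas_Z, hA.law_Z, hA.indep_Z, hA.indep_ZV, fun t ht => ?_⟩
    filter_upwards [hF.repr_outputPart ht,
      hF.outputPart_eq_zero_of_optimal hn hnoise hpow (hopt ▸ hric.2) ht] with ω h1 h2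
    rw [h1, h2, Pi.zero_apply, add_zero]
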